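/- Let $n\ge 2$, $d=n+1$, and let $(M^{d},[g])$ be a smooth manifold with a conformal class $[g]=\{e^{2\omega}g\}$ of smooth Riemannian metrics. For $w\in\mathbb R$ let $\mathcal E[w]$ be the line bundle of conformal densities of weight $w$: a section $\sigma$ is represented in the scale $g$ by a function $\sigma_g$, with $\sigma_{e^{2\omega}g}=e^{w\omega}\sigma_g$. Let $\boldsymbol g$ be the conformal metric, a section of $S^2T^*M\otimes\mathcal E[2]$. For a metric $g$ in the class let $\nabla$ be its Levi-Civita connection, $\Delta=-g^{ab}\nabla_a\nabla_b$, and let the Schouten tensor $P$ and its trace $J=g^{ab}P_{ab}$ be given by $\mathrm{Ric}=(d-2)P+Jg$. The standard tractor bundle $\mathcal T$ is the quotient of the 2-jet bundle $J^2\mathcal E[1]$ by the trace-free part $S^2_0T^*M\otimes\mathcal E[1]$ of $S^2T^*M\otimes\mathcal E[1]\subset J^2\mathcal E[1]$. The operator $D:\mathcal E[1]\to\mathcal T$ is $j^2$ followed by the projection. Each $g$ in the class gives an isomorphism $\mathcal T\cong\mathcal E[1]\oplus T^*M[1]\oplus\mathcal E[-1]$ in which $D\sigma=(\sigma,\nabla_a\sigma,\tfrac1d(\Delta\sigma-J\sigma))$.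 In it the canonical tractor $X:\mathcal E[-1]\to\mathcal T$, viewed as a section of $\mathcal T\otimes\mathcal E[1]$, is $(0,0,1)$, the tractor metric is $h((\sigma,\mu,\rho),(\sigma,\mu,\rho))=\boldsymbol g^{-1}(\mu,\mu)+2\sigma\rho$, and the normal tractor connection is $$\nabla^{\mathcal T}_a(\sigma,\mu_b,\rho)=(\nabla_a\sigma-\mu_a,\ \nabla_a\mu_b+\boldsymbol g_{ab}\rho+P_{ab}\sigma,\ \nabla_a\rho-P_{ab}\mu^b);$$ write $|I|^2=h(I,I)$. A directed almost Einstein structure on $(M,[g])$ is a smooth section $\sigma\not\equiv0$ of $\mathcal E[1]$ for which the trace-free part of $\nabla_a\nabla_b\sigma+P_{ab}\sigma$ vanishes. A directed almost scalar constant structure is a smooth section $\sigma\not\equiv0$ of $\mathcal E[1]$ for which $S([g],\sigma)=\tfrac2d\,\sigma(J-\Delta)\sigma-|\nabla\sigma|^2_{\boldsymbol g}$ is constant. (All these notions may be computed in any metric of the class.) Then: 1. $\sigma\mapsto D\sigma$ is a bijection from the directed almost Einstein structures on $(M,[g])$ onto the smooth parallel sections $I\not\equiv0$ of $\mathcal T$,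 with inverse $I\mapsto\sigma:=h(I,X)$. 2. If $I\not\equiv0$ is a smooth parallel section of $\mathcal T$ and $\sigma:=h(I,X)$, then $S([g],\sigma)=-|I|^2$, and if $M$ is connected this is constant, so that $(M,[g],\sigma)$ is almost scalar constant. 3. In the situation of 2, on the open set where $\sigma\ne0$ the metric $g^o:=\sigma^{-2}\boldsymbol g$ is Einstein, with $\mathrm{Ric}^{g^o}=-n\,|I|^2\,g^o$. -/

import Mathlib

open scoped Manifold ContDiff Topology
open Bundle

noncomputable section

namespace Tractor

/-! ### Tensor calculus in coordinates

`G : E → Matrix` is the matrix field of a metric in local coordinates on `E = ℝᵈ`. -/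

/-- The model space `ℝᵈ`. -/
abbrev Model (d : ℕ) : Type := EuclideanSpace ℝ (Fin d)

/-- The standard basis of `ℝᵈ`. -/
abbrev stdVec {d : ℕ} (i : Fin d) : Model d := EuclideanSpace.single i (1 : ℝ)

/-- The partial derivative `∂ᵢ u`. -/
def pd {d : ℕ} (i : Fin d) (u : Model d → ℝ) (y : Model d) : ℝ := fderiv ℝ u y (stdVec i)

/-- Christoffel symbols `Γᵏᵢⱼ` of the Levi-Civita connection. -/
def christoffel {d : ℕ} (G : Model d → Matrix (Fin d) (Fin d) ℝ) (k i j : Fin d) (y : Model d) : ℝ :=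
  1 / 2 * ∑ l, (G y)⁻¹ k l *
    (pd i (fun z => G z j l) y + pd j (fun z => G z i l) y - pd l (fun z => G z i j) y)

/-- The curvature `R_{ij}{}^k{}_l`, with `(∇ᵢ∇ⱼ - ∇ⱼ∇ᵢ) Vᵏ = R_{ij}{}^k{}_l Vˡ`. -/
def riemann {d : ℕ} (G : Model d → Matrix (Fin d) (Fin d) ℝ) (i j k l : Fin d) (y : Model d) : ℝ :=
  pd i (christoffel G k j l) y - pd j (christoffel G k i l) y +
    ∑ m, (christoffel G k i m y * christoffel G m j l y -
      christoffel G k j m y * christoffel G m i l y)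

/-- `Ric_{ij} = R_{ki}{}^k{}_j`. -/
def coordRicci {d : ℕ} (G : Model d → Matrix (Fin d) (Fin d) ℝ) (y : Model d) :
    Matrix (Fin d) (Fin d) ℝ :=
  Matrix.of fun i j => ∑ k, riemann G k i k j y

/-- The second covariant derivative `∇ᵢ∇ⱼ u` of a function. -/
def coordHess {d : ℕ} (G : Model d → Matrix (Fin d) (Fin d) ℝ) (u : Model d → ℝ) (y : Model d) :
    Matrix (Fin d) (Fin d) ℝ :=
  Matrix.of fun i j => pd i (pd j u) y - ∑ k, christoffel G k i j y * pd k u y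

/-- The covariant derivative `∇ᵢ μⱼ` of a one-form. -/
def coordCov {d : ℕ} (G : Model d → Matrix (Fin d) (Fin d) ℝ) (μ : Fin d → Model d → ℝ)
    (y : Model d) : Matrix (Fin d) (Fin d) ℝ :=
  Matrix.of fun i j => pd i (μ j) y - ∑ k, christoffel G k i j y * μ k y

/-! ### Tensors on a manifold

The components at `x` are taken in the preferred chart at `x`; its coordinate frame at `x` is the
standard basis of `TangentSpace (𝓡 d) x = ℝᵈ`. -/

section Manifold

variable {d : ℕ} {M : Type*} [TopologicalSpace M] [ChartedSpace (Model d) M]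

/-- Fields of (continuous) bilinear forms on the tangent spaces. -/
abbrev BilinField (d : ℕ) (M : Type*) [TopologicalSpace M] [ChartedSpace (Model d) M] :=
  ∀ x : M, TangentSpace (𝓡 d) x →L[ℝ] TangentSpace (𝓡 d) x →L[ℝ] ℝ

/-- The cotangent space `T*ₓM`. -/
abbrev Cotangent (d : ℕ) {M : Type*} [TopologicalSpace M] [ChartedSpace (Model d) M] (x : M) :=
  TangentSpace (𝓡 d) x →L[ℝ] ℝ

/-- The coordinate vector `∂ᵢ` at `x`, for the chart at `x`. -/
def frame (x : M) (i : Fin d) : TangentSpace (𝓡 d) x := (stdVec i : Model d)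

/-- The coordinates of a tangent vector at `x`, for the chart at `x`. -/
def coords {x : M} (v : TangentSpace (𝓡 d) x) (i : Fin d) : ℝ := (show Model d from v) i

/-- The coordinate representation of a function in the chart at `x`. -/
def chartFun (x : M) (f : M → ℝ) : Model d → ℝ := f ∘ (extChartAt (𝓡 d) x).symm

/-- The coordinates of `x` in the chart at `x`. -/
def origin (d : ℕ) {M : Type*} [TopologicalSpace M] [ChartedSpace (Model d) M] (x : M) : Model d :=
  extChartAt (𝓡 d) x x

/-- The coordinate vector field `∂ᵢ` of the chart at `x`, at the point with coordinates `y`. -/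
def chartVec (x : M) (i : Fin d) (y : Model d) :
    TangentSpace (𝓡 d) ((extChartAt (𝓡 d) x).symm y) :=
  mfderiv 𝓘(ℝ, Model d) (𝓡 d) (extChartAt (𝓡 d) x).symm y (stdVec i : Model d)

/-- The components of a bilinear form field in the chart at `x`. -/
def chartMetric (b : BilinField d M) (x : M) (y : Model d) : Matrix (Fin d) (Fin d) ℝ :=
  Matrix.of fun i j => b ((extChartAt (𝓡 d) x).symm y) (chartVec x i y) (chartVec x j y)

/-- The components of a one-form in the chart at `x`. -/
def chartForm (μ : ∀ x : M, Cotangent d x) (x : M) (i : Fin d) (y : Model d) : ℝ :=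
  μ ((extChartAt (𝓡 d) x).symm y) (chartVec x i y)

/-- The matrix `b_{ij}` at `x`. -/
def metricAt (b : BilinField d M) (x : M) : Matrix (Fin d) (Fin d) ℝ :=
  chartMetric b x (origin d x)

/-- The matrix `Ric_{ij}` at `x` of the metric `b`. -/
def ricciAt (b : BilinField d M) (x : M) : Matrix (Fin d) (Fin d) ℝ :=
  coordRicci (chartMetric b x) (origin d x)

/-- The `b`-trace `b^{ij} T_{ij}` at `x` of a 2-tensor. -/
def trace (b : BilinField d M) (x : M) (T : Matrix (Fin d) (Fin d) ℝ) : ℝ :=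
  ∑ i, ∑ j, (metricAt b x)⁻¹ i j * T i j

/-- The inner product `b^{ij} μᵢ νⱼ` of covectors at `x`. -/
def coInner (b : BilinField d M) (x : M) (μ ν : Cotangent d x) : ℝ :=
  ∑ i, ∑ j, (metricAt b x)⁻¹ i j * (μ (frame x i) * ν (frame x j))

/-- `J = Sc / (2 (d - 1))`, the trace of the Schouten tensor. -/
def schoutenTrace (b : BilinField d M) (x : M) : ℝ :=
  trace b x (ricciAt b x) / (2 * ((d : ℝ) - 1))

/-- The Schouten tensor `P`, given by `Ric = (d - 2) P + J b`. -/
def schouten (b : BilinField d M) (x : M) : Matrix (Fin d) (Fin d) ℝ :=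
  ((d : ℝ) - 2)⁻¹ • (ricciAt b x - schoutenTrace b x • metricAt b x)

/-- The second derivatives `∂ᵢ∂ⱼ f` at `x`. -/
def secondDeriv (f : M → ℝ) (x : M) : Matrix (Fin d) (Fin d) ℝ :=
  Matrix.of fun i j => pd i (pd j (chartFun x f)) (origin d x)

/-- The Hessian `∇ᵢ∇ⱼ f` at `x`. -/
def hess (b : BilinField d M) (f : M → ℝ) (x : M) : Matrix (Fin d) (Fin d) ℝ :=
  coordHess (chartMetric b x) (chartFun x f) (origin d x)

/-- The Laplacian with nonnegative spectrum, `Δ f = - b^{ij} ∇ᵢ∇ⱼ f`. -/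
def laplacian (b : BilinField d M) (f : M → ℝ) (x : M) : ℝ := - trace b x (hess b f x)

/-- The covariant derivative `∇ᵢ μⱼ` at `x` of a one-form. -/
def covForm (b : BilinField d M) (μ : ∀ x : M, Cotangent d x) (x : M) :
    Matrix (Fin d) (Fin d) ℝ :=
  coordCov (chartMetric b x) (chartForm μ x) (origin d x)

/-- The differential of a function at `x`, as a covector. -/
def diff (d : ℕ) {M : Type*} [TopologicalSpace M] [ChartedSpace (Model d) M] (f : M → ℝ) (x : M) :
    Cotangent d x :=
  mfderiv (𝓡 d) 𝓘(ℝ, ℝ) f x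

/-- The covector `w ↦ T_{ij} vⁱ wʲ` at `x`. -/
def contract (x : M) (T : Matrix (Fin d) (Fin d) ℝ) (v : TangentSpace (𝓡 d) x) : Cotangent d x :=
  (∑ j, (∑ i, coords v i * T i j) • (EuclideanSpace.proj j : Model d →L[ℝ] ℝ) : Model d →L[ℝ] ℝ)

/-- `A(b, s)`, the trace-free part of `∇∇s + s P`. -/
def obstructionA (b : BilinField d M) (s : M → ℝ) (x : M) : Matrix (Fin d) (Fin d) ℝ :=
  (hess b s x + s x • schouten b x) -
    ((d : ℝ)⁻¹ * trace b x (hess b s x + s x • schouten b x)) • metricAt b x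

/-- `S(b, s) = (2/d) s (J - Δ) s - |ds|²`. -/
def scalarS (b : BilinField d M) (s : M → ℝ) (x : M) : ℝ :=
  2 / (d : ℝ) * s x * (schoutenTrace b x * s x - laplacian b s x) -
    coInner b x (diff d s x) (diff d s x)

/-! ### Derivatives up to second order at a point -/

lemma contDiffAt_chartFun {x : M} {f : M → ℝ} (hf : ContMDiffAt (𝓡 d) 𝓘(ℝ, ℝ) ∞ f x) :
    ContDiffAt ℝ ∞ (chartFun x f) (origin d x) := by
  have := (contMDiffAt_iff_source (I := 𝓡 d)).1 hf
  rw [modelWithCornersSelf_coe, Set.range_id, contMDiffWithinAt_univ,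
    contMDiffAt_iff_contDiffAt] at this
  exact this

lemma chartFun_origin (x : M) (f : M → ℝ) : chartFun x f (origin d x) = f x := by
  simp [chartFun, origin]

lemma diff_frame {x : M} {f : M → ℝ} (hf : ContMDiffAt (𝓡 d) 𝓘(ℝ, ℝ) ∞ f x) (i : Fin d) :
    diff d f x (frame x i) = pd i (chartFun x f) (origin d x) := by
  have h := hf.mdifferentiableAt (by simp)
  rw [diff, h.mfderiv]
  simp [frame, pd, chartFun, origin, writtenInExtChartAt]
  rfl

lemma pd_add {i : Fin d} {u v : Model d → ℝ} {y : Model d} (hu : DifferentiableAt ℝ u y)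
    (hv : DifferentiableAt ℝ v y) : pd i (u + v) y = pd i u y + pd i v y := by
  simp [pd, fderiv_add hu hv]

lemma pd_smul {i : Fin d} {u : Model d → ℝ} {y : Model d} (r : ℝ)
    (hu : DifferentiableAt ℝ u y) : pd i (r • u) y = r * pd i u y := by
  simp [pd, fderiv_const_smul hu]

lemma pd_mul {i : Fin d} {u v : Model d → ℝ} {y : Model d} (hu : DifferentiableAt ℝ u y)
    (hv : DifferentiableAt ℝ v y) : pd i (u * v) y = u y * pd i v y + v y * pd i u y := by
  simp [pd, fderiv_mul hu hv]

lemma eventually_differentiableAt {u : Model d → ℝ} {y : Model d} (hu : ContDiffAt ℝ ∞ u y) :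
    ∀ᶠ z in 𝓝 y, DifferentiableAt ℝ u z := by
  have h1 : ContDiffAt ℝ 1 u y := hu.of_le (by exact_mod_cast le_top)
  filter_upwards [h1.eventually (by simp)] with z hz using hz.differentiableAt (by simp)

lemma differentiableAt_pd {u : Model d → ℝ} {y : Model d} (hu : ContDiffAt ℝ ∞ u y) (i : Fin d) :
    DifferentiableAt ℝ (pd i u) y := by
  have h2 : ContDiffAt ℝ 1 (fderiv ℝ u) y := hu.fderiv_right (m := 1) (by norm_cast)
  exact (h2.differentiableAt (by simp)).clm_apply (differentiableAt_const _)

lemma pd_congr {i : Fin d} {u v : Model d → ℝ} {y : Model d} (h : u =ᶠ[𝓝 y] v) :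
    pd i u y = pd i v y := by
  simp [pd, h.fderiv_eq]

lemma pd_pd_add {i j : Fin d} {u v : Model d → ℝ} {y : Model d} (hu : ContDiffAt ℝ ∞ u y)
    (hv : ContDiffAt ℝ ∞ v y) : pd i (pd j (u + v)) y = pd i (pd j u) y + pd i (pd j v) y := by
  rw [← pd_add (differentiableAt_pd hu j) (differentiableAt_pd hv j)]
  apply pd_congr
  filter_upwards [eventually_differentiableAt hu, eventually_differentiableAt hv] with z h1 h2
  exact pd_add h1 h2

lemma pd_pd_smul {i j : Fin d} {u : Model d → ℝ} {y : Model d} (r : ℝ)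
    (hu : ContDiffAt ℝ ∞ u y) : pd i (pd j (r • u)) y = r * pd i (pd j u) y := by
  rw [← pd_smul r (differentiableAt_pd hu j)]
  apply pd_congr
  filter_upwards [eventually_differentiableAt hu] with z h1
  exact pd_smul r h1

lemma pd_pd_mul {i j : Fin d} {a u : Model d → ℝ} {y : Model d} (ha : ContDiffAt ℝ ∞ a y)
    (hu : ContDiffAt ℝ ∞ u y) (h0 : u y = 0) (h1 : ∀ k, pd k u y = 0) :
    pd i (pd j (a * u)) y = a y * pd i (pd j u) y := by
  have h : pd j (a * u) =ᶠ[𝓝 y] a * pd j u + u * pd j a := by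
    filter_upwards [eventually_differentiableAt ha, eventually_differentiableAt hu] with z hz1 hz2
    simpa using pd_mul hz1 hz2
  have ha1 := ha.differentiableAt (by simp)
  have hu1 := hu.differentiableAt (by simp)
  rw [pd_congr h, pd_add (ha1.mul (differentiableAt_pd hu j)) (hu1.mul (differentiableAt_pd ha j)),
    pd_mul ha1 (differentiableAt_pd hu j), pd_mul hu1 (differentiableAt_pd ha j)]
  simp [h0, h1]

lemma frame_ne_zero [NeZero d] (x : M) : frame (d := d) x 0 ≠ 0 := by
  intro h0
  have : (stdVec (0 : Fin d) : Model d) = 0 := h0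
  simp [stdVec] at this

lemma diff_add {x : M} {f f' : M → ℝ} (hf : ContMDiffAt (𝓡 d) 𝓘(ℝ, ℝ) ∞ f x)
    (hf' : ContMDiffAt (𝓡 d) 𝓘(ℝ, ℝ) ∞ f' x) : diff d (f + f') x = diff d f x + diff d f' x :=
  mfderiv_add (hf.mdifferentiableAt (by simp)) (hf'.mdifferentiableAt (by simp))

lemma diff_mul {x : M} {f f' : M → ℝ} (hf : ContMDiffAt (𝓡 d) 𝓘(ℝ, ℝ) ∞ f x)
    (hf' : ContMDiffAt (𝓡 d) 𝓘(ℝ, ℝ) ∞ f' x) :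
    diff d (f * f') x = f x • diff d f' x + f' x • diff d f x :=
  ((hf.mdifferentiableAt (by simp)).hasMFDerivAt.mul
    (hf'.mdifferentiableAt (by simp)).hasMFDerivAt).mfderiv

lemma diff_smul {x : M} {f : M → ℝ} (r : ℝ) (hf : ContMDiffAt (𝓡 d) 𝓘(ℝ, ℝ) ∞ f x) :
    diff d (r • f) x = r • diff d f x :=
  const_smul_mfderiv (hf.mdifferentiableAt (by simp)) r

lemma secondDeriv_add {x : M} {f f' : M → ℝ} (hf : ContMDiffAt (𝓡 d) 𝓘(ℝ, ℝ) ∞ f x)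
    (hf' : ContMDiffAt (𝓡 d) 𝓘(ℝ, ℝ) ∞ f' x) :
    secondDeriv (d := d) (f + f') x = secondDeriv f x + secondDeriv f' x := by
  ext i j
  exact pd_pd_add (contDiffAt_chartFun hf) (contDiffAt_chartFun hf')

lemma secondDeriv_smul {x : M} {f : M → ℝ} (r : ℝ) (hf : ContMDiffAt (𝓡 d) 𝓘(ℝ, ℝ) ∞ f x) :
    secondDeriv (d := d) (r • f) x = r • secondDeriv f x := by
  ext i j
  exact pd_pd_smul r (contDiffAt_chartFun hf)

lemma trace_add (b : BilinField d M) (x : M) (T U : Matrix (Fin d) (Fin d) ℝ) :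
    trace b x (T + U) = trace b x T + trace b x U := by
  simp [trace, mul_add, Finset.sum_add_distrib]

lemma trace_smul (b : BilinField d M) (x : M) (r : ℝ) (T : Matrix (Fin d) (Fin d) ℝ) :
    trace b x (r • T) = r * trace b x T := by
  simp [trace, Finset.mul_sum, mul_left_comm]

lemma hess_eq {b : BilinField d M} {x : M} {f : M → ℝ}
    (hf : ContMDiffAt (𝓡 d) 𝓘(ℝ, ℝ) ∞ f x) :
    hess b f x = secondDeriv f x - Matrix.of fun i j =>
      ∑ k, christoffel (chartMetric b x) k i j (origin d x) * diff d f x (frame x k) := by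
  ext i j
  simp [hess, coordHess, secondDeriv, diff_frame hf]

lemma hess_add {b : BilinField d M} {x : M} {f f' : M → ℝ}
    (hf : ContMDiffAt (𝓡 d) 𝓘(ℝ, ℝ) ∞ f x) (hf' : ContMDiffAt (𝓡 d) 𝓘(ℝ, ℝ) ∞ f' x) :
    hess b (f + f') x = hess b f x + hess b f' x := by
  rw [hess_eq (hf.add hf'), hess_eq hf, hess_eq hf', secondDeriv_add hf hf', diff_add hf hf']
  ext i j
  simp [mul_add, Finset.sum_add_distrib]
  ring

lemma hess_smul {b : BilinField d M} {x : M} {f : M → ℝ} (r : ℝ)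
    (hf : ContMDiffAt (𝓡 d) 𝓘(ℝ, ℝ) ∞ f x) : hess b (r • f) x = r • hess b f x := by
  have hrf : ContMDiffAt (𝓡 d) 𝓘(ℝ, ℝ) ∞ (r • f) x := contMDiffAt_const.mul hf
  rw [hess_eq hrf, hess_eq hf, secondDeriv_smul r hf, diff_smul r hf]
  ext i j
  simp [mul_sub, Finset.mul_sum, mul_left_comm]

/-! ### Conformal structures and densities -/

variable [IsManifold (𝓡 d) ∞ M]

/-- Smooth Riemannian metrics. -/
abbrev Metric (d : ℕ) (M : Type*) [TopologicalSpace M] [ChartedSpace (Model d) M]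
    [IsManifold (𝓡 d) ∞ M] :=
  ContMDiffRiemannianMetric (𝓡 d) ∞ (Model d) (fun x : M => TangentSpace (𝓡 d) x)

/-- `g' = e^{2υ} g` for a smooth function `υ`. -/
def ConformallyRelated (g g' : Metric d M) : Prop :=
  ∃ υ : M → ℝ, ContMDiff (𝓡 d) 𝓘(ℝ, ℝ) ∞ υ ∧
    ∀ x v w, g'.inner x v w = Real.exp (2 * υ x) * g.inner x v w

/-- A conformal structure `[g]`: an equivalence class of conformally related metrics. -/
structure ConformalStructure (d : ℕ) (M : Type*) [TopologicalSpace M] [ChartedSpace (Model d) M]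
    [IsManifold (𝓡 d) ∞ M] where
  metrics : Set (Metric d M)
  nonempty : metrics.Nonempty
  mem_iff : ∀ g ∈ metrics, ∀ g', g' ∈ metrics ↔ ConformallyRelated g g'

/-- The fibre at `x` of the density bundle `ℰ[w]`: functions on the metrics of the conformal class
whose value depends on the metric at `x` only and is homogeneous, i.e. `φ(e^{2t} g) = e^{wt} φ(g)`.
-/
def Density (c : ConformalStructure d M) (w : ℝ) (x : M) : Submodule ℝ (c.metrics → ℝ) where
  carrier := {φ | ∀ g g' : c.metrics, ∀ t : ℝ,
    (∀ v u, g'.1.inner x v u = Real.exp (2 * t) * g.1.inner x v u) →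
      φ g' = Real.exp (w * t) * φ g}
  add_mem' {φ ψ} hφ hψ g g' t h := by simp [hφ g g' t h, hψ g g' t h, mul_add]
  zero_mem' := by simp
  smul_mem' r φ hφ g g' t h := by simp [hφ g g' t h]; ring

/-- The function that represents a section of `ℰ[w]` in the scale `g`. -/
def inScale {c : ConformalStructure d M} (g : c.metrics) (σ : M → c.metrics → ℝ) : M → ℝ :=
  fun x => σ x g

/-- The smooth sections of `ℰ[w]`. -/
def SmoothDensity (c : ConformalStructure d M) (w : ℝ) : Submodule ℝ (M → c.metrics → ℝ) where
  carrier := {σ | (∀ x, σ x ∈ Density c w x) ∧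
    ∀ g : c.metrics, ContMDiff (𝓡 d) 𝓘(ℝ, ℝ) ∞ (inScale g σ)}
  add_mem' hσ hτ := ⟨fun x => add_mem (hσ.1 x) (hτ.1 x), fun g => (hσ.2 g).add (hτ.2 g)⟩
  zero_mem' := ⟨fun _ => zero_mem _, fun _ => contMDiff_const⟩
  smul_mem' r _ hσ :=
    ⟨fun x => Submodule.smul_mem _ r (hσ.1 x), fun g => contMDiff_const.mul (hσ.2 g)⟩

/-- The sections of `ℰ[1]` that are smooth near `x`. -/
def LocalDensity (c : ConformalStructure d M) (x : M) : Submodule ℝ (M → c.metrics → ℝ) where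
  carrier := {σ | (∀ y, σ y ∈ Density c 1 y) ∧
    ∀ g : c.metrics, ∀ᶠ y in 𝓝 x, ContMDiffAt (𝓡 d) 𝓘(ℝ, ℝ) ∞ (inScale g σ) y}
  add_mem' hσ hτ := ⟨fun x => add_mem (hσ.1 x) (hτ.1 x), fun g => by
    filter_upwards [hσ.2 g, hτ.2 g] with y h1 h2 using h1.add h2⟩
  zero_mem' := ⟨fun _ => zero_mem _, fun _ => Filter.Eventually.of_forall fun _ => contMDiffAt_const⟩
  smul_mem' r _ hσ := ⟨fun x => Submodule.smul_mem _ r (hσ.1 x), fun g => by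
    filter_upwards [hσ.2 g] with y h1 using contMDiffAt_const.mul h1⟩

/-! ### The standard tractor bundle -/

section Tractor

variable {c : ConformalStructure d M}

lemma LocalDensity.smooth {x : M} (σ : LocalDensity c x) (g : c.metrics) :
    ContMDiffAt (𝓡 d) 𝓘(ℝ, ℝ) ∞ (inScale g σ.1) x :=
  (σ.2.2 g).self_of_nhds

/-- The local sections of `ℰ[1]` whose 2-jet at `x` vanishes. -/
def jetKernel (c : ConformalStructure d M) (x : M) : Submodule ℝ (LocalDensity c x) where
  carrier := {σ | ∀ g : c.metrics, inScale g σ.1 x = 0 ∧ diff d (inScale g σ.1) x = 0 ∧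
    secondDeriv (d := d) (inScale g σ.1) x = 0}
  add_mem' {σ τ} hσ hτ g := by
    obtain ⟨h1, h2, h3⟩ := hσ g
    obtain ⟨k1, k2, k3⟩ := hτ g
    have e : inScale g (σ + τ).1 = inScale g σ.1 + inScale g τ.1 := rfl
    rw [e, diff_add (LocalDensity.smooth σ g) (LocalDensity.smooth τ g), secondDeriv_add (LocalDensity.smooth σ g) (LocalDensity.smooth τ g)]
    simp [h1, h2, h3, k1, k2, k3]
  zero_mem' g := by
    have e : inScale g (0 : LocalDensity c x).1 = (0 : ℝ) • inScale g (0 : LocalDensity c x).1 := by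
      ext y; simp [inScale]
    rw [e, diff_smul _ (LocalDensity.smooth 0 g), secondDeriv_smul _ (LocalDensity.smooth 0 g)]
    simp
  smul_mem' r σ hσ g := by
    obtain ⟨h1, h2, h3⟩ := hσ g
    have e : inScale g (r • σ).1 = r • inScale g σ.1 := rfl
    rw [e, diff_smul r (LocalDensity.smooth σ g), secondDeriv_smul r (LocalDensity.smooth σ g)]
    simp [h1, h2, h3]

/-- The fibre at `x` of the bundle of 2-jets `J² ℰ[1]`. -/
abbrev Jet2 (c : ConformalStructure d M) (x : M) : Type _ := LocalDensity c x ⧸ jetKernel c x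

/-- The local sections of `ℰ[1]` whose 1-jet at `x` vanishes and whose second derivative at `x`, an
element of `S²T*ₓM ⊗ ℰ[1]ₓ`, is trace-free. -/
def traceFreeGerms (c : ConformalStructure d M) (x : M) : Submodule ℝ (LocalDensity c x) where
  carrier := {σ | ∀ g : c.metrics, inScale g σ.1 x = 0 ∧ diff d (inScale g σ.1) x = 0 ∧
    trace g.1.inner x (secondDeriv (inScale g σ.1) x) = 0}
  add_mem' {σ τ} hσ hτ g := by
    obtain ⟨h1, h2, h3⟩ := hσ g
    obtain ⟨k1, k2, k3⟩ := hτ g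
    have e : inScale g (σ + τ).1 = inScale g σ.1 + inScale g τ.1 := rfl
    rw [e, diff_add (LocalDensity.smooth σ g) (LocalDensity.smooth τ g), secondDeriv_add (LocalDensity.smooth σ g) (LocalDensity.smooth τ g), trace_add]
    simp [h1, h2, h3, k1, k2, k3]
  zero_mem' g := by
    have e : inScale g (0 : LocalDensity c x).1 = (0 : ℝ) • inScale g (0 : LocalDensity c x).1 := by
      ext y; simp [inScale]
    rw [e, diff_smul _ (LocalDensity.smooth 0 g), secondDeriv_smul _ (LocalDensity.smooth 0 g),
      trace_smul]
    simp
  smul_mem' r σ hσ g := by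
    obtain ⟨h1, h2, h3⟩ := hσ g
    have e : inScale g (r • σ).1 = r • inScale g σ.1 := rfl
    rw [e, diff_smul r (LocalDensity.smooth σ g), secondDeriv_smul r (LocalDensity.smooth σ g), trace_smul]
    simp [h1, h2, h3]

/-- The image of `S²₀T*ₓM ⊗ ℰ[1]ₓ` in `J²ₓ ℰ[1]`. -/
def traceFreeJets (c : ConformalStructure d M) (x : M) : Submodule ℝ (Jet2 c x) :=
  (traceFreeGerms c x).map (jetKernel c x).mkQ

/-- The fibre at `x` of the standard tractor bundle, `J² ℰ[1]` modulo `S²₀T*M ⊗ ℰ[1]`. -/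
abbrev TractorFibre (c : ConformalStructure d M) (x : M) : Type _ := Jet2 c x ⧸ traceFreeJets c x

/-- The canonical projection of a local section of `ℰ[1]` to its tractor at `x`. -/
def toTractor (c : ConformalStructure d M) (x : M) : LocalDensity c x →ₗ[ℝ] TractorFibre c x :=
  (traceFreeJets c x).mkQ ∘ₗ (jetKernel c x).mkQ

/-- The tautological operator `D` from smooth sections of `ℰ[1]` to tractors. -/
def tractorD (c : ConformalStructure d M) (σ : SmoothDensity c 1) (x : M) : TractorFibre c x :=
  toTractor c x ⟨σ.1, σ.2.1, fun g => Filter.Eventually.of_forall fun y => (σ.2.2 g) y⟩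

/-- `σ ↦ (σ, ∇σ, (1/d)(Δσ - Jσ))` at `x`, in the scale `g`. -/
def jetSplit (c : ConformalStructure d M) (g : c.metrics) (x : M) :
    LocalDensity c x →ₗ[ℝ] ℝ × Cotangent d x × ℝ where
  toFun σ := (inScale g σ.1 x, diff d (inScale g σ.1) x,
    (d : ℝ)⁻¹ * (laplacian g.1.inner (inScale g σ.1) x -
      schoutenTrace g.1.inner x * inScale g σ.1 x))
  map_add' σ τ := by
    have e : inScale g (σ + τ).1 = inScale g σ.1 + inScale g τ.1 := rfl
    rw [e, diff_add (LocalDensity.smooth σ g) (LocalDensity.smooth τ g), laplacian, hess_add (LocalDensity.smooth σ g) (LocalDensity.smooth τ g),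
      trace_add]
    simp [laplacian]
    ring
  map_smul' r σ := by
    have e : inScale g (r • σ).1 = r • inScale g σ.1 := rfl
    rw [e, diff_smul r (LocalDensity.smooth σ g), laplacian, hess_smul r (LocalDensity.smooth σ g), trace_smul]
    simp [laplacian]
    ring

lemma jetSplit_eq_zero (g : c.metrics) {x : M} {σ : LocalDensity c x}
    (h0 : inScale g σ.1 x = 0) (h1 : diff d (inScale g σ.1) x = 0)
    (h2 : trace g.1.inner x (secondDeriv (inScale g σ.1) x) = 0) : jetSplit c g x σ = 0 := by
  have h : hess g.1.inner (inScale g σ.1) x = secondDeriv (inScale g σ.1) x := by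
    rw [hess_eq (LocalDensity.smooth σ g)]
    ext i j
    simp [h1]
  simp [jetSplit, h0, h1, laplacian, h, h2]

/-- The components `(σ, μ, ρ)` of a tractor at `x` in the scale `g`. -/
def splitMap (c : ConformalStructure d M) (g : c.metrics) (x : M) :
    TractorFibre c x →ₗ[ℝ] ℝ × Cotangent d x × ℝ :=
  (traceFreeJets c x).liftQ
    ((jetKernel c x).liftQ (jetSplit c g x) (fun σ hσ => by
      obtain ⟨h0, h1, h2⟩ := hσ g
      exact jetSplit_eq_zero g h0 h1 (by simp [h2, trace])))
    (by
      rintro _ ⟨σ, hσ, rfl⟩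
      obtain ⟨h0, h1, h2⟩ := hσ g
      simpa using jetSplit_eq_zero g h0 h1 h2)

lemma splitMap_toTractor (g : c.metrics) (x : M) (σ : LocalDensity c x) :
    splitMap c g x (toTractor c x σ) = jetSplit c g x σ := rfl

lemma toTractor_surjective (x : M) : Function.Surjective (toTractor c x) :=
  (Submodule.mkQ_surjective _).comp (Submodule.mkQ_surjective _)

lemma inScale_eq {w : ℝ} {g g' : c.metrics} {υ : M → ℝ}
    (h : ∀ x v u, g'.1.inner x v u = Real.exp (2 * υ x) * g.1.inner x v u)
    {σ : M → c.metrics → ℝ} (hσ : ∀ x, σ x ∈ Density c w x) (x : M) :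
    inScale g' σ x = Real.exp (w * υ x) * inScale g σ x :=
  hσ x g g' (υ x) (h x)

lemma metricAt_conformal {g g' : c.metrics} {υ : M → ℝ}
    (h : ∀ x v u, g'.1.inner x v u = Real.exp (2 * υ x) * g.1.inner x v u) (x : M) :
    metricAt g'.1.inner x = Real.exp (2 * υ x) • metricAt g.1.inner x := by
  ext i j
  have e : (extChartAt (𝓡 d) x).symm (origin d x) = x := extChartAt_to_inv x
  simp only [metricAt, chartMetric, Matrix.of_apply, Matrix.smul_apply, h, smul_eq_mul]
  rw [e]

lemma isUnit_det_metricAt (g : Metric d M) (x : M) : IsUnit (metricAt g.inner x).det := by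
  rw [isUnit_iff_ne_zero]
  intro h0
  obtain ⟨v, hv, hM⟩ := Matrix.exists_mulVec_eq_zero_iff.2 h0
  set L : Model d →L[ℝ] TangentSpace (𝓡 d) ((extChartAt (𝓡 d) x).symm (origin d x)) :=
    mfderiv 𝓘(ℝ, Model d) (𝓡 d) (extChartAt (𝓡 d) x).symm (origin d x) with hL
  have hinj : Function.Injective L := by
    have := isInvertible_mfderivWithin_extChartAt_symm (I := 𝓡 d) (x := x)
      (y := origin d x) (mem_extChartAt_target x)
    rw [modelWithCornersSelf_coe, Set.range_id, mfderivWithin_univ] at this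
    exact this.injective
  set V : Model d := ∑ i, v i • stdVec i with hV
  have hVi : ∀ i, V i = v i := by
    intro i
    simp [hV, stdVec, Pi.single_apply]
  have hV0 : V ≠ 0 := by
    intro hz
    apply hv
    ext i
    rw [← hVi i, hz]
    rfl
  have hpos := g.pos _ (L V) (fun hz => hV0 (hinj (by rw [hz, map_zero])))
  have : g.inner _ (L V) (L V) = v ⬝ᵥ (metricAt g.inner x).mulVec v := by
    simp only [hV, map_sum, map_smul, dotProduct, Matrix.mulVec, Finset.mul_sum, sum_apply,
      smul_apply, smul_eq_mul]
    refine Finset.sum_comm.trans (Finset.sum_congr rfl fun i _ => Finset.sum_congr rfl fun j _ => ?_)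
    exact (by intros; ring : ∀ a b c : ℝ, a * (b * c) = b * (c * a)) _ _ _
  rw [this, hM] at hpos
  simp at hpos

lemma trace_metricAt (g : Metric d M) (x : M) : trace g.inner x (metricAt g.inner x) = d := by
  have h := Matrix.nonsing_inv_mul _ (isUnit_det_metricAt g x)
  have hs : ∀ i j, metricAt g.inner x i j = metricAt g.inner x j i := fun i j => g.symm _ _ _
  have : trace g.inner x (metricAt g.inner x) =
      ((metricAt g.inner x)⁻¹ * metricAt g.inner x).trace := by
    simp only [trace, Matrix.trace, Matrix.mul_apply, Matrix.diag_apply]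
    exact Finset.sum_congr rfl fun i _ => Finset.sum_congr rfl fun j _ => by rw [hs i j]
  rw [this, h]
  simp

lemma splitMap_injective [NeZero d] (g : c.metrics) (x : M) :
    Function.Injective (splitMap c g x) := by
  have hd : (d : ℝ) ≠ 0 := by exact_mod_cast NeZero.ne d
  rw [injective_iff_map_eq_zero]
  intro t ht
  obtain ⟨σ, rfl⟩ := toTractor_surjective x t
  rw [splitMap_toTractor] at ht
  have h0 : inScale g σ.1 x = 0 := congrArg Prod.fst ht
  have h1 : diff d (inScale g σ.1) x = 0 := congrArg (fun p => p.2.1) ht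
  have h2 : trace g.1.inner x (secondDeriv (inScale g σ.1) x) = 0 := by
    have h : hess g.1.inner (inScale g σ.1) x = secondDeriv (inScale g σ.1) x := by
      rw [hess_eq (LocalDensity.smooth σ g)]
      ext i j
      simp [h1]
    have h3 : (d : ℝ)⁻¹ * (laplacian g.1.inner (inScale g σ.1) x -
      schoutenTrace g.1.inner x * inScale g σ.1 x) = 0 := congrArg (fun p => p.2.2) ht
    simpa [laplacian, h, h0, hd] using h3
  have hmem : σ ∈ traceFreeGerms c x := by
    intro g'
    obtain ⟨υ, hυ, h⟩ := (c.mem_iff g.1 g.2 g'.1).1 g'.2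
    have e : inScale g' σ.1 = (fun y => Real.exp (υ y)) * inScale g σ.1 := by
      ext y
      simpa using inScale_eq h σ.2.1 y
    have ha : ContMDiffAt (𝓡 d) 𝓘(ℝ, ℝ) ∞ (fun y => Real.exp (υ y)) x :=
      (Real.contDiff_exp.contMDiff.comp hυ) x
    have hk : ∀ k, pd k (chartFun x (inScale g σ.1)) (origin d x) = 0 := fun k => by
      rw [← diff_frame (LocalDensity.smooth σ g), h1]; rfl
    have hu0 : chartFun x (inScale g σ.1) (origin d x) = 0 := by rw [chartFun_origin, h0]
    have e2 : secondDeriv (d := d) (inScale g' σ.1) x =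
        Real.exp (υ x) • secondDeriv (inScale g σ.1) x := by
      ext i j
      rw [e]
      have := pd_pd_mul (i := i) (j := j) (contDiffAt_chartFun ha)
        (contDiffAt_chartFun (LocalDensity.smooth σ g)) hu0 hk
      rw [chartFun_origin] at this
      exact this
    refine ⟨by rw [e]; simp [h0], ?_, ?_⟩
    · rw [e, diff_mul ha (LocalDensity.smooth σ g), h1, h0]
      simp
    · rw [e2, trace_smul]
      have : (metricAt g'.1.inner x)⁻¹ = (Real.exp (2 * υ x))⁻¹ • (metricAt g.1.inner x)⁻¹ := by
        rw [metricAt_conformal h]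
        exact Matrix.inv_smul' _ (Units.mk0 _ (Real.exp_ne_zero (2 * υ x)))
          (isUnit_det_metricAt g.1 x)
      have h3 : trace g'.1.inner x (secondDeriv (inScale g σ.1) x) =
          (Real.exp (2 * υ x))⁻¹ * trace g.1.inner x (secondDeriv (inScale g σ.1) x) := by
        simp [trace, this, Finset.mul_sum, mul_assoc]
      rw [h3, h2]
      simp
  change (traceFreeJets c x).mkQ _ = 0
  simp only [Submodule.mkQ_apply, Submodule.Quotient.mk_eq_zero]
  exact ⟨σ, hmem, rfl⟩

/-- The logarithmic conformal factor `υ` at `x`, where `g' = e^{2υ} g`. -/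
def logFactor (g g' : c.metrics) (x : M) : ℝ :=
  Classical.choose (show ∃ _ : M → ℝ, _ from (c.mem_iff g.1 g.2 g'.1).1 g'.2) x

lemma contMDiff_logFactor (g g' : c.metrics) : ContMDiff (𝓡 d) 𝓘(ℝ, ℝ) ∞ (logFactor g g') :=
  (Classical.choose_spec (show ∃ _ : M → ℝ, _ from (c.mem_iff g.1 g.2 g'.1).1 g'.2)).1

lemma inner_logFactor (g g' : c.metrics) (x : M) (v u : TangentSpace (𝓡 d) x) :
    g'.1.inner x v u = Real.exp (2 * logFactor g g' x) * g.1.inner x v u :=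
  (Classical.choose_spec (show ∃ _ : M → ℝ, _ from (c.mem_iff g.1 g.2 g'.1).1 g'.2)).2 x v u

/-- The section of `ℰ[w]` that is represented by the function `f` in the scale `g`. -/
def ofScale (c : ConformalStructure d M) (w : ℝ) (g : c.metrics) (f : M → ℝ) :
    M → c.metrics → ℝ :=
  fun x g' => Real.exp (w * logFactor g g' x) * f x

lemma ofScale_mem [NeZero d] (w : ℝ) (g : c.metrics) (f : M → ℝ) (x : M) :
    ofScale c w g f x ∈ Density c w x := by
  intro g₁ g₂ t h
  have e := h (frame x 0) (frame x 0)
  rw [inner_logFactor g g₁, inner_logFactor g g₂, ← mul_assoc, ← Real.exp_add] at e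
  have e' := Real.exp_injective (mul_right_cancel₀ (g.1.pos x _ (frame_ne_zero x)).ne' e)
  have : logFactor g g₂ x = t + logFactor g g₁ x := by linarith
  rw [ofScale, ofScale, this, ← mul_assoc, ← Real.exp_add, mul_add]

lemma inScale_ofScale [NeZero d] (w : ℝ) (g : c.metrics) (f : M → ℝ) :
    inScale g (ofScale c w g f) = f := by
  ext x
  have e := inner_logFactor g g x (frame x 0) (frame x 0)
  have e0 : (1 : ℝ) = Real.exp (2 * logFactor g g x) :=
    mul_right_cancel₀ (g.1.pos x _ (frame_ne_zero x)).ne' ((one_mul _).trans e)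
  have e1 : logFactor g g x = 0 := by
    have := (Real.exp_eq_one_iff _).1 e0.symm
    linarith
  simp [inScale, ofScale, e1]

lemma exists_jet [NeZero d] (g : c.metrics) (x : M) (a : ℝ) (α : Cotangent d x) (k : ℝ) :
    ∃ σ : LocalDensity c x, inScale g σ.1 x = a ∧ diff d (inScale g σ.1) x = α ∧
      secondDeriv (inScale g σ.1) x = k • metricAt g.1.inner x := by
  let L : Model d →L[ℝ] Model d :=
    mfderiv 𝓘(ℝ, Model d) (𝓡 d) (extChartAt (𝓡 d) x).symm (origin d x)
  let B₀ : Model d →L[ℝ] Model d →L[ℝ] ℝ := g.1.inner ((extChartAt (𝓡 d) x).symm (origin d x))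
  let B : Model d →L[ℝ] Model d →L[ℝ] ℝ := B₀.bilinearComp L L
  have hB : ∀ v u, B v u = B u v := fun v u => g.1.symm _ _ _
  let α' : Model d →L[ℝ] ℝ := α
  let y₀ : Model d := origin d x
  let u : Model d → ℝ := fun y => a + α' (y - y₀) + k / 2 * B (y - y₀) (y - y₀)
  have hu : ContDiff ℝ ∞ u := by fun_prop
  have hder : ∀ y, HasFDerivAt u (α' + k • B (y - y₀)) y := by
    intro y
    have h0 : HasFDerivAt (fun y : Model d => y - y₀) (ContinuousLinearMap.id ℝ (Model d)) y :=
      (hasFDerivAt_id y).sub_const y₀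
    have h1 : HasFDerivAt (fun y => α' (y - y₀)) (α'.comp (ContinuousLinearMap.id ℝ _)) y :=
      α'.hasFDerivAt.comp y h0
    have h2 : HasFDerivAt (fun y => B (y - y₀)) (B.comp (ContinuousLinearMap.id ℝ _)) y :=
      B.hasFDerivAt.comp y h0
    have h3 := ((h1.const_add a).add ((h2.clm_apply h0).const_mul (k / 2)))
    refine h3.congr_fderiv ?_
    ext v
    simp [hB v y, hB v y₀]
    ring
  have hpd : ∀ j, pd j u = fun y => α' (stdVec j) + k * B (y - y₀) (stdVec j) := by
    intro j
    ext y
    simp [pd, (hder y).fderiv]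
  let f : M → ℝ := fun p => u (extChartAt (𝓡 d) x p)
  have hf : ∀ᶠ y in 𝓝 x, ContMDiffAt (𝓡 d) 𝓘(ℝ, ℝ) ∞ f y := by
    filter_upwards [extChartAt_source_mem_nhds (I := 𝓡 d) x] with y hy
    rw [extChartAt_source] at hy
    exact hu.contMDiff.contMDiffAt.comp y (contMDiffAt_extChartAt' hy)
  have hc : chartFun x f =ᶠ[𝓝 y₀] u := by
    filter_upwards [extChartAt_target_mem_nhds (I := 𝓡 d) x] with y hy
    simp only [chartFun, f, Function.comp]
    rw [(extChartAt (𝓡 d) x).right_inv hy]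
  have hfx := hf.self_of_nhds
  refine ⟨⟨ofScale c 1 g f, ofScale_mem 1 g f, fun g' => ?_⟩, ?_⟩
  · filter_upwards [hf] with y hy
    have : ContMDiffAt (𝓡 d) 𝓘(ℝ, ℝ) ∞ (fun y => Real.exp (1 * logFactor g g' y)) y :=
      (Real.contDiff_exp.contMDiff.comp (contMDiff_const.mul (contMDiff_logFactor g g'))) y
    exact this.mul hy
  · simp only [inScale_ofScale]
    refine ⟨?_, ?_, ?_⟩
    · simp [f, u, y₀, origin]
    · have : (diff d f x : Model d →L[ℝ] ℝ) = α' := by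
        have h := hfx.mdifferentiableAt (by simp)
        rw [diff, h.mfderiv]
        have e : fderiv ℝ (chartFun x f) (origin d x) = α' := by
          rw [hc.fderiv_eq, (hder y₀).fderiv]
          simp
        simpa [chartFun, origin, writtenInExtChartAt] using! e
      exact this
    · ext i j
      have h1 : pd j (chartFun x f) =ᶠ[𝓝 y₀] pd j u := by
        filter_upwards [hc.eventuallyEq_nhds] with y hy using pd_congr hy
      have h2 : pd i (pd j (chartFun x f)) y₀ = k * B (stdVec i) (stdVec j) := by
        rw [pd_congr h1, hpd j, pd]
        have h0 : HasFDerivAt (fun y : Model d => y - y₀) (ContinuousLinearMap.id ℝ (Model d)) y₀ :=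
          (hasFDerivAt_id y₀).sub_const y₀
        have h3 : HasFDerivAt (fun y => B.flip (stdVec j) (y - y₀))
            ((B.flip (stdVec j)).comp (ContinuousLinearMap.id ℝ _)) y₀ :=
          (B.flip (stdVec j)).hasFDerivAt.comp y₀ h0
        have h4 := (h3.const_mul k).const_add (α' (stdVec j))
        have h5 := h4.fderiv
        simp only [ContinuousLinearMap.flip_apply] at h5
        rw [h5]
        simp
      exact h2

lemma splitMap_surjective [NeZero d] (g : c.metrics) (x : M) :
    Function.Surjective (splitMap c g x) := by
  rintro ⟨a, α, r⟩
  have hd : (d : ℝ) ≠ 0 := by exact_mod_cast NeZero.ne d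
  let C : Matrix (Fin d) (Fin d) ℝ := Matrix.of fun i j =>
    ∑ k, christoffel (chartMetric g.1.inner x) k i j (origin d x) * α (frame x k)
  obtain ⟨σ, h0, h1, h2⟩ := exists_jet g x a α
    ((trace g.1.inner x C - schoutenTrace g.1.inner x * a) / d - r)
  refine ⟨toTractor c x σ, ?_⟩
  rw [splitMap_toTractor]
  have hh : hess g.1.inner (inScale g σ.1) x =
      ((trace g.1.inner x C - schoutenTrace g.1.inner x * a) / d - r) • metricAt g.1.inner x +
        (-1 : ℝ) • C := by
    rw [hess_eq (LocalDensity.smooth σ g), h1, h2]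
    simp [C, sub_eq_add_neg]
  have h3 : (d : ℝ)⁻¹ * (laplacian g.1.inner (inScale g σ.1) x -
      schoutenTrace g.1.inner x * inScale g σ.1 x) = r := by
    rw [laplacian, hh, trace_add, trace_smul, trace_smul, trace_metricAt, h0]
    field_simp
    ring
  exact Prod.ext h0 (Prod.ext h1 h3)

/-- The isomorphism `𝒯ₓ ≅ ℰ[1]ₓ ⊕ T*ₓM[1] ⊕ ℰ[-1]ₓ`, `t ↦ (σ, μ, ρ)`, given by a metric `g` of the
conformal class; density bundles are trivialised by `g`. -/
def splitting [NeZero d] (c : ConformalStructure d M) (g : c.metrics) (x : M) :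
    TractorFibre c x ≃ₗ[ℝ] ℝ × Cotangent d x × ℝ :=
  LinearEquiv.ofBijective (splitMap c g x) ⟨splitMap_injective g x, splitMap_surjective g x⟩

/-! ### Tractor metric, canonical tractor and tractor connection -/

variable [NeZero d]

/-- The tractor metric `h((σ, μ, ρ), (σ', μ', ρ')) = g⁻¹(μ, μ') + σρ' + ρσ'`, in the scale `g`. -/
def tractorMetric (c : ConformalStructure d M) (g : c.metrics) (x : M) (t t' : TractorFibre c x) :
    ℝ :=
  coInner g.1.inner x (splitting c g x t).2.1 (splitting c g x t').2.1 +
    (splitting c g x t).1 * (splitting c g x t').2.2 +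
    (splitting c g x t).2.2 * (splitting c g x t').1

/-- The canonical tractor `X : ℰ[-1] → 𝒯`, `ρ ↦ (0, 0, ρ)`. -/
def canonicalX (c : ConformalStructure d M) (g : c.metrics) (x : M) (ρ : Density c (-1) x) :
    TractorFibre c x :=
  (splitting c g x).symm (0, 0, ρ.1 g)

/-- The section `h(I, X)` of `ℰ[1]`. Its value in the scale `g` is the pairing of `I` with the image
under `X` of the element of `ℰ[-1]ₓ` that `g` represents by `1`. -/
def pairX (c : ConformalStructure d M) (I : ∀ x, TractorFibre c x) : M → c.metrics → ℝ :=
  fun x g => tractorMetric c g x (I x)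
    (canonicalX c g x ⟨ofScale c (-1) g (fun _ => 1) x, ofScale_mem (-1) g (fun _ => 1) x⟩)

/-- The components of a section of the tractor bundle in the scale `g`. -/
def compσ (c : ConformalStructure d M) (g : c.metrics) (I : ∀ x, TractorFibre c x) : M → ℝ :=
  fun x => (splitting c g x (I x)).1

/-- See `compσ`. -/
def compμ (c : ConformalStructure d M) (g : c.metrics) (I : ∀ x, TractorFibre c x) :
    ∀ x : M, Cotangent d x :=
  fun x => (splitting c g x (I x)).2.1

/-- See `compσ`. -/
def compρ (c : ConformalStructure d M) (g : c.metrics) (I : ∀ x, TractorFibre c x) : M → ℝ :=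
  fun x => (splitting c g x (I x)).2.2

/-- Smooth sections of the tractor bundle. -/
def IsSmoothTractor (c : ConformalStructure d M) (I : ∀ x, TractorFibre c x) : Prop :=
  ∀ g : c.metrics, ContMDiff (𝓡 d) 𝓘(ℝ, ℝ) ∞ (compσ c g I) ∧
    ContMDiff (𝓡 d) ((𝓡 d).prod 𝓘(ℝ, Model d →L[ℝ] ℝ)) ∞
      (fun x => TotalSpace.mk' (Model d →L[ℝ] ℝ) (E := fun x : M => Cotangent d x) x
        (compμ c g I x)) ∧
    ContMDiff (𝓡 d) 𝓘(ℝ, ℝ) ∞ (compρ c g I)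

/-- The normal tractor connection, in the scale `g`:
`∇_v (σ, μ, ρ) = (∇_v σ - μ(v), ∇_v μ + ρ g(v, ·) + σ P(v, ·), ∇_v ρ - P(v, μ^♯))`. -/
def tractorConnection (c : ConformalStructure d M) (g : c.metrics) (I : ∀ x, TractorFibre c x)
    (x : M) (v : TangentSpace (𝓡 d) x) : TractorFibre c x :=
  (splitting c g x).symm
    (diff d (compσ c g I) x v - compμ c g I x v,
     contract x (covForm g.1.inner (compμ c g I) x) v + compρ c g I x • g.1.inner x v +
      compσ c g I x • contract x (schouten g.1.inner x) v,
     diff d (compρ c g I) x v -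
      coInner g.1.inner x (contract x (schouten g.1.inner x) v) (compμ c g I x))

/-- `I` is parallel for the tractor connection, computed in the scale `g`. -/
def IsParallel (c : ConformalStructure d M) (g : c.metrics) (I : ∀ x, TractorFibre c x) : Prop :=
  ∀ x v, tractorConnection c g I x v = 0

/-- `σ` satisfies the almost Einstein equation `trace-free(∇∇σ + Pσ) = 0`, computed in the scale
`g`. -/
def IsAlmostEinstein (c : ConformalStructure d M) (g : c.metrics) (σ : M → c.metrics → ℝ) : Prop :=
  ∀ x, obstructionA g.1.inner (inScale g σ) x = 0

/-- `(M, [g], σ)` is a directed almost scalar constant structure with `S([g], σ) = k`. -/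
def IsAlmostScalarConstant (c : ConformalStructure d M) (σ : M → c.metrics → ℝ) (k : ℝ) : Prop :=
  σ ∈ SmoothDensity c 1 ∧ σ ≠ 0 ∧ ∀ (g : c.metrics) x, scalarS g.1.inner (inScale g σ) x = k

/-- The metric `σ⁻² 𝐠` (on the open set where `σ ≠ 0`), where `𝐠` is the conformal metric. -/
def scaleMetric (c : ConformalStructure d M) (g : c.metrics) (σ : M → c.metrics → ℝ) :
    BilinField d M :=
  fun x => ((inScale g σ x) ^ 2)⁻¹ • g.1.inner x

end Tractor

end Manifold

end Tractor

end

open Tractor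

/-! In a scale, a tractor field is a triple I = (σ, μ, ρ). Vanishing of the first slot of ∇I says μ
= dσ. The second slot then reads ∇∇σ + σP + ρg = 0: its trace-free part is the almost Einstein
equation, and its trace, with tr P = J, forces ρ = (1/d)(Δσ - Jσ). So a parallel I is Dσ for the
almost Einstein density σ = h(I, X) (`exists_of_isParallel`).

Conversely, if σ is almost Einstein, the first two slots of ∇Dσ vanish at once, and the point is
that the third does too: dρ = P(∇σ). This is the prolongation in `IsMetricOn.pd_of_almostEinstein`.
From the divergence of ∇∇σ + σP + ρg = 0 one subtracts the differential of its trace. The two third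
order terms in σ differ by Ric(∇σ) (`IsMetricOn.ricci_identity`), the terms in dJ cancel because div
P = dJ (`IsMetricOn.contracted_bianchi` and d ≥ 3), and what is left is (d - 1)dρ = (d - 1)P(∇σ).

The length |Dσ|² = |dσ|² + 2σρ equals -S by plain algebra. Its differential is 2∇∇σ(∇σ, ·) + 2ρ dσ +
2σ dρ, which vanishes by the two equations above (`IsMetricOn.pd_normSq`). The Ricci tensor of σ⁻²g
is read off from the conformal change formula with exponent -log|σ|
(`IsMetricOn.ricci_of_almostEinstein`).

Two kinds of invariance are needed underneath. Each tensor at x is defined in the chart preferred at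
x, so naturality under coordinate changes must be proved before ρ or |Dσ|² can be differentiated
(`IsPullback`, `isPullback_chartChange`). And the almost Einstein equation and |Dσ|² must not depend
on the scale: up to a factor e^υ, the tensor ∇∇σ + σP changes only by a multiple of the metric
(`IsMetricOn.hess_add_schouten_conformal`).

The coordinate work is matrix calculus: Γ is a matrix valued one-form with curvature dΓ + Γ∧Γ. For
conformal metrics and for pullbacks alike, a candidate for the new Γ is written down and identified
by the uniqueness of the Levi-Civita connection (`IsMetricOn.christoffel_unique`). -/

namespace Tractor

/-! ### Calculus of functions and matrix fields in coordinates -/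

section Calculus

variable {d : ℕ} {U : Set (Model d)} {y : Model d}

lemma differentiableAt_of_mem {f : Model d → ℝ} (hf : ContDiffOn ℝ ∞ f U) (hU : IsOpen U)
    (hy : y ∈ U) : DifferentiableAt ℝ f y :=
  (hf.contDiffAt (hU.mem_nhds hy)).differentiableAt (by simp)

lemma contDiffOn_pd {f : Model d → ℝ} (hf : ContDiffOn ℝ ∞ f U) (hU : IsOpen U) (i : Fin d) :
    ContDiffOn ℝ ∞ (pd i f) U := by
  have h : ContDiffOn ℝ ∞ (fderiv ℝ f) U := hf.fderiv_of_isOpen hU (by simp)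
  exact h.clm_apply contDiffOn_const

lemma pd_congr_on {f g : Model d → ℝ} (hU : IsOpen U) (h : ∀ z ∈ U, f z = g z) (hy : y ∈ U)
    (i : Fin d) : pd i f y = pd i g y :=
  pd_congr (Filter.eventuallyEq_of_mem (hU.mem_nhds hy) h)

lemma pd_fun_add {i : Fin d} {u v : Model d → ℝ} (hu : DifferentiableAt ℝ u y)
    (hv : DifferentiableAt ℝ v y) : pd i (fun z => u z + v z) y = pd i u y + pd i v y :=
  pd_add hu hv

lemma pd_fun_sub {i : Fin d} {u v : Model d → ℝ} (hu : DifferentiableAt ℝ u y)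
    (hv : DifferentiableAt ℝ v y) : pd i (fun z => u z - v z) y = pd i u y - pd i v y := by
  simp [pd, fderiv_fun_sub hu hv]

lemma pd_fun_neg {i : Fin d} {u : Model d → ℝ} : pd i (fun z => - u z) y = - pd i u y := by
  simp [pd, fderiv_fun_neg]

lemma pd_fun_mul {i : Fin d} {u v : Model d → ℝ} (hu : DifferentiableAt ℝ u y)
    (hv : DifferentiableAt ℝ v y) :
    pd i (fun z => u z * v z) y = u y * pd i v y + v y * pd i u y :=
  pd_mul hu hv

lemma pd_const (i : Fin d) (r : ℝ) : pd i (fun _ => r) y = 0 := by simp [pd]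

lemma pd_const_mul {i : Fin d} {u : Model d → ℝ} (r : ℝ) (hu : DifferentiableAt ℝ u y) :
    pd i (fun z => r * u z) y = r * pd i u y :=
  pd_smul r hu

lemma pd_fun_sum {ι : Type*} {s : Finset ι} {i : Fin d} {u : ι → Model d → ℝ}
    (hu : ∀ a ∈ s, DifferentiableAt ℝ (fun z => u a z) y) :
    pd i (fun z => ∑ a ∈ s, u a z) y = ∑ a ∈ s, pd i (u a) y := by
  simp [pd, fderiv_fun_sum hu]

lemma pd_comp {h : ℝ → ℝ} {h' : ℝ} {u : Model d → ℝ} (i : Fin d)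
    (hh : HasDerivAt h h' (u y)) (hu : DifferentiableAt ℝ u y) :
    pd i (fun z => h (u z)) y = h' * pd i u y := by
  have := (hh.hasFDerivAt.comp y hu.hasFDerivAt).fderiv
  simp only [Function.comp_def] at this
  simp [pd, this, mul_comm]

lemma pd_exp {u : Model d → ℝ} (i : Fin d) (hu : DifferentiableAt ℝ u y) :
    pd i (fun z => Real.exp (u z)) y = Real.exp (u y) * pd i u y :=
  pd_comp i (Real.hasDerivAt_exp _) hu

lemma pd_pd_comm {f : Model d → ℝ} (hf : ContDiffAt ℝ ∞ f y) (i j : Fin d) :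
    pd i (pd j f) y = pd j (pd i f) y := by
  have h1 : ContDiffAt ℝ 1 (fderiv ℝ f) y := hf.fderiv_right (m := 1) (by norm_cast)
  have h2 := h1.differentiableAt (by simp)
  have e : ∀ a b : Fin d, pd a (pd b f) y = fderiv ℝ (fderiv ℝ f) y (stdVec a) (stdVec b) := by
    intro a b
    have := (h2.hasFDerivAt.clm_apply (hasFDerivAt_const (stdVec b) y)).fderiv
    change fderiv ℝ (fun z => fderiv ℝ f z (stdVec b)) y (stdVec a) = _
    rw [this]
    simp
  rw [e, e]
  exact (hf.isSymmSndFDerivAt (by simp; norm_cast)).eq _ _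

/-- A vector of the model space in the standard basis. -/
lemma sum_smul_stdVec (v : Model d) : ∑ a, v a • stdVec a = v := by
  ext i
  simp [stdVec, Pi.single_apply]

/-- The chain rule for a map of the model space. -/
lemma pd_comp_map {φ : Model d → Model d} {f : Model d → ℝ} (hφ : DifferentiableAt ℝ φ y)
    (hf : DifferentiableAt ℝ f (φ y)) (i : Fin d) :
    pd i (fun z => f (φ z)) y = ∑ a, pd i (fun z => φ z a) y * pd a f (φ y) := by
  have h1 := (hf.hasFDerivAt.comp y hφ.hasFDerivAt).fderiv
  simp only [Function.comp_def] at h1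
  have h2 : ∀ a, pd i (fun z => φ z a) y = (fderiv ℝ φ y (stdVec i)) a := by
    intro a
    change fderiv ℝ ((EuclideanSpace.proj (𝕜 := ℝ) a : Model d →L[ℝ] ℝ) ∘ φ) y (stdVec i) = _
    rw [((EuclideanSpace.proj (𝕜 := ℝ) a : Model d →L[ℝ] ℝ).hasFDerivAt.comp y
      hφ.hasFDerivAt).fderiv]
    rfl
  rw [pd, h1]
  simp only [h2, ContinuousLinearMap.comp_apply]
  conv_lhs => rw [← sum_smul_stdVec (fderiv ℝ φ y (stdVec i))]
  simp only [map_sum, map_smul, smul_eq_mul, pd]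

/-- Matrix fields with smooth entries. -/
def SmoothM (A : Model d → Matrix (Fin d) (Fin d) ℝ) (U : Set (Model d)) : Prop :=
  ∀ k l, ContDiffOn ℝ ∞ (fun z => A z k l) U

/-- The entrywise partial derivative of a matrix field. -/
noncomputable def pdM (i : Fin d) (A : Model d → Matrix (Fin d) (Fin d) ℝ) (y : Model d) :
    Matrix (Fin d) (Fin d) ℝ :=
  Matrix.of fun k l => pd i (fun z => A z k l) y

lemma pdM_apply (i : Fin d) (A : Model d → Matrix (Fin d) (Fin d) ℝ) (y : Model d) (k l : Fin d) :
    pdM i A y k l = pd i (fun z => A z k l) y := rfl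

section

variable {A B : Model d → Matrix (Fin d) (Fin d) ℝ}

lemma SmoothM.mul (hA : SmoothM A U) (hB : SmoothM B U) : SmoothM (fun z => A z * B z) U := by
  intro k l
  simp only [Matrix.mul_apply]
  exact ContDiffOn.sum fun j _ => (hA k j).mul (hB j l)

lemma SmoothM.add (hA : SmoothM A U) (hB : SmoothM B U) : SmoothM (fun z => A z + B z) U :=
  fun k l => (hA k l).add (hB k l)

lemma SmoothM.sub (hA : SmoothM A U) (hB : SmoothM B U) : SmoothM (fun z => A z - B z) U :=
  fun k l => (hA k l).sub (hB k l)

lemma SmoothM.transpose (hA : SmoothM A U) : SmoothM (fun z => (A z).transpose) U :=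
  fun k l => hA l k

lemma SmoothM.pdM (hA : SmoothM A U) (hU : IsOpen U) (i : Fin d) : SmoothM (pdM i A) U :=
  fun k l => contDiffOn_pd (hA k l) hU i

lemma SmoothM.trace (hA : SmoothM A U) : ContDiffOn ℝ ∞ (fun z => (A z).trace) U :=
  ContDiffOn.sum fun i _ => hA i i

lemma pdM_mul (hA : SmoothM A U) (hB : SmoothM B U) (hU : IsOpen U) (hy : y ∈ U) (i : Fin d) :
    pdM i (fun z => A z * B z) y = pdM i A y * B y + A y * pdM i B y := by
  ext k l
  simp only [pdM_apply, Matrix.mul_apply, Matrix.add_apply]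
  rw [pd_fun_sum (u := fun j z => A z k j * B z j l) fun j _ =>
    (differentiableAt_of_mem (hA k j) hU hy).mul (differentiableAt_of_mem (hB j l) hU hy),
    ← Finset.sum_add_distrib]
  refine Finset.sum_congr rfl fun j _ => ?_
  rw [pd_fun_mul (differentiableAt_of_mem (hA k j) hU hy) (differentiableAt_of_mem (hB j l) hU hy)]
  ring

lemma pdM_add (hA : SmoothM A U) (hB : SmoothM B U) (hU : IsOpen U) (hy : y ∈ U) (i : Fin d) :
    pdM i (fun z => A z + B z) y = pdM i A y + pdM i B y := by
  ext k l
  exact pd_fun_add (differentiableAt_of_mem (hA k l) hU hy) (differentiableAt_of_mem (hB k l) hU hy)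

lemma pdM_sub (hA : SmoothM A U) (hB : SmoothM B U) (hU : IsOpen U) (hy : y ∈ U) (i : Fin d) :
    pdM i (fun z => A z - B z) y = pdM i A y - pdM i B y := by
  ext k l
  exact pd_fun_sub (differentiableAt_of_mem (hA k l) hU hy) (differentiableAt_of_mem (hB k l) hU hy)

lemma pdM_transpose (i : Fin d) :
    pdM i (fun z => (A z).transpose) y = (pdM i A y).transpose := rfl

lemma pdM_congr (hU : IsOpen U) (h : ∀ z ∈ U, A z = B z) (hy : y ∈ U) (i : Fin d) :
    pdM i A y = pdM i B y := by
  ext k l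
  exact pd_congr_on hU (fun z hz => by rw [h z hz]) hy i

lemma pdM_const (i : Fin d) (C : Matrix (Fin d) (Fin d) ℝ) : pdM i (fun _ => C) y = 0 := by
  ext k l
  exact pd_const i _

lemma pdM_comm (hA : SmoothM A U) (hU : IsOpen U) (hy : y ∈ U) (i j : Fin d) :
    pdM i (pdM j A) y = pdM j (pdM i A) y := by
  ext k l
  exact pd_pd_comm ((hA k l).contDiffAt (hU.mem_nhds hy)) i j

lemma SmoothM.det (hA : SmoothM A U) : ContDiffOn ℝ ∞ (fun z => (A z).det) U := by
  simp only [Matrix.det_apply']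
  refine ContDiffOn.sum fun s _ => contDiffOn_const.mul ?_
  exact contDiffOn_prod fun i _ => hA _ _

/-- Cramer's rule: the inverse is the adjugate divided by the determinant, and every entry of the
adjugate is the determinant of a matrix with one row replaced by a constant one. -/
lemma SmoothM.inv (hA : SmoothM A U) (h0 : ∀ z ∈ U, IsUnit (A z).det) :
    SmoothM (fun z => (A z)⁻¹) U := by
  intro k l
  simp only [Matrix.inv_def, Ring.inverse_eq_inv', Matrix.smul_apply, smul_eq_mul,
    Matrix.adjugate_apply]
  refine (hA.det.inv fun z hz => (h0 z hz).ne_zero).mul (SmoothM.det ?_)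
  intro a b
  by_cases h : a = l
  · subst h
    simpa using contDiffOn_const
  · simpa [Matrix.updateRow_ne h] using hA a b

end

end Calculus

/-! ### The Levi-Civita connection in coordinates -/

section LeviCivita

variable {d : ℕ} {U : Set (Model d)} {y : Model d}

/-- `G` is a smooth field of nondegenerate symmetric matrices on the open set `U`. -/
structure IsMetricOn (G : Model d → Matrix (Fin d) (Fin d) ℝ) (U : Set (Model d)) : Prop where
  isOpen : IsOpen U
  smooth : SmoothM G U
  symm : ∀ y ∈ U, ∀ i j, G y i j = G y j i
  det : ∀ y ∈ U, IsUnit (G y).det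

/-- The connection matrices `(Γᵢ)ᵏₗ = Γᵏᵢₗ`. -/
noncomputable def gam (G : Model d → Matrix (Fin d) (Fin d) ℝ) (i : Fin d) (y : Model d) :
    Matrix (Fin d) (Fin d) ℝ :=
  Matrix.of fun k l => christoffel G k i l y

/-- The curvature matrices `(R_{ij})ᵏₗ = R_{ij}ᵏₗ`. -/
noncomputable def curv (G : Model d → Matrix (Fin d) (Fin d) ℝ) (i j : Fin d) (y : Model d) :
    Matrix (Fin d) (Fin d) ℝ :=
  Matrix.of fun k l => riemann G i j k l y

variable {G : Model d → Matrix (Fin d) (Fin d) ℝ}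

lemma gam_apply (i k l : Fin d) : gam G i y k l = christoffel G k i l y := rfl

/-- This form of the curvature, dΓ + Γ∧Γ, reduces the Bianchi identity, the conformal change and the
gauge change to identities in a noncommutative ring. -/
lemma curv_eq (i j : Fin d) : curv G i j y =
    pdM i (gam G j) y - pdM j (gam G i) y + (gam G i y * gam G j y - gam G j y * gam G i y) := by
  ext k l
  simp only [curv, riemann, Matrix.of_apply, Matrix.add_apply, Matrix.sub_apply, Matrix.mul_apply,
    pdM_apply, gam_apply, ← Finset.sum_sub_distrib]

lemma coordRicci_apply (i j : Fin d) : coordRicci G y i j = ∑ k, curv G k i y k j := rfl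

lemma curv_swap (i j : Fin d) : curv G j i y = - curv G i j y := by
  rw [curv_eq, curv_eq]
  abel

namespace IsMetricOn

lemma mono (hG : IsMetricOn G U) {V : Set (Model d)} (hV : IsOpen V) (h : V ⊆ U) :
    IsMetricOn G V where
  isOpen := hV
  smooth k l := (hG.smooth k l).mono h
  symm y hy := hG.symm y (h hy)
  det y hy := hG.det y (h hy)

lemma diffAt (hG : IsMetricOn G U) (hy : y ∈ U) (i j : Fin d) :
    DifferentiableAt ℝ (fun z => G z i j) y :=
  differentiableAt_of_mem (hG.smooth i j) hG.isOpen hy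

lemma mul_inv (hG : IsMetricOn G U) (hy : y ∈ U) : G y * (G y)⁻¹ = 1 :=
  Matrix.mul_nonsing_inv _ (hG.det y hy)

lemma inv_mul (hG : IsMetricOn G U) (hy : y ∈ U) : (G y)⁻¹ * G y = 1 :=
  Matrix.nonsing_inv_mul _ (hG.det y hy)

lemma transpose_eq (hG : IsMetricOn G U) (hy : y ∈ U) : (G y).transpose = G y := by
  ext i j
  exact hG.symm y hy j i

lemma inv_transpose (hG : IsMetricOn G U) (hy : y ∈ U) : ((G y)⁻¹).transpose = (G y)⁻¹ := by
  rw [Matrix.transpose_nonsing_inv, hG.transpose_eq hy]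

lemma inv_symm (hG : IsMetricOn G U) (hy : y ∈ U) (i j : Fin d) : (G y)⁻¹ i j = (G y)⁻¹ j i :=
  congrFun (congrFun (hG.inv_transpose hy) j) i

lemma sum_mul_inv (hG : IsMetricOn G U) (hy : y ∈ U) (i j : Fin d) :
    ∑ m, G y i m * (G y)⁻¹ m j = if i = j then 1 else 0 := by
  rw [← Matrix.mul_apply, hG.mul_inv hy, Matrix.one_apply]

lemma pd_symm (hG : IsMetricOn G U) (hy : y ∈ U) (k i j : Fin d) :
    pd k (fun z => G z i j) y = pd k (fun z => G z j i) y :=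
  pd_congr_on hG.isOpen (fun z hz => hG.symm z hz i j) hy k

lemma inv_smooth (hG : IsMetricOn G U) : SmoothM (fun z => (G z)⁻¹) U := hG.smooth.inv hG.det

lemma christoffel_smooth (hG : IsMetricOn G U) (k i j : Fin d) :
    ContDiffOn ℝ ∞ (christoffel G k i j) U := by
  unfold christoffel
  refine contDiffOn_const.mul (ContDiffOn.sum fun l _ => (hG.inv_smooth k l).mul ?_)
  exact ((contDiffOn_pd (hG.smooth _ _) hG.isOpen _).add
    (contDiffOn_pd (hG.smooth _ _) hG.isOpen _)).sub (contDiffOn_pd (hG.smooth _ _) hG.isOpen _)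

lemma gam_smooth (hG : IsMetricOn G U) (i : Fin d) : SmoothM (gam G i) U :=
  fun k l => hG.christoffel_smooth k i l

lemma curv_smooth (hG : IsMetricOn G U) (i j : Fin d) : SmoothM (curv G i j) U := by
  have e : curv G i j = fun z => (pdM i (gam G j) z - pdM j (gam G i) z) +
      (gam G i z * gam G j z - gam G j z * gam G i z) := funext fun z => curv_eq i j
  rw [e]
  exact (((hG.gam_smooth j).pdM hG.isOpen i).sub ((hG.gam_smooth i).pdM hG.isOpen j)).add
    (((hG.gam_smooth i).mul (hG.gam_smooth j)).sub ((hG.gam_smooth j).mul (hG.gam_smooth i)))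

lemma ricci_smooth (hG : IsMetricOn G U) : SmoothM (coordRicci G) U := fun i j => by
  simp only [coordRicci_apply]
  exact ContDiffOn.sum fun k _ => hG.curv_smooth k i k j

lemma christoffel_symm (hG : IsMetricOn G U) (hy : y ∈ U) (k i j : Fin d) :
    christoffel G k i j y = christoffel G k j i y := by
  unfold christoffel
  congr 1
  refine Finset.sum_congr rfl fun l _ => ?_
  rw [hG.pd_symm hy l i j]
  ring

/-- These are the Christoffel symbols of the first kind. Being free of the inverse matrix, they are
the convenient form for proving compatibility with the metric and uniqueness. -/
lemma lower_christoffel (hG : IsMetricOn G U) (hy : y ∈ U) (l i j : Fin d) :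
    ∑ m, G y l m * christoffel G m i j y = 1 / 2 *
      (pd i (fun z => G z j l) y + pd j (fun z => G z i l) y - pd l (fun z => G z i j) y) := by
  set F : Fin d → ℝ := fun l =>
    pd i (fun z => G z j l) y + pd j (fun z => G z i l) y - pd l (fun z => G z i j) y with hF
  have h1 : ∀ m, G y l m * christoffel G m i j y = ∑ n, 1 / 2 * (G y l m * (G y)⁻¹ m n * F n) := by
    intro m
    simp only [christoffel, Finset.mul_sum, hF]
    exact Finset.sum_congr rfl fun n _ => by ring
  simp only [h1]
  rw [Finset.sum_comm]
  simp only [← Finset.mul_sum, ← Finset.sum_mul, hG.sum_mul_inv hy]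
  simp [hF]

/-- The Levi-Civita connection preserves the metric. -/
lemma pd_metric (hG : IsMetricOn G U) (hy : y ∈ U) (k i j : Fin d) : pd k (fun z => G z i j) y =
    ∑ m, christoffel G m k i y * G y m j + ∑ m, G y i m * christoffel G m k j y := by
  have h1 : ∑ m, christoffel G m k i y * G y m j = ∑ m, G y j m * christoffel G m k i y :=
    Finset.sum_congr rfl fun m _ => by rw [hG.symm y hy m j, mul_comm]
  rw [h1, hG.lower_christoffel hy, hG.lower_christoffel hy, hG.pd_symm hy k j i]
  ring

lemma pdM_metric (hG : IsMetricOn G U) (hy : y ∈ U) (k : Fin d) :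
    pdM k G y = (gam G k y).transpose * G y + G y * gam G k y := by
  ext i j
  simp only [pdM_apply, Matrix.add_apply, Matrix.mul_apply, Matrix.transpose_apply, gam_apply]
  exact hG.pd_metric hy k i j

/-- The Levi-Civita connection is the only torsion free one that preserves the metric. -/
lemma christoffel_unique (hG : IsMetricOn G U) (hy : y ∈ U) (C : Fin d → Matrix (Fin d) (Fin d) ℝ)
    (hs : ∀ k i j, C i k j = C j k i)
    (hm : ∀ k, pdM k G y = (C k).transpose * G y + G y * C k) (i : Fin d) : gam G i y = C i := by
  have hm' : ∀ k i j, pd k (fun z => G z i j) y =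
      ∑ m, G y j m * C k m i + ∑ m, G y i m * C k m j := by
    intro k i j
    have := congrFun (congrFun (hm k) i) j
    simp only [pdM_apply, Matrix.add_apply, Matrix.mul_apply, Matrix.transpose_apply] at this
    rw [this]
    congr 1
    exact Finset.sum_congr rfl fun m _ => by rw [hG.symm y hy m j, mul_comm]
  -- Koszul's formula: the derivatives of G in the lowered symbols are expressed by C, and the
  -- symmetry of C in its lower indices cancels everything except G C.
  have key : G y * gam G i y = G y * C i := by
    ext l j
    simp only [Matrix.mul_apply, gam_apply]
    rw [hG.lower_christoffel hy, hm', hm', hm']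
    simp only [hs _ j i, hs _ l i, hs _ l j]
    ring
  calc gam G i y = ((G y)⁻¹ * G y) * gam G i y := by rw [hG.inv_mul hy, one_mul]
    _ = ((G y)⁻¹ * G y) * C i := by rw [mul_assoc, key, mul_assoc]
    _ = C i := by rw [hG.inv_mul hy, one_mul]

/-- The Levi-Civita connection preserves the inverse metric. -/
lemma pdM_inv (hG : IsMetricOn G U) (hy : y ∈ U) (k : Fin d) : pdM k (fun z => (G z)⁻¹) y =
    - (gam G k y * (G y)⁻¹) - (G y)⁻¹ * (gam G k y).transpose := by
  have h1 : pdM k (fun z => (G z)⁻¹ * G z) y = 0 := by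
    rw [pdM_congr hG.isOpen (fun z hz => hG.inv_mul hz) hy, pdM_const]
  rw [pdM_mul hG.inv_smooth hG.smooth hG.isOpen hy, hG.pdM_metric hy] at h1
  have h2 : pdM k (fun z => (G z)⁻¹) y * G y =
      -((G y)⁻¹ * ((gam G k y).transpose * G y + G y * gam G k y)) := eq_neg_of_add_eq_zero_left h1
  calc pdM k (fun z => (G z)⁻¹) y = (pdM k (fun z => (G z)⁻¹) y * G y) * (G y)⁻¹ := by
        rw [mul_assoc, hG.mul_inv hy, mul_one]
    _ = -((G y)⁻¹ * (gam G k y).transpose * (G y * (G y)⁻¹)) -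
        ((G y)⁻¹ * G y) * gam G k y * (G y)⁻¹ := by rw [h2]; noncomm_ring
    _ = _ := by rw [hG.inv_mul hy, hG.mul_inv hy, one_mul, mul_one]; abel

/-- `R_{ij}{}^{kl}` is antisymmetric in `k` and `l`. -/
lemma curv_mul_inv_transpose (hG : IsMetricOn G U) (hy : y ∈ U) (i j : Fin d) :
    (curv G i j y * (G y)⁻¹).transpose = - (curv G i j y * (G y)⁻¹) := by
  have hU := hG.isOpen
  have hd : ∀ a b, pdM a (pdM b (fun z => (G z)⁻¹)) y =
      - (pdM a (gam G b) y * (G y)⁻¹ + gam G b y * pdM a (fun z => (G z)⁻¹) y) -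
      (pdM a (fun z => (G z)⁻¹) y * (gam G b y).transpose +
        (G y)⁻¹ * (pdM a (gam G b) y).transpose) := by
    intro a b
    have hs1 := (hG.gam_smooth b).mul hG.inv_smooth
    have hs2 := hG.inv_smooth.mul (hG.gam_smooth b).transpose
    have e : ∀ z ∈ U, pdM b (fun z => (G z)⁻¹) z = (fun _ => 0) z -
        (gam G b z * (G z)⁻¹ + (G z)⁻¹ * (gam G b z).transpose) := fun z hz => by
      simp only [hG.pdM_inv hz, zero_sub, neg_add']
    rw [pdM_congr hU e hy, pdM_sub (A := fun _ => 0) (fun k l => contDiffOn_const) (hs1.add hs2)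
      hU hy, pdM_add hs1 hs2 hU hy, pdM_mul (hG.gam_smooth b) hG.inv_smooth hU hy,
      pdM_mul hG.inv_smooth (hG.gam_smooth b).transpose hU hy, pdM_const, pdM_transpose]
    abel
  -- The inverse metric is parallel, so commuting its second partial derivatives says that the
  -- curvature annihilates it. That is the sum of R G⁻¹ and its transpose.
  have h := pdM_comm hG.inv_smooth hU hy i j
  rw [hd, hd, hG.pdM_inv hy, hG.pdM_inv hy] at h
  rw [Matrix.transpose_mul, hG.inv_transpose hy, curv_eq]
  simp only [Matrix.transpose_add, Matrix.transpose_sub, Matrix.transpose_mul]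
  rw [← sub_eq_zero] at h ⊢
  rw [← neg_eq_zero, ← h]
  noncomm_ring

/-- The second Bianchi identity. -/
lemma bianchi (hG : IsMetricOn G U) (hy : y ∈ U) (m i j : Fin d) :
    (pdM m (curv G i j) y + (gam G m y * curv G i j y - curv G i j y * gam G m y)) +
    (pdM i (curv G j m) y + (gam G i y * curv G j m y - curv G j m y * gam G i y)) +
    (pdM j (curv G m i) y + (gam G j y * curv G m i y - curv G m i y * gam G j y)) = 0 := by
  have hU := hG.isOpen
  have hg := hG.gam_smooth
  have hd : ∀ a b c, pdM a (curv G b c) y =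
      pdM a (pdM b (gam G c)) y - pdM a (pdM c (gam G b)) y +
      (pdM a (gam G b) y * gam G c y + gam G b y * pdM a (gam G c) y -
      (pdM a (gam G c) y * gam G b y + gam G c y * pdM a (gam G b) y)) := by
    intro a b c
    have h1 := (hg c).pdM hU b
    have h2 := (hg b).pdM hU c
    have h3 := (hg b).mul (hg c)
    have h4 := (hg c).mul (hg b)
    rw [pdM_congr hU (fun z _ => curv_eq b c) hy, pdM_add (h1.sub h2) (h3.sub h4) hU hy,
      pdM_sub h1 h2 hU hy, pdM_sub h3 h4 hU hy, pdM_mul (hg b) (hg c) hU hy,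
      pdM_mul (hg c) (hg b) hU hy]
  -- The second derivatives of Γ cancel in pairs once their order is fixed. The terms in Γ ∂Γ and
  -- ΓΓΓ cancel in the cyclic sum, as in the Jacobi identity.
  rw [hd, hd, hd, curv_eq, curv_eq, curv_eq, pdM_comm (hg j) hU hy i m, pdM_comm (hg m) hU hy j i,
    pdM_comm (hg i) hU hy j m]
  noncomm_ring

end IsMetricOn

end LeviCivita

/-! ### The contracted Bianchi identity and the prolongation of the almost Einstein equation -/

section Prolongation

variable {d : ℕ} {U : Set (Model d)} {y : Model d} {G : Model d → Matrix (Fin d) (Fin d) ℝ}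

/-- The divergence `∇ₘ Eᵢᵐ` of a tensor field with components `E i m = Eᵢᵐ`. -/
noncomputable def divM (G E : Model d → Matrix (Fin d) (Fin d) ℝ) (y : Model d) (i : Fin d) : ℝ :=
  ∑ m, pd m (fun z => E z i m) y + ∑ m, ∑ p, christoffel G m m p y * E y i p -
    ∑ m, ∑ p, christoffel G p m i y * E y p m

lemma divM_congr {E F : Model d → Matrix (Fin d) (Fin d) ℝ} (hU : IsOpen U) (hy : y ∈ U)
    (h : ∀ z ∈ U, E z = F z) (i : Fin d) : divM G E y i = divM G F y i := by
  unfold divM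
  rw [h y hy]
  congr 2
  exact Finset.sum_congr rfl fun m _ => pd_congr_on hU (fun z hz => by rw [h z hz]) hy m

lemma divM_add {E F : Model d → Matrix (Fin d) (Fin d) ℝ} (hE : SmoothM E U) (hF : SmoothM F U)
    (hU : IsOpen U) (hy : y ∈ U) (i : Fin d) :
    divM G (fun z => E z + F z) y i = divM G E y i + divM G F y i := by
  have h : ∀ m, pd m (fun z => (E z + F z) i m) y =
      pd m (fun z => E z i m) y + pd m (fun z => F z i m) y := fun m =>
    pd_fun_add (differentiableAt_of_mem (hE i m) hU hy) (differentiableAt_of_mem (hF i m) hU hy)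
  unfold divM
  simp only [h]
  simp only [Matrix.add_apply, mul_add, Finset.sum_add_distrib]
  ring

lemma divM_smul {E : Model d → Matrix (Fin d) (Fin d) ℝ} {f : Model d → ℝ}
    (hf : ContDiffOn ℝ ∞ f U) (hE : SmoothM E U) (hU : IsOpen U) (hy : y ∈ U) (i : Fin d) :
    divM G (fun z => f z • E z) y i = ∑ m, pd m f y * E y i m + f y * divM G E y i := by
  have h : ∀ m, pd m (fun z => (f z • E z) i m) y =
      f y * pd m (fun z => E z i m) y + E y i m * pd m f y := fun m =>
    pd_fun_mul (differentiableAt_of_mem hf hU hy) (differentiableAt_of_mem (hE i m) hU hy)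
  unfold divM
  simp only [h]
  simp only [Matrix.smul_apply, smul_eq_mul, mul_add, mul_sub, Finset.sum_add_distrib,
    Finset.mul_sum, mul_left_comm, mul_comm (pd _ f y)]
  ring

lemma divM_zero (i : Fin d) : divM G (fun _ => 0) y i = 0 := by
  simp [divM, pd_const]

/-- The identity endomorphism is parallel. Hence the divergence of a multiple f · 1, in particular
of the raised term ρg, is just df. -/
lemma IsMetricOn.divM_one (hG : IsMetricOn G U) (hy : y ∈ U) (i : Fin d) :
    divM G (fun _ => 1) y i = 0 := by
  simp [divM, pd_const, Matrix.one_apply, hG.christoffel_symm hy _ _ i]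

/-- The contracted Bianchi identity. -/
lemma IsMetricOn.contracted_bianchi (hG : IsMetricOn G U) (hy : y ∈ U) (i : Fin d) :
    2 * divM G (fun z => coordRicci G z * (G z)⁻¹) y i =
      pd i (fun z => (coordRicci G z * (G z)⁻¹).trace) y := by
  have hU := hG.isOpen
  -- With one index raised, the curvature R_{ab}^{kl} is antisymmetric in each of its two pairs. All
  -- the index shuffling below uses only these two symmetries.
  set S : Fin d → Fin d → Model d → Matrix (Fin d) (Fin d) ℝ :=
    fun a b z => curv G a b z * (G z)⁻¹ with hS
  have hSs : ∀ a b, SmoothM (S a b) U := fun a b => (hG.curv_smooth a b).mul hG.inv_smooth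
  have hSd : ∀ a b k l, DifferentiableAt ℝ (fun z => S a b z k l) y := fun a b k l =>
    differentiableAt_of_mem (hSs a b k l) hU hy
  have s1 : ∀ z a b k l, S a b z k l = - S b a z k l := by
    intro z a b k l
    simp only [hS]
    rw [curv_swap b a, neg_mul]
    rfl
  have s2 : ∀ z ∈ U, ∀ a b k l, S a b z k l = - S a b z l k := fun z hz a b k l =>
    congrFun (congrFun (hG.curv_mul_inv_transpose hz a b) l) k
  have s3 : ∀ z ∈ U, ∀ a b k l, S a b z k l = S b a z l k := by
    intro z hz a b k l
    rw [s1, s2 z hz, neg_neg]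
  have D1 : ∀ m a b k l, pd m (fun z => S a b z k l) y = - pd m (fun z => S b a z k l) y := by
    intro m a b k l
    rw [← pd_fun_neg]
    exact pd_congr_on hU (fun z _ => s1 z a b k l) hy m
  have D3 : ∀ m a b k l, pd m (fun z => S a b z k l) y = pd m (fun z => S b a z l k) y :=
    fun m a b k l => pd_congr_on hU (fun z hz => s3 z hz a b k l) hy m
  have hQ : ∀ z ∈ U, ∀ a k, (coordRicci G z * (G z)⁻¹) a k = ∑ j, S a j z k j := by
    intro z hz a k
    simp only [Matrix.mul_apply, coordRicci_apply, Finset.sum_mul]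
    rw [Finset.sum_comm]
    refine Finset.sum_congr rfl fun j _ => ?_
    rw [s3 z hz]
    simp [hS, Matrix.mul_apply]
  -- The Bianchi identity prepared for a double contraction: the index m is matched with the first
  -- upper index, and j with the second.
  have cyc : ∀ m j,
      (pd m (fun z => S i j z m j) y + ∑ p, christoffel G m m p y * S i j y p j +
        ∑ p, S i j y m p * christoffel G j m p y) +
      (pd i (fun z => S j m z m j) y + ∑ p, christoffel G m i p y * S j m y p j +
        ∑ p, S j m y m p * christoffel G j i p y) +
      (pd j (fun z => S m i z m j) y + ∑ p, christoffel G m j p y * S m i y p j +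
        ∑ p, S m i y m p * christoffel G j j p y) = 0 := by
    intro m j
    -- Raising an index commutes with the covariant derivative because G⁻¹ is parallel. The raised
    -- index is differentiated through the transpose of Γ on the right.
    have hd : ∀ a b c, pdM a (S b c) y + gam G a y * S b c y + S b c y * (gam G a y).transpose =
        (pdM a (curv G b c) y + (gam G a y * curv G b c y - curv G b c y * gam G a y)) *
          (G y)⁻¹ := by
      intro a b c
      simp only [hS]
      rw [pdM_mul (hG.curv_smooth b c) hG.inv_smooth hU hy, hG.pdM_inv hy]
      noncomm_ring
    have h := congrArg (fun B => B * (G y)⁻¹) (hG.bianchi hy m i j)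
    beta_reduce at h
    rw [zero_mul, add_mul, add_mul, ← hd, ← hd, ← hd] at h
    have h' := congrFun (congrFun h m) j
    simpa only [Matrix.add_apply, Matrix.mul_apply, Matrix.transpose_apply, pdM_apply, gam_apply,
      Matrix.zero_apply] using h'
  have tot : ∑ m, ∑ j, _ = ∑ m : Fin d, ∑ j : Fin d, (0 : ℝ) :=
    Finset.sum_congr rfl fun m _ => Finset.sum_congr rfl fun j _ => cyc m j
  simp only [Finset.sum_add_distrib, Finset.sum_const_zero] at tot
  have dQ : ∀ m a k, pd m (fun z => (coordRicci G z * (G z)⁻¹) a k) y =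
      ∑ j, pd m (fun z => S a j z k j) y := by
    intro m a k
    rw [pd_congr_on hU (fun z hz => hQ z hz a k) hy m]
    exact pd_fun_sum fun j _ => hSd _ _ _ _
  have t2 : ∑ m, ∑ j, ∑ p, christoffel G m m p y * S i j y p j =
      ∑ m, ∑ p, christoffel G m m p y * (coordRicci G y * (G y)⁻¹) i p := by
    refine Finset.sum_congr rfl fun m _ => ?_
    rw [Finset.sum_comm]
    exact Finset.sum_congr rfl fun p _ => by rw [hQ y hy, Finset.mul_sum]
  -- An antisymmetric pair contracted with the symmetric lower indices of Γ.
  have t3 : ∑ m, ∑ j, ∑ p, S i j y m p * christoffel G j m p y = 0 := by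
    have : ∑ m, ∑ j, ∑ p, S i j y m p * christoffel G j m p y =
        - ∑ m, ∑ j, ∑ p, S i j y m p * christoffel G j m p y := by
      conv_lhs => rw [Finset.sum_comm]
      conv_rhs => rw [Finset.sum_comm]
      rw [← Finset.sum_neg_distrib]
      refine Finset.sum_congr rfl fun j _ => ?_
      conv_lhs => rw [Finset.sum_comm]
      rw [← Finset.sum_neg_distrib]
      refine Finset.sum_congr rfl fun p _ => ?_
      rw [← Finset.sum_neg_distrib]
      refine Finset.sum_congr rfl fun m _ => ?_
      rw [s2 y hy i j m p, hG.christoffel_symm hy j m p]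
      ring
    linarith
  have t4 : ∑ m, ∑ j, pd i (fun z => S j m z m j) y =
      - pd i (fun z => (coordRicci G z * (G z)⁻¹).trace) y := by
    have : pd i (fun z => (coordRicci G z * (G z)⁻¹).trace) y =
        ∑ m, pd i (fun z => (coordRicci G z * (G z)⁻¹) m m) y :=
      pd_fun_sum fun m _ => differentiableAt_of_mem (hG.ricci_smooth.mul hG.inv_smooth m m) hU hy
    rw [this, ← Finset.sum_neg_distrib]
    refine Finset.sum_congr rfl fun m _ => ?_
    rw [dQ, ← Finset.sum_neg_distrib]
    exact Finset.sum_congr rfl fun j _ => D1 _ _ _ _ _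
  have t5 : ∑ m, ∑ j, ∑ p, christoffel G m i p y * S j m y p j =
      - ∑ m, ∑ p, christoffel G p m i y * (coordRicci G y * (G y)⁻¹) p m := by
    conv_rhs => rw [Finset.sum_comm]
    rw [← Finset.sum_neg_distrib]
    refine Finset.sum_congr rfl fun m _ => ?_
    rw [Finset.sum_comm, ← Finset.sum_neg_distrib]
    refine Finset.sum_congr rfl fun p _ => ?_
    rw [hQ y hy, Finset.mul_sum, ← Finset.sum_neg_distrib]
    refine Finset.sum_congr rfl fun j _ => ?_
    rw [s1, hG.christoffel_symm hy]
    ring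
  have t6 : ∑ m, ∑ j, ∑ p, S j m y m p * christoffel G j i p y =
      - ∑ m, ∑ p, christoffel G p m i y * (coordRicci G y * (G y)⁻¹) p m := by
    rw [← t5, Finset.sum_comm]
    refine Finset.sum_congr rfl fun m _ => Finset.sum_congr rfl fun j _ =>
      Finset.sum_congr rfl fun p _ => ?_
    rw [s3 y hy, mul_comm]
  have t7 : ∑ m, ∑ j, pd j (fun z => S m i z m j) y = ∑ m, ∑ j, pd m (fun z => S i j z m j) y := by
    rw [Finset.sum_comm]
    exact Finset.sum_congr rfl fun m _ => Finset.sum_congr rfl fun j _ => D3 _ _ _ _ _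
  have t8 : ∑ m, ∑ j, ∑ p, christoffel G m j p y * S m i y p j =
      ∑ m, ∑ j, ∑ p, S i j y m p * christoffel G j m p y := by
    rw [Finset.sum_comm]
    refine Finset.sum_congr rfl fun m _ => Finset.sum_congr rfl fun j _ =>
      Finset.sum_congr rfl fun p _ => ?_
    rw [s3 y hy, mul_comm]
  have t9 : ∑ m, ∑ j, ∑ p, S m i y m p * christoffel G j j p y =
      ∑ m, ∑ j, ∑ p, christoffel G m m p y * S i j y p j := by
    rw [Finset.sum_comm]
    refine Finset.sum_congr rfl fun m _ => Finset.sum_congr rfl fun j _ =>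
      Finset.sum_congr rfl fun p _ => ?_
    rw [s3 y hy, mul_comm]
  -- The nine sums pair off: each of the three terms of the divergence of Ric occurs twice, two sums
  -- vanish, and `t4` is minus the derivative of the scalar curvature.
  rw [t9, t8, t7, t6, t5, t4, t3, t2] at tot
  simp only [divM, dQ]
  linarith

/-- The Ricci identity `∇ₐ∇_c Vᵃ - ∇_c∇ₐ Vᵃ = Ric_{cb} Vᵇ` for a vector field `V`. -/
lemma IsMetricOn.ricci_identity (hG : IsMetricOn G U) {V : Fin d → Model d → ℝ}
    (hV : ∀ a, ContDiffOn ℝ ∞ (V a) U) {W : Model d → Matrix (Fin d) (Fin d) ℝ}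
    (hW : ∀ z ∈ U, ∀ c a, W z c a = pd c (V a) z + ∑ p, christoffel G a c p z * V p z)
    (hy : y ∈ U) (c : Fin d) :
    divM G W y c - pd c (fun z => (W z).trace) y = ∑ b, coordRicci G y c b * V b y := by
  have hU := hG.isOpen
  have dV : ∀ a, DifferentiableAt ℝ (V a) y := fun a => differentiableAt_of_mem (hV a) hU hy
  have dpV : ∀ a b, DifferentiableAt ℝ (pd b (V a)) y := fun a b =>
    differentiableAt_of_mem (contDiffOn_pd (hV a) hU b) hU hy
  have dΓ : ∀ a b e, DifferentiableAt ℝ (christoffel G a b e) y := fun a b e =>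
    differentiableAt_of_mem (hG.christoffel_smooth a b e) hU hy
  have dW : ∀ e c a, pd e (fun z => W z c a) y = pd e (pd c (V a)) y +
      ∑ p, (christoffel G a c p y * pd e (V p) y + V p y * pd e (christoffel G a c p) y) := by
    intro e c a
    rw [pd_congr_on hU (fun z hz => hW z hz c a) hy,
      pd_fun_add (dpV a c) (DifferentiableAt.fun_sum fun p _ => (dΓ a c p).fun_mul (dV p)),
      pd_fun_sum fun p _ => (dΓ a c p).fun_mul (dV p)]
    congr 1
    exact Finset.sum_congr rfl fun p _ => pd_fun_mul (dΓ a c p) (dV p)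
  have dWd : ∀ c a, DifferentiableAt ℝ (fun z => W z c a) y := by
    intro c a
    have : ContDiffOn ℝ ∞ (fun z => W z c a) U := ContDiffOn.congr
      ((contDiffOn_pd (hV a) hU c).add
        (ContDiffOn.sum fun p _ => (hG.christoffel_smooth a c p).mul (hV p)))
      (fun z hz => hW z hz c a)
    exact differentiableAt_of_mem this hU hy
  have dT : pd c (fun z => (W z).trace) y = ∑ a, pd c (fun z => W z a a) y :=
    pd_fun_sum fun a _ => dWd a a
  have e1 : ∑ b, coordRicci G y c b * V b y = ∑ a, ∑ p, (pd a (christoffel G a c p) y -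
      pd c (christoffel G a a p) y + ∑ m, (christoffel G a a m y * christoffel G m c p y -
        christoffel G a c m y * christoffel G m a p y)) * V p y := by
    rw [Finset.sum_comm]
    simp only [coordRicci, riemann, Matrix.of_apply, Finset.sum_mul]
  have e2 : ∑ m, ∑ p, christoffel G m m p y * W y c p =
      ∑ m, ∑ p, christoffel G m m p y * pd c (V p) y +
        ∑ a, ∑ p, ∑ m, christoffel G a a m y * christoffel G m c p y * V p y := by
    simp only [hW y hy, mul_add, Finset.sum_add_distrib, Finset.mul_sum, mul_assoc]
    congr 1
    exact Finset.sum_congr rfl fun a _ => Finset.sum_comm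
  have e3 : ∑ m, ∑ p, christoffel G p m c y * W y p m =
      ∑ a, ∑ p, christoffel G a c p y * pd a (V p) y +
        ∑ a, ∑ p, ∑ m, christoffel G a c m y * christoffel G m a p y * V p y := by
    simp only [hW y hy, mul_add, Finset.sum_add_distrib, Finset.mul_sum, mul_assoc,
      hG.christoffel_symm hy _ _ c]
    congr 1
    · exact Finset.sum_comm
    · rw [Finset.sum_comm]
      exact Finset.sum_congr rfl fun a _ => Finset.sum_comm
  have hcomm : ∀ a, pd a (pd c (V a)) y = pd c (pd a (V a)) y := fun a =>
    pd_pd_comm ((hV a).contDiffAt (hU.mem_nhds hy)) a c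
  rw [divM, e1, e2, e3, dT]
  -- Every term with a derivative of V cancels. The terms in V itself carry ∂Γ and ΓΓ in exactly the
  -- combination that makes up Ric.
  simp only [dW, hcomm, add_mul, sub_mul, Finset.sum_add_distrib, Finset.sum_sub_distrib,
    Finset.sum_mul, mul_comm (V _ y)]
  ring

/-- The scalar `J` in coordinates. -/
noncomputable def coordJ (G : Model d → Matrix (Fin d) (Fin d) ℝ) (y : Model d) : ℝ :=
  (∑ i, ∑ j, (G y)⁻¹ i j * coordRicci G y i j) / (2 * ((d : ℝ) - 1))

/-- The Schouten tensor in coordinates. -/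
noncomputable def coordP (G : Model d → Matrix (Fin d) (Fin d) ℝ) (y : Model d) :
    Matrix (Fin d) (Fin d) ℝ :=
  ((d : ℝ) - 2)⁻¹ • (coordRicci G y - coordJ G y • G y)

lemma IsMetricOn.sum_inv_mul_eq_trace (hG : IsMetricOn G U) (hy : y ∈ U)
    (T : Matrix (Fin d) (Fin d) ℝ) :
    ∑ i, ∑ j, (G y)⁻¹ i j * T i j = (T * (G y)⁻¹).trace := by
  simp only [Matrix.trace, Matrix.diag_apply, Matrix.mul_apply]
  exact Finset.sum_congr rfl fun i _ => Finset.sum_congr rfl fun j _ => by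
    rw [hG.inv_symm hy, mul_comm]

lemma IsMetricOn.trace_self (hG : IsMetricOn G U) (hy : y ∈ U) :
    ∑ i, ∑ j, (G y)⁻¹ i j * G y i j = d := by
  rw [hG.sum_inv_mul_eq_trace hy, hG.mul_inv hy, Matrix.trace_one, Fintype.card_fin]

/-- Since tr Ric = 2(d - 1)J and tr g = d, the trace of Ric - Jg is (d - 2)J. Cancelling d - 2 is
one of the places where the dimension must be at least three. -/
lemma IsMetricOn.trace_coordP (hG : IsMetricOn G U) (hd : 3 ≤ d) (hy : y ∈ U) :
    ∑ i, ∑ j, (G y)⁻¹ i j * coordP G y i j = coordJ G y := by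
  have hd3 : (3 : ℝ) ≤ d := by exact_mod_cast hd
  have hd1 : (d : ℝ) - 1 ≠ 0 := by linarith
  have hd2 : (d : ℝ) - 2 ≠ 0 := by linarith
  have e : ∑ i, ∑ j, (G y)⁻¹ i j * coordP G y i j = ((d : ℝ) - 2)⁻¹ *
      (∑ i, ∑ j, (G y)⁻¹ i j * coordRicci G y i j -
        coordJ G y * ∑ i, ∑ j, (G y)⁻¹ i j * G y i j) := by
    simp only [coordP, Matrix.smul_apply, Matrix.sub_apply, smul_eq_mul, Finset.mul_sum,
      ← Finset.sum_sub_distrib]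
    exact Finset.sum_congr rfl fun _ _ => Finset.sum_congr rfl fun _ _ => by ring
  have e2 : ∑ i, ∑ j, (G y)⁻¹ i j * coordRicci G y i j = 2 * ((d : ℝ) - 1) * coordJ G y := by
    rw [coordJ, mul_div_cancel₀ _ (by simpa using hd1)]
  rw [e, e2, hG.trace_self hy]
  field_simp
  ring

lemma IsMetricOn.coordJ_smooth (hG : IsMetricOn G U) : ContDiffOn ℝ ∞ (coordJ G) U := by
  unfold coordJ
  exact (ContDiffOn.sum fun i _ => ContDiffOn.sum fun j _ =>
    (hG.inv_smooth i j).mul (hG.ricci_smooth i j)).div_const _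

lemma IsMetricOn.coordP_smooth (hG : IsMetricOn G U) : SmoothM (coordP G) U := fun i j =>
  contDiffOn_const.mul ((hG.ricci_smooth i j).sub (hG.coordJ_smooth.mul (hG.smooth i j)))

lemma IsMetricOn.coordHess_smooth (hG : IsMetricOn G U) {u : Model d → ℝ}
    (hu : ContDiffOn ℝ ∞ u U) : SmoothM (coordHess G u) U := fun i j =>
  (contDiffOn_pd (contDiffOn_pd hu hG.isOpen j) hG.isOpen i).sub
    (ContDiffOn.sum fun k _ => (hG.christoffel_smooth k i j).mul (contDiffOn_pd hu hG.isOpen k))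

/-- `∇_c uᵃ` is the Hessian with the second index raised. -/
lemma IsMetricOn.hess_mul_inv (hG : IsMetricOn G U) {u : Model d → ℝ} (hu : ContDiffOn ℝ ∞ u U)
    (hy : y ∈ U) (c a : Fin d) : (coordHess G u y * (G y)⁻¹) c a =
      pd c (fun z => ∑ b, (G z)⁻¹ a b * pd b u z) y +
        ∑ p, christoffel G a c p y * ∑ b, (G y)⁻¹ p b * pd b u y := by
  have hU := hG.isOpen
  have dK : ∀ i j, DifferentiableAt ℝ (fun z => (G z)⁻¹ i j) y := fun i j =>
    differentiableAt_of_mem (hG.inv_smooth i j) hU hy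
  have du : ∀ b, DifferentiableAt ℝ (pd b u) y := fun b =>
    differentiableAt_of_mem (contDiffOn_pd hu hU b) hU hy
  have h1 : ∀ b, pd c (fun z => (G z)⁻¹ a b) y = - ∑ p, christoffel G a c p y * (G y)⁻¹ p b -
      ∑ p, (G y)⁻¹ a p * christoffel G b c p y := fun b => by
    have := congrFun (congrFun (hG.pdM_inv hy c) a) b
    simpa only [pdM_apply, Matrix.sub_apply, Matrix.neg_apply, Matrix.mul_apply, gam_apply,
      Matrix.transpose_apply] using this
  have h2 : pd c (fun z => ∑ b, (G z)⁻¹ a b * pd b u z) y =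
      ∑ b, ((G y)⁻¹ a b * pd c (pd b u) y + pd b u y * pd c (fun z => (G z)⁻¹ a b) y) := by
    rw [pd_fun_sum fun b _ => (dK a b).fun_mul (du b)]
    exact Finset.sum_congr rfl fun b _ => pd_fun_mul (dK a b) (du b)
  have h3 : ∑ p, christoffel G a c p y * ∑ b, (G y)⁻¹ p b * pd b u y =
      ∑ b, pd b u y * ∑ p, christoffel G a c p y * (G y)⁻¹ p b := by
    simp only [Finset.mul_sum]
    rw [Finset.sum_comm]
    exact Finset.sum_congr rfl fun _ _ => Finset.sum_congr rfl fun _ _ => by ring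
  have h4 : ∑ b, pd b u y * ∑ p, (G y)⁻¹ a p * christoffel G b c p y =
      ∑ b, (G y)⁻¹ a b * ∑ k, christoffel G k c b y * pd k u y := by
    simp only [Finset.mul_sum]
    rw [Finset.sum_comm]
    exact Finset.sum_congr rfl fun _ _ => Finset.sum_congr rfl fun _ _ => by ring
  rw [h2, h3]
  simp only [h1, mul_sub, mul_neg, Finset.sum_add_distrib, Finset.sum_sub_distrib,
    Finset.sum_neg_distrib, h4]
  simp only [Matrix.mul_apply, coordHess, Matrix.of_apply, hG.inv_symm hy a, sub_mul,
    Finset.sum_sub_distrib, mul_comm ((G y)⁻¹ _ a)]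
  ring

/-- If `∇∇u + uP + rg = 0` then `dr = P(du)`. -/
lemma IsMetricOn.pd_of_almostEinstein (hG : IsMetricOn G U) (hd : 3 ≤ d) {u r : Model d → ℝ}
    (hu : ContDiffOn ℝ ∞ u U) (hr : ContDiffOn ℝ ∞ r U)
    (h : ∀ z ∈ U, coordHess G u z + u z • coordP G z + r z • G z = 0) (hy : y ∈ U) (c : Fin d) :
    pd c r y = ∑ i, ∑ j, (G y)⁻¹ i j * (coordP G y c i * pd j u y) := by
  have hU := hG.isOpen
  have hd1 : (d : ℝ) - 1 ≠ 0 := by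
    have : (3 : ℝ) ≤ d := by exact_mod_cast hd
    linarith
  have hd2 : (d : ℝ) - 2 ≠ 0 := by
    have : (3 : ℝ) ≤ d := by exact_mod_cast hd
    linarith
  set Q : Model d → Matrix (Fin d) (Fin d) ℝ := fun z => coordRicci G z * (G z)⁻¹ with hQ
  set Pm : Model d → Matrix (Fin d) (Fin d) ℝ := fun z => coordP G z * (G z)⁻¹ with hPm
  set W : Model d → Matrix (Fin d) (Fin d) ℝ := fun z => coordHess G u z * (G z)⁻¹ with hW
  set V : Fin d → Model d → ℝ := fun a z => ∑ b, (G z)⁻¹ a b * pd b u z with hV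
  have sPm : SmoothM Pm U := hG.coordP_smooth.mul hG.inv_smooth
  have sW : SmoothM W U := (hG.coordHess_smooth hu).mul hG.inv_smooth
  have sV : ∀ a, ContDiffOn ℝ ∞ (V a) U := fun a =>
    ContDiffOn.sum fun b _ => (hG.inv_smooth a b).mul (contDiffOn_pd hu hU b)
  have s1 : SmoothM (fun _ : Model d => (1 : Matrix (Fin d) (Fin d) ℝ)) U :=
    fun _ _ => contDiffOn_const
  have smulS : ∀ {f : Model d → ℝ} {E : Model d → Matrix (Fin d) (Fin d) ℝ}, ContDiffOn ℝ ∞ f U →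
      SmoothM E U → SmoothM (fun z => f z • E z) U := fun hf hE k l => hf.mul (hE k l)
  have hJ := hG.coordJ_smooth
  have dJ := differentiableAt_of_mem hJ hU hy
  have du := differentiableAt_of_mem hu hU hy
  have dr := differentiableAt_of_mem hr hU hy
  have trJ : ∀ z ∈ U, (Q z).trace = 2 * ((d : ℝ) - 1) * coordJ G z := by
    intro z hz
    rw [coordJ, hG.sum_inv_mul_eq_trace hz, mul_div_cancel₀ _ (by simpa using hd1)]
  have QPm : ∀ z ∈ U, Q z = (fun _ => ((d : ℝ) - 2)) z • Pm z + coordJ G z •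
      (1 : Matrix _ _ ℝ) := by
    intro z hz
    simp only [hQ, hPm, coordP, Matrix.smul_mul, smul_smul, mul_inv_cancel₀ hd2, one_smul, sub_mul,
      hG.mul_inv hz]
    abel
  have trPm : ∀ z ∈ U, (Pm z).trace = coordJ G z := by
    intro z hz
    rw [← hG.sum_inv_mul_eq_trace hz, hG.trace_coordP hd hz]
  -- Inserting Ric = (d - 2)P + Jg and tr Ric = 2(d - 1)J into the contracted Bianchi identity gives
  -- (d - 2) div P = (d - 2) dJ.
  have divPm : divM G Pm y c = pd c (coordJ G) y := by
    have b := hG.contracted_bianchi hy c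
    rw [pd_congr_on hU trJ hy, pd_const_mul _ dJ, divM_congr hU hy QPm,
      divM_add (smulS contDiffOn_const sPm) (smulS hJ s1) hU hy,
      divM_smul contDiffOn_const sPm hU hy, divM_smul hJ s1 hU hy, hG.divM_one hy] at b
    simp only [pd_const, Matrix.one_apply, zero_mul, Finset.sum_const_zero, mul_ite, mul_one,
      mul_zero, Finset.sum_ite_eq, Finset.mem_univ, if_true] at b
    apply mul_left_cancel₀ hd2
    linarith
  have hE : ∀ z ∈ U, W z + u z • Pm z + r z • (1 : Matrix (Fin d) (Fin d) ℝ) = 0 := by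
    intro z hz
    have := congrArg (fun B => B * (G z)⁻¹) (h z hz)
    beta_reduce at this
    rwa [add_mul, add_mul, Matrix.smul_mul, Matrix.smul_mul, hG.mul_inv hz, zero_mul] at this
  -- The divergence of the equation, with div P = dJ inserted.
  have div0 : divM G W y c + (∑ m, pd m u y * Pm y c m + u y * pd c (coordJ G) y) +
      pd c r y = 0 := by
    have e := divM_congr (G := G) hU hy hE c
    rw [divM_zero, divM_add (sW.add (smulS hu sPm)) (smulS hr s1) hU hy,
      divM_add sW (smulS hu sPm) hU hy, divM_smul hu sPm hU hy, divM_smul hr s1 hU hy,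
      hG.divM_one hy, divPm] at e
    simpa [Matrix.one_apply] using e
  -- The differential of the trace of the equation. Its dJ term is the same as in `div0`.
  have tr0 : pd c (fun z => (W z).trace) y + (u y * pd c (coordJ G) y + coordJ G y * pd c u y) +
      d * pd c r y = 0 := by
    have e : ∀ z ∈ U, (W z).trace + u z * coordJ G z + d * r z = 0 := by
      intro z hz
      have := congrArg Matrix.trace (hE z hz)
      rw [Matrix.trace_add, Matrix.trace_add, Matrix.trace_smul, Matrix.trace_smul,
        Matrix.trace_one, trPm z hz, Matrix.trace_zero, Fintype.card_fin, smul_eq_mul,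
        smul_eq_mul] at this
      linarith
    have e' := pd_congr_on hU e hy c
    have dW := differentiableAt_of_mem sW.trace hU hy
    rwa [pd_const, pd_fun_add (dW.fun_add (du.fun_mul dJ)) (dr.const_mul _),
      pd_fun_add dW (du.fun_mul dJ), pd_fun_mul du dJ, pd_const_mul _ dr] at e'
  have ric := hG.ricci_identity sV (W := W) (fun z hz c a => hG.hess_mul_inv hu hz c a) hy c
  have eV : ∀ T : Matrix (Fin d) (Fin d) ℝ, ∑ b, T c b * V b y =
      ∑ m, pd m u y * (T * (G y)⁻¹) c m := by
    intro T
    simp only [hV, Matrix.mul_apply, Finset.mul_sum]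
    rw [Finset.sum_comm]
    exact Finset.sum_congr rfl fun _ _ => Finset.sum_congr rfl fun _ _ => by ring
  have goal : ∑ i, ∑ j, (G y)⁻¹ i j * (coordP G y c i * pd j u y) =
      ∑ m, pd m u y * Pm y c m := by
    rw [← eV]
    simp only [hV, Finset.mul_sum]
    exact Finset.sum_congr rfl fun _ _ => Finset.sum_congr rfl fun _ _ => by ring
  have hQy : ∑ m, pd m u y * (coordRicci G y * (G y)⁻¹) c m =
      ((d : ℝ) - 2) * ∑ m, pd m u y * Pm y c m + coordJ G y * pd c u y := by
    have := QPm y hy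
    simp only [hQ] at this
    rw [this]
    simp only [Matrix.add_apply, Matrix.smul_apply, smul_eq_mul, Matrix.one_apply, mul_add,
      Finset.sum_add_distrib, mul_ite, mul_one, mul_zero, Finset.sum_ite_eq,
      Finset.mem_univ, if_true, mul_left_comm _ ((d : ℝ) - 2), ← Finset.mul_sum]
    ring
  rw [eV, hQy] at ric
  rw [goal]
  -- In `div0` minus `tr0` the Ricci identity supplies (d - 2)P(du) + J du. The J du terms cancel,
  -- the loose P(du) raises its coefficient to d - 1, and dr enters with coefficient 1 - d.
  apply mul_left_cancel₀ hd1
  linarith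

end Prolongation

/-! ### Conformal change of the metric in coordinates -/

section Conformal

variable {d : ℕ} {U : Set (Model d)} {y : Model d} {G G' : Model d → Matrix (Fin d) (Fin d) ℝ}
  {f : Model d → ℝ}

/-- The difference of the connection matrices of `e^{2 f} G` and `G`. -/
noncomputable def confT (G : Model d → Matrix (Fin d) (Fin d) ℝ) (f : Model d → ℝ) (i : Fin d)
    (z : Model d) : Matrix (Fin d) (Fin d) ℝ :=
  Matrix.of fun k l => pd i f z * (1 : Matrix (Fin d) (Fin d) ℝ) k l +
    (1 : Matrix (Fin d) (Fin d) ℝ) k i * pd l f z - (∑ b, (G z)⁻¹ k b * pd b f z) * G z i l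

lemma IsMetricOn.conformal (hG : IsMetricOn G U) (hf : ContDiffOn ℝ ∞ f U)
    (h : ∀ z ∈ U, G' z = Real.exp (2 * f z) • G z) : IsMetricOn G' U where
  isOpen := hG.isOpen
  smooth i j := ContDiffOn.congr
    ((Real.contDiff_exp.comp_contDiffOn (contDiffOn_const.mul hf)).mul (hG.smooth i j))
    fun z hz => by rw [h z hz]; rfl
  symm z hz i j := by
    rw [h z hz, Matrix.smul_apply, Matrix.smul_apply, hG.symm z hz]
  det z hz := by
    rw [h z hz, Matrix.det_smul]
    exact (((Real.exp_pos _).ne'.isUnit).pow _).mul (hG.det z hz)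

lemma IsMetricOn.inv_conformal (hG : IsMetricOn G U) (hy : y ∈ U)
    (h : G' y = Real.exp (2 * f y) • G y) : (G' y)⁻¹ = (Real.exp (2 * f y))⁻¹ • (G y)⁻¹ := by
  rw [h]
  exact Matrix.inv_smul' _ (Units.mk0 _ (Real.exp_ne_zero (2 * f y))) (hG.det y hy)

/-- Lowering the index of the gradient. -/
lemma IsMetricOn.sum_metric_grad (hG : IsMetricOn G U) (hy : y ∈ U) (u : Fin d → ℝ) (j : Fin d) :
    ∑ m, G y j m * ∑ b, (G y)⁻¹ m b * u b = u j := by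
  have : ∀ m, G y j m * ∑ b, (G y)⁻¹ m b * u b = ∑ b, G y j m * (G y)⁻¹ m b * u b := fun m => by
    rw [Finset.mul_sum]
    exact Finset.sum_congr rfl fun b _ => by ring
  simp only [this]
  rw [Finset.sum_comm]
  simp only [← Finset.sum_mul, hG.sum_mul_inv hy]
  simp

/-- The corrected symbols are torsion free and preserve e^{2f}G, so they are its Levi-Civita
connection by uniqueness. -/
lemma IsMetricOn.gam_conformal (hG : IsMetricOn G U) (hf : ContDiffOn ℝ ∞ f U)
    (h : ∀ z ∈ U, G' z = Real.exp (2 * f z) • G z) (hy : y ∈ U) (i : Fin d) :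
    gam G' i y = gam G i y + confT G f i y := by
  have hU := hG.isOpen
  have df := differentiableAt_of_mem hf hU hy
  refine (hG.conformal hf h).christoffel_unique hy (fun i => gam G i y + confT G f i y) ?_ ?_ i
  · intro k i j
    simp only [Matrix.add_apply, gam_apply, confT, Matrix.of_apply, hG.christoffel_symm hy k i j,
      hG.symm y hy i j]
    ring
  · intro k
    have e1 : pdM k G' y = Real.exp (2 * f y) • ((2 * pd k f y) • G y + pdM k G y) := by
      ext i j
      rw [pdM_congr hU h hy]
      simp only [pdM_apply, Matrix.smul_apply, smul_eq_mul, Matrix.add_apply]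
      rw [pd_fun_mul (((df.const_mul 2)).exp) (hG.diffAt hy i j), pd_exp k (df.const_mul 2),
        pd_const_mul 2 df]
      ring
    -- Lowered with G, the correction is df_k G_{ij} plus a part antisymmetric in i and j. Only the
    -- first survives symmetrisation, and it accounts for the derivative of the factor e^{2f}.
    have e2 : (confT G f k y).transpose * G y + G y * confT G f k y = (2 * pd k f y) • G y := by
      ext i j
      set V : Fin d → ℝ := fun m => ∑ b, (G y)⁻¹ m b * pd b f y with hV
      have hl : ∀ j, ∑ m, G y j m * V m = pd j f y := fun j =>
        hG.sum_metric_grad hy (fun b => pd b f y) j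
      have e3 : ∀ i j, ∑ m, G y i m * confT G f k y m j =
          pd k f y * G y i j + G y i k * pd j f y - pd i f y * G y k j := by
        intro i j
        rw [← hl i, Finset.sum_mul]
        simp only [confT, Matrix.of_apply, Matrix.one_apply, mul_add, mul_sub,
          Finset.sum_add_distrib, Finset.sum_sub_distrib, ite_mul, mul_ite, one_mul, mul_one,
          zero_mul, mul_zero, Finset.sum_ite_eq', Finset.mem_univ, if_true, ← mul_assoc, hV]
        ring
      have e4 : ∑ m, confT G f k y m i * G y m j = ∑ m, G y j m * confT G f k y m i :=
        Finset.sum_congr rfl fun m _ => by rw [hG.symm y hy m j, mul_comm]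
      simp only [Matrix.add_apply, Matrix.mul_apply, Matrix.transpose_apply, Matrix.smul_apply,
        smul_eq_mul]
      rw [e4, e3, e3, hG.symm y hy j i, hG.symm y hy j k, hG.symm y hy i k]
      ring
    rw [e1, h y hy, hG.pdM_metric hy, ← e2]
    simp only [Matrix.transpose_add, add_mul, mul_add, Matrix.mul_smul, Matrix.smul_mul, smul_add]
    abel

lemma IsMetricOn.confT_smooth (hG : IsMetricOn G U) (hf : ContDiffOn ℝ ∞ f U) (i : Fin d) :
    SmoothM (confT G f i) U := fun k l =>
  (((contDiffOn_pd hf hG.isOpen i).mul contDiffOn_const).add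
    (contDiffOn_const.mul (contDiffOn_pd hf hG.isOpen l))).sub
    ((ContDiffOn.sum fun b _ => (hG.inv_smooth k b).mul (contDiffOn_pd hf hG.isOpen b)).mul
      (hG.smooth i l))

lemma coordHess_congr {u v : Model d → ℝ} (hU : IsOpen U) (h : ∀ z ∈ U, u z = v z) (hy : y ∈ U) :
    coordHess G u y = coordHess G v y := by
  have hp : ∀ j, ∀ z ∈ U, pd j u z = pd j v z := fun j z hz => pd_congr_on hU h hz j
  ext i j
  simp only [coordHess, Matrix.of_apply]
  rw [pd_congr_on hU (hp j) hy]
  simp only [hp _ _ hy]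

lemma IsMetricOn.coordHess_symm (hG : IsMetricOn G U) (hf : ContDiffOn ℝ ∞ f U) (hy : y ∈ U)
    (i j : Fin d) : coordHess G f y i j = coordHess G f y j i := by
  simp only [coordHess, Matrix.of_apply]
  rw [pd_pd_comm (hf.contDiffAt (hG.isOpen.mem_nhds hy))]
  simp only [hG.christoffel_symm hy _ i j]

/-- The covariant derivative of the tensor `confT`, up to a term symmetric in `a` and `j`. -/
lemma IsMetricOn.cov_confT (hG : IsMetricOn G U) (hf : ContDiffOn ℝ ∞ f U) (hy : y ∈ U)
    (a j k l : Fin d) :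
    (pdM a (confT G f j) y + (gam G a y * confT G f j y - confT G f j y * gam G a y)) k l =
      coordHess G f y a j * (1 : Matrix (Fin d) (Fin d) ℝ) k l +
      (1 : Matrix (Fin d) (Fin d) ℝ) k j * coordHess G f y a l -
      (coordHess G f y * (G y)⁻¹) a k * G y j l +
      ∑ p, christoffel G p a j y * confT G f p y k l := by
  have hU := hG.isOpen
  set V : Fin d → Model d → ℝ := fun m z => ∑ b, (G z)⁻¹ m b * pd b f z with hV
  have dV : ∀ m, DifferentiableAt ℝ (V m) y := fun m => differentiableAt_of_mem
    (ContDiffOn.sum fun b _ => (hG.inv_smooth m b).mul (contDiffOn_pd hf hU b)) hU hy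
  have dp : ∀ b, DifferentiableAt ℝ (pd b f) y := fun b =>
    differentiableAt_of_mem (contDiffOn_pd hf hU b) hU hy
  have dG := hG.diffAt hy
  have hT : ∀ j z k l, confT G f j z k l = pd j f z * (1 : Matrix (Fin d) (Fin d) ℝ) k l +
    (1 : Matrix (Fin d) (Fin d) ℝ) k j * pd l f z - V k z * G z j l := fun _ _ _ _ => rfl
  have e1 : pdM a (confT G f j) y k l = pd a (pd j f) y * (1 : Matrix (Fin d) (Fin d) ℝ) k l +
      (1 : Matrix (Fin d) (Fin d) ℝ) k j * pd a (pd l f) y -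
      (V k y * pd a (fun z => G z j l) y + G y j l * pd a (V k) y) := by
    rw [pdM_apply]
    simp only [hT]
    rw [pd_fun_sub (((dp j).mul_const _).fun_add ((dp l).const_mul _)) ((dV k).fun_mul (dG j l)),
      pd_fun_add ((dp j).mul_const _) ((dp l).const_mul _), pd_fun_mul (dV k) (dG j l),
      pd_const_mul _ (dp l), pd_fun_mul (dp j) (differentiableAt_const _), pd_const]
    ring
  have e2 : pd a (V k) y = (coordHess G f y * (G y)⁻¹) a k -
      ∑ p, christoffel G k a p y * V p y := by
    rw [hG.hess_mul_inv hf hy]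
    ring
  have e3 : ∀ i, pd a (pd i f) y = coordHess G f y a i + ∑ p, christoffel G p a i y * pd p f y := by
    intro i
    simp only [coordHess, Matrix.of_apply]
    ring
  have e4 : (gam G a y * confT G f j y) k l = pd j f y * christoffel G k a l y +
      christoffel G k a j y * pd l f y - (∑ p, christoffel G k a p y * V p y) * G y j l := by
    simp only [Matrix.mul_apply, gam_apply, hT, mul_add, mul_sub, Finset.sum_add_distrib,
      Finset.sum_sub_distrib, Finset.sum_mul, Matrix.one_apply, mul_ite, ite_mul, mul_one, one_mul,
      mul_zero, zero_mul, Finset.sum_ite_eq', Finset.mem_univ, if_true, ← mul_assoc]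
    ring
  have e5 : (confT G f j y * gam G a y) k l = pd j f y * christoffel G k a l y +
      (1 : Matrix (Fin d) (Fin d) ℝ) k j * (∑ p, christoffel G p a l y * pd p f y) -
      V k y * ∑ m, G y j m * christoffel G m a l y := by
    simp only [Matrix.mul_apply, gam_apply, hT, add_mul, sub_mul, Finset.sum_add_distrib,
      Finset.sum_sub_distrib, Finset.mul_sum, mul_assoc, mul_comm (christoffel G _ a l y)]
    simp [Matrix.one_apply]
  have e6 : ∑ p, christoffel G p a j y * confT G f p y k l =
      (∑ p, christoffel G p a j y * pd p f y) * (1 : Matrix (Fin d) (Fin d) ℝ) k l +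
      christoffel G k a j y * pd l f y - V k y * ∑ m, christoffel G m a j y * G y m l := by
    simp only [hT, mul_add, mul_sub, Finset.sum_add_distrib, Finset.sum_sub_distrib,
      Finset.mul_sum, Matrix.one_apply, mul_ite, ite_mul, mul_one, one_mul,
      mul_zero, zero_mul, Finset.sum_ite_eq, Finset.mem_univ, if_true, mul_left_comm (V k y)]
    split_ifs <;> simp
  rw [Matrix.add_apply, Matrix.sub_apply, e1, e2, e3, e3, e4, e5, e6, hG.pd_metric hy]
  ring

/-- The conformal change of the Ricci tensor. -/
lemma IsMetricOn.ricci_conformal (hG : IsMetricOn G U) (hf : ContDiffOn ℝ ∞ f U)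
    (h : ∀ z ∈ U, G' z = Real.exp (2 * f z) • G z) (hy : y ∈ U) (j l : Fin d) :
    coordRicci G' y j l = coordRicci G y j l -
      ((d : ℝ) - 2) * (coordHess G f y j l - pd j f y * pd l f y) -
      (∑ i, ∑ k, (G y)⁻¹ i k * coordHess G f y i k +
        ((d : ℝ) - 2) * ∑ i, ∑ k, (G y)⁻¹ i k * (pd i f y * pd k f y)) * G y j l := by
  have hU := hG.isOpen
  have hg := hG.gam_smooth
  have ht := hG.confT_smooth hf
  -- For Γ' = Γ + T the curvature is R' = R + d^∇T + T∧T. The rest of the proof traces the two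
  -- corrections.
  have key : ∀ a, curv G' a j y = curv G a j y +
      ((pdM a (confT G f j) y + (gam G a y * confT G f j y - confT G f j y * gam G a y)) -
       (pdM j (confT G f a) y + (gam G j y * confT G f a y - confT G f a y * gam G j y))) +
      (confT G f a y * confT G f j y - confT G f j y * confT G f a y) := by
    intro a
    have hd : ∀ b c, pdM b (gam G' c) y = pdM b (gam G c) y + pdM b (confT G f c) y := by
      intro b c
      rw [pdM_congr hU (fun z hz => hG.gam_conformal hf h hz c) hy, pdM_add (hg c) (ht c) hU hy]
    rw [curv_eq, curv_eq, hd, hd, hG.gam_conformal hf h hy, hG.gam_conformal hf h hy]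
    noncomm_ring
  set V : Fin d → ℝ := fun m => ∑ b, (G y)⁻¹ m b * pd b f y with hV
  set N : ℝ := ∑ i, ∑ k, (G y)⁻¹ i k * (pd i f y * pd k f y) with hN
  have hl : ∀ j, ∑ m, G y j m * V m = pd j f y := fun j =>
    hG.sum_metric_grad hy (fun b => pd b f y) j
  have hl' : ∀ j, ∑ m, V m * G y m j = pd j f y := fun j => by
    rw [← hl j]
    exact Finset.sum_congr rfl fun m _ => by rw [hG.symm y hy m j, mul_comm]
  have hVN : ∑ m, V m * pd m f y = N := by
    simp only [hN, hV, Finset.sum_mul]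
    exact Finset.sum_congr rfl fun _ _ => Finset.sum_congr rfl fun _ _ => by ring
  have hT : ∀ j k l, confT G f j y k l = pd j f y * (1 : Matrix (Fin d) (Fin d) ℝ) k l +
    (1 : Matrix (Fin d) (Fin d) ℝ) k j * pd l f y - V k * G y j l := fun _ _ _ => rfl
  have trT : ∀ m, ∑ a, confT G f a y a m = d * pd m f y := by
    intro m
    simp only [hT, Finset.sum_add_distrib, Finset.sum_sub_distrib, hl']
    simp [Matrix.one_apply]
  have gT : ∀ j l, ∑ m, pd m f y * confT G f j y m l = 2 * (pd j f y * pd l f y) - N * G y j l := by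
    intro j l
    have w : ∑ m, pd m f y * (V m * G y j l) = N * G y j l := by
      rw [← hVN, Finset.sum_mul]
      exact Finset.sum_congr rfl fun _ _ => by ring
    simp only [hT, mul_add, mul_sub, Finset.sum_add_distrib, Finset.sum_sub_distrib, w,
      Matrix.one_apply, mul_ite, ite_mul, mul_one, one_mul, mul_zero, zero_mul,
      Finset.sum_ite_eq', Finset.mem_univ, if_true]
    ring
  have t1 : ∑ a, (confT G f a y * confT G f j y) a l =
      d * (2 * (pd j f y * pd l f y) - N * G y j l) := by
    simp only [Matrix.mul_apply]
    rw [Finset.sum_comm, ← gT, Finset.mul_sum]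
    refine Finset.sum_congr rfl fun m _ => ?_
    rw [← Finset.sum_mul, trT]
    ring
  have t2 : ∑ a, (confT G f j y * confT G f a y) a l =
      (d + 2) * (pd j f y * pd l f y) - 2 * N * G y j l := by
    have e : ∀ a, (confT G f j y * confT G f a y) a l = pd j f y * confT G f a y a l +
        (1 : Matrix (Fin d) (Fin d) ℝ) a j * ∑ m, pd m f y * confT G f a y m l -
        V a * ∑ m, G y j m * confT G f a y m l := by
      intro a
      simp only [Matrix.mul_apply, hT j a, add_mul, sub_mul, Finset.sum_add_distrib,
        Finset.sum_sub_distrib, Finset.mul_sum, mul_assoc]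
      simp [Matrix.one_apply]
    have e' : ∀ a, ∑ m, G y j m * confT G f a y m l =
        pd a f y * G y j l + G y j a * pd l f y - pd j f y * G y a l := by
      intro a
      rw [← hl j]
      simp only [hT, mul_add, mul_sub, Finset.sum_add_distrib, Finset.sum_sub_distrib,
        Finset.sum_mul, Matrix.one_apply, mul_ite, ite_mul, mul_one, one_mul, mul_zero, zero_mul,
        Finset.sum_ite_eq', Finset.mem_univ, if_true, ← mul_assoc]
      ring
    have e3 : ∑ a, V a * (pd a f y * G y j l + G y j a * pd l f y - pd j f y * G y a l) =
        N * G y j l + pd j f y * pd l f y - pd j f y * pd l f y := by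
      have w1 : ∑ a, V a * (pd a f y * G y j l) = N * G y j l := by
        rw [← hVN, Finset.sum_mul]
        exact Finset.sum_congr rfl fun _ _ => by ring
      have w2 : ∑ a, V a * (G y j a * pd l f y) = pd j f y * pd l f y := by
        rw [← hl j, Finset.sum_mul]
        exact Finset.sum_congr rfl fun _ _ => by ring
      have w3 : ∑ a, V a * (pd j f y * G y a l) = pd j f y * pd l f y := by
        rw [← hl' l, Finset.mul_sum]
        exact Finset.sum_congr rfl fun _ _ => by ring
      simp only [mul_add, mul_sub, Finset.sum_add_distrib, Finset.sum_sub_distrib, w1, w2, w3]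
    simp only [e, e', gT, Finset.sum_add_distrib, Finset.sum_sub_distrib, ← Finset.mul_sum, trT, e3]
    simp [Matrix.one_apply]
    ring
  have t3 : ∑ a, (coordHess G f y * (G y)⁻¹) j a * G y a l = coordHess G f y j l := by
    rw [← Matrix.mul_apply, mul_assoc, hG.inv_mul hy, mul_one]
  have t4 : ∑ i, ∑ k, (G y)⁻¹ i k * coordHess G f y i k =
      ∑ a, (coordHess G f y * (G y)⁻¹) a a := hG.sum_inv_mul_eq_trace hy _
  have kc : ∀ a, curv G' a j y a l = curv G a j y a l + (_ - _) + (_ - _) := fun a =>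
    congrFun (congrFun (key a) a) l
  -- With the lower indices in a common order, the remainders Γ^p_{aj} T_p of the two covariant
  -- derivatives coincide and drop out of the alternation.
  simp only [hG.cov_confT hf hy, hG.christoffel_symm hy _ j, hG.coordHess_symm hf hy j] at kc
  simp only [coordRicci_apply, kc, Finset.sum_add_distrib, Finset.sum_sub_distrib, t1, t2, t3, t4,
    ← Finset.sum_mul]
  simp [Matrix.one_apply]
  rw [hG.coordHess_symm hf hy l j]
  ring

lemma IsMetricOn.trace_conformal (hG : IsMetricOn G U) (hy : y ∈ U)
    (h : G' y = Real.exp (2 * f y) • G y) (T : Matrix (Fin d) (Fin d) ℝ) :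
    ∑ i, ∑ k, (G' y)⁻¹ i k * T i k =
      (Real.exp (2 * f y))⁻¹ * ∑ i, ∑ k, (G y)⁻¹ i k * T i k := by
  rw [hG.inv_conformal hy h]
  simp only [Matrix.smul_apply, smul_eq_mul, Finset.mul_sum, mul_assoc]

/-- The conformal change of `J`. -/
lemma IsMetricOn.coordJ_conformal (hG : IsMetricOn G U) (hd : 3 ≤ d) (hf : ContDiffOn ℝ ∞ f U)
    (h : ∀ z ∈ U, G' z = Real.exp (2 * f z) • G z) (hy : y ∈ U) :
    coordJ G' y = (Real.exp (2 * f y))⁻¹ * (coordJ G y -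
      ∑ i, ∑ k, (G y)⁻¹ i k * coordHess G f y i k -
      ((d : ℝ) - 2) / 2 * ∑ i, ∑ k, (G y)⁻¹ i k * (pd i f y * pd k f y)) := by
  have hd3 : (3 : ℝ) ≤ d := by exact_mod_cast hd
  have hd1 : (d : ℝ) - 1 ≠ 0 := by linarith
  set H := ∑ i, ∑ k, (G y)⁻¹ i k * coordHess G f y i k with hH
  set N := ∑ i, ∑ k, (G y)⁻¹ i k * (pd i f y * pd k f y) with hN
  have e : ∑ i, ∑ k, (G y)⁻¹ i k * coordRicci G' y i k =
      ∑ i, ∑ k, (G y)⁻¹ i k * coordRicci G y i k - ((d : ℝ) - 2) * (H - N) -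
        (H + ((d : ℝ) - 2) * N) * d := by
    have e' : ∀ i k, (G y)⁻¹ i k * coordRicci G' y i k = (G y)⁻¹ i k * coordRicci G y i k -
        ((d : ℝ) - 2) * ((G y)⁻¹ i k * coordHess G f y i k -
          (G y)⁻¹ i k * (pd i f y * pd k f y)) -
        (H + ((d : ℝ) - 2) * N) * ((G y)⁻¹ i k * G y i k) := fun i k => by
      rw [hG.ricci_conformal hf h hy]
      ring
    simp only [e', Finset.sum_sub_distrib, ← Finset.mul_sum]
    rw [hG.trace_self hy]
  rw [coordJ, hG.trace_conformal hy (h y hy), e, coordJ]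
  field_simp
  ring

/-- The conformal change of the Schouten tensor. -/
lemma IsMetricOn.coordP_conformal (hG : IsMetricOn G U) (hd : 3 ≤ d) (hf : ContDiffOn ℝ ∞ f U)
    (h : ∀ z ∈ U, G' z = Real.exp (2 * f z) • G z) (hy : y ∈ U) (j l : Fin d) :
    coordP G' y j l = coordP G y j l - (coordHess G f y j l - pd j f y * pd l f y) -
      1 / 2 * (∑ i, ∑ k, (G y)⁻¹ i k * (pd i f y * pd k f y)) * G y j l := by
  have hd3 : (3 : ℝ) ≤ d := by exact_mod_cast hd
  have hd2 : (d : ℝ) - 2 ≠ 0 := by linarith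
  simp only [coordP, Matrix.smul_apply, Matrix.sub_apply, smul_eq_mul]
  rw [hG.ricci_conformal hf h hy, hG.coordJ_conformal hd hf h hy, h y hy, Matrix.smul_apply,
    smul_eq_mul]
  have := (Real.exp_pos (2 * f y)).ne'
  field_simp
  ring

/-- The conformal change of `∇∇s + sP`, for a density `s` of weight one. -/
lemma IsMetricOn.hess_add_schouten_conformal (hG : IsMetricOn G U) (hd : 3 ≤ d)
    (hf : ContDiffOn ℝ ∞ f U) (h : ∀ z ∈ U, G' z = Real.exp (2 * f z) • G z) {s s' : Model d → ℝ}
    (hs : ContDiffOn ℝ ∞ s U) (hs' : ∀ z ∈ U, s' z = Real.exp (f z) * s z) (hy : y ∈ U) :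
    coordHess G' s' y + s' y • coordP G' y = Real.exp (f y) • (coordHess G s y + s y • coordP G y +
      (∑ i, ∑ k, (G y)⁻¹ i k * (pd i f y * pd k s y) +
        s y / 2 * ∑ i, ∑ k, (G y)⁻¹ i k * (pd i f y * pd k f y)) • G y) := by
  have hU := hG.isOpen
  have df : ∀ z ∈ U, DifferentiableAt ℝ f z := fun z hz => differentiableAt_of_mem hf hU hz
  have ds : ∀ z ∈ U, DifferentiableAt ℝ s z := fun z hz => differentiableAt_of_mem hs hU hz
  have dpf : ∀ i, DifferentiableAt ℝ (pd i f) y := fun i =>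
    differentiableAt_of_mem (contDiffOn_pd hf hU i) hU hy
  have dps : ∀ i, DifferentiableAt ℝ (pd i s) y := fun i =>
    differentiableAt_of_mem (contDiffOn_pd hs hU i) hU hy
  have e1 : ∀ i, ∀ z ∈ U, pd i s' z = Real.exp (f z) * (pd i s z + s z * pd i f z) := by
    intro i z hz
    rw [pd_congr_on hU hs' hz, pd_fun_mul (df z hz).exp (ds z hz), pd_exp i (df z hz)]
    ring
  have e2 : ∀ i j, pd i (pd j s') y = Real.exp (f y) * (pd i (pd j s) y + s y * pd i (pd j f) y +
      pd i s y * pd j f y + pd i f y * pd j s y + s y * (pd i f y * pd j f y)) := by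
    intro i j
    rw [pd_congr_on hU (e1 j) hy,
      pd_fun_mul (df y hy).exp ((dps j).fun_add ((ds y hy).fun_mul (dpf j))),
      pd_exp i (df y hy), pd_fun_add (dps j) ((ds y hy).fun_mul (dpf j)),
      pd_fun_mul (ds y hy) (dpf j)]
    ring
  have eΓ : ∀ k i j, christoffel G' k i j y = christoffel G k i j y + confT G f i y k j :=
    fun k i j => congrFun (congrFun (hG.gam_conformal hf h hy i) k) j
  set A := ∑ i, ∑ k, (G y)⁻¹ i k * (pd i f y * pd k s y) with hA
  set N := ∑ i, ∑ k, (G y)⁻¹ i k * (pd i f y * pd k f y) with hN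
  have eT : ∀ (w : Fin d → ℝ) (i j), ∑ k, confT G f i y k j * w k =
      pd i f y * w j + pd j f y * w i -
        (∑ i, ∑ k, (G y)⁻¹ i k * (pd i f y * w k)) * G y i j := by
    intro w i j
    have w1 : ∑ k, (∑ b, (G y)⁻¹ k b * pd b f y) * G y i j * w k =
        (∑ i, ∑ k, (G y)⁻¹ i k * (pd i f y * w k)) * G y i j := by
      rw [Finset.sum_comm, Finset.sum_mul]
      refine Finset.sum_congr rfl fun k _ => ?_
      rw [Finset.sum_mul, Finset.sum_mul, Finset.sum_mul]
      refine Finset.sum_congr rfl fun b _ => ?_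
      rw [hG.inv_symm hy]
      ring
    rw [← w1]
    simp only [confT, Matrix.of_apply, add_mul, sub_mul, Finset.sum_add_distrib,
      Finset.sum_sub_distrib]
    simp [Matrix.one_apply]
  ext i j
  have eS : ∑ k, christoffel G' k i j y * pd k s' y = Real.exp (f y) *
      (∑ k, christoffel G k i j y * pd k s y + s y * ∑ k, christoffel G k i j y * pd k f y +
        (pd i f y * pd j s y + pd j f y * pd i s y - A * G y i j) +
        s y * (2 * (pd i f y * pd j f y) - N * G y i j)) := by
    have w : ∀ k, christoffel G' k i j y * pd k s' y = Real.exp (f y) *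
      (christoffel G k i j y * pd k s y + s y * (christoffel G k i j y * pd k f y) +
        confT G f i y k j * pd k s y + s y * (confT G f i y k j * pd k f y)) := by
      intro k
      rw [eΓ, e1 k y hy]
      ring
    simp only [w, ← Finset.mul_sum, Finset.sum_add_distrib]
    rw [eT (fun k => pd k s y), eT (fun k => pd k f y)]
    ring
  simp only [Matrix.add_apply, Matrix.smul_apply, smul_eq_mul]
  rw [hG.coordP_conformal hd hf h hy, hs' y hy]
  simp only [coordHess, Matrix.of_apply]
  -- Weight one is what makes the mixed terms ds ⊗ df cancel against the change of Γ. The term s(∇∇f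
  -- - df ⊗ df) is cancelled by the change of P, so only multiples of the metric remain.
  rw [eS, e2]
  ring

end Conformal

/-! ### Change of coordinates -/

section ChartChange

variable {d : ℕ} {U U' : Set (Model d)} {y : Model d} {G G' : Model d → Matrix (Fin d) (Fin d) ℝ}
  {φ : Model d → Model d}

/-- The Jacobian matrix of a map. -/
noncomputable def jac (φ : Model d → Model d) (z : Model d) : Matrix (Fin d) (Fin d) ℝ :=
  Matrix.of fun a i => pd i (fun w => φ w a) z

/-- `G` is the pullback of `G'` by `φ`. -/
structure IsPullback (G G' : Model d → Matrix (Fin d) (Fin d) ℝ) (φ : Model d → Model d)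
    (U U' : Set (Model d)) : Prop where
  source : IsMetricOn G U
  target : IsMetricOn G' U'
  smooth : ContDiffOn ℝ ∞ φ U
  maps : ∀ z ∈ U, φ z ∈ U'
  eq : ∀ z ∈ U, G z = (jac φ z).transpose * G' (φ z) * jac φ z

namespace IsPullback

lemma smooth_apply (h : IsPullback G G' φ U U') (a : Fin d) :
    ContDiffOn ℝ ∞ (fun z => φ z a) U :=
  (EuclideanSpace.proj (𝕜 := ℝ) a : Model d →L[ℝ] ℝ).contDiff.comp_contDiffOn h.smooth

lemma jac_smooth (h : IsPullback G G' φ U U') : SmoothM (jac φ) U := fun a i =>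
  contDiffOn_pd (h.smooth_apply a) h.source.isOpen i

lemma pd_jac_symm (h : IsPullback G G' φ U U') (hy : y ∈ U) (i : Fin d) (a j : Fin d) :
    pdM i (jac φ) y a j = pdM j (jac φ) y a i :=
  pd_pd_comm ((h.smooth_apply a).contDiffAt (h.source.isOpen.mem_nhds hy)) i j

/-- The determinant of the pulled back metric has det(dφ) as a factor, so nondegeneracy of that
metric already makes φ a local diffeomorphism. -/
lemma isUnit_jac (h : IsPullback G G' φ U U') (hy : y ∈ U) : IsUnit (jac φ y).det := by
  have := h.source.det y hy
  rw [h.eq y hy, Matrix.det_mul] at this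
  exact isUnit_of_mul_isUnit_right this

lemma jac_mul_inv (h : IsPullback G G' φ U U') (hy : y ∈ U) : jac φ y * (jac φ y)⁻¹ = 1 :=
  Matrix.mul_nonsing_inv _ (h.isUnit_jac hy)

lemma inv_mul_jac (h : IsPullback G G' φ U U') (hy : y ∈ U) : (jac φ y)⁻¹ * jac φ y = 1 :=
  Matrix.nonsing_inv_mul _ (h.isUnit_jac hy)

lemma chain (h : IsPullback G G' φ U U') (hy : y ∈ U) {f : Model d → ℝ}
    (hf : ContDiffOn ℝ ∞ f U') (i : Fin d) :
    pd i (fun z => f (φ z)) y = ∑ a, jac φ y a i * pd a f (φ y) :=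
  pd_comp_map ((h.smooth.contDiffAt (h.source.isOpen.mem_nhds hy)).differentiableAt (by simp))
    (differentiableAt_of_mem hf h.target.isOpen (h.maps y hy)) i

lemma comp_smooth (h : IsPullback G G' φ U U') {f : Model d → ℝ} (hf : ContDiffOn ℝ ∞ f U') :
    ContDiffOn ℝ ∞ (fun z => f (φ z)) U :=
  hf.comp h.smooth h.maps

lemma comp_smoothM (h : IsPullback G G' φ U U') {A : Model d → Matrix (Fin d) (Fin d) ℝ}
    (hA : SmoothM A U') : SmoothM (fun z => A (φ z)) U := fun k l => h.comp_smooth (hA k l)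

lemma chainM (h : IsPullback G G' φ U U') (hy : y ∈ U) {A : Model d → Matrix (Fin d) (Fin d) ℝ}
    (hA : SmoothM A U') (i : Fin d) :
    pdM i (fun z => A (φ z)) y = ∑ a, jac φ y a i • pdM a A (φ y) := by
  ext k l
  simp only [pdM_apply, Matrix.sum_apply, Matrix.smul_apply, smul_eq_mul]
  exact h.chain hy (hA k l) i

/-- The pulled back connection form. -/
noncomputable def pullGam (G' : Model d → Matrix (Fin d) (Fin d) ℝ) (φ : Model d → Model d)
    (i : Fin d) (z : Model d) : Matrix (Fin d) (Fin d) ℝ :=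
  ∑ b, jac φ z b i • gam G' b (φ z)

lemma pullGam_apply (i : Fin d) (z : Model d) (k l : Fin d) :
    pullGam G' φ i z k l = ∑ b, jac φ z b i * gam G' b (φ z) k l := by
  simp [pullGam, Matrix.sum_apply]

lemma pullGam_smooth (h : IsPullback G G' φ U U') (i : Fin d) : SmoothM (pullGam G' φ i) U := by
  intro k l
  simp only [pullGam_apply]
  exact ContDiffOn.sum fun b _ => (h.jac_smooth b i).mul
    (h.comp_smoothM (h.target.gam_smooth b) k l)

/-- The Levi-Civita connection of the pulled back metric, as a gauge transformation. -/
lemma jac_mul_gam (h : IsPullback G G' φ U U') (hy : y ∈ U) (i : Fin d) :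
    jac φ y * gam G i y = pdM i (jac φ) y + pullGam G' φ i y * jac φ y := by
  have hU := h.source.isOpen
  have hy' := h.maps y hy
  set A := jac φ y with hA
  -- The candidate is the gauge transform A⁻¹dA + A⁻¹ωA of the pulled back form ω. It is torsion
  -- free since second derivatives of φ commute and Γ' is symmetric; it preserves G by
  -- differentiating Aᵀ G' A.
  have key : ∀ i, gam G i y = A⁻¹ * (pdM i (jac φ) y + pullGam G' φ i y * A) := by
    refine h.source.christoffel_unique hy _ ?_ ?_
    · have hs : ∀ i j a, (pdM i (jac φ) y + pullGam G' φ i y * A) a j =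
          (pdM j (jac φ) y + pullGam G' φ j y * A) a i := by
        intro i j a
        rw [Matrix.add_apply, Matrix.add_apply, h.pd_jac_symm hy]
        congr 1
        simp only [Matrix.mul_apply, pullGam_apply, Finset.sum_mul, gam_apply, ← hA]
        rw [Finset.sum_comm]
        refine Finset.sum_congr rfl fun b _ => Finset.sum_congr rfl fun c _ => ?_
        rw [h.target.christoffel_symm hy']
        ring
      intro k i j
      simp only [Matrix.mul_apply (M := A⁻¹), hs i j]
    · intro k
      have e1 : pdM k (fun z => G' (φ z)) y =
          (pullGam G' φ k y).transpose * G' (φ y) + G' (φ y) * pullGam G' φ k y := by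
        rw [h.chainM hy h.target.smooth]
        simp only [h.target.pdM_metric hy', pullGam, Matrix.transpose_sum, Matrix.transpose_smul,
          Finset.sum_mul, Finset.mul_sum, Matrix.smul_mul, Matrix.mul_smul, smul_add,
          Finset.sum_add_distrib]
      have e2 : pdM k G y = ((pdM k (jac φ) y).transpose * G' (φ y) + A.transpose *
          ((pullGam G' φ k y).transpose * G' (φ y) + G' (φ y) * pullGam G' φ k y)) * A +
          A.transpose * G' (φ y) * pdM k (jac φ) y := by
        rw [pdM_congr hU h.eq hy, pdM_mul (h.jac_smooth.transpose.mul
          (h.comp_smoothM h.target.smooth)) h.jac_smooth hU hy, pdM_mul h.jac_smooth.transpose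
          (h.comp_smoothM h.target.smooth) hU hy, e1, pdM_transpose]
      have e3 : A * A⁻¹ = 1 := h.jac_mul_inv hy
      have e4 : G y * (A⁻¹ * (pdM k (jac φ) y + pullGam G' φ k y * A)) =
          A.transpose * G' (φ y) * (pdM k (jac φ) y + pullGam G' φ k y * A) := by
        rw [h.eq y hy, ← hA, mul_assoc _ A, ← mul_assoc A, e3, one_mul]
      have e5 : (A⁻¹ * (pdM k (jac φ) y + pullGam G' φ k y * A)).transpose * G y =
          (G y * (A⁻¹ * (pdM k (jac φ) y + pullGam G' φ k y * A))).transpose := by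
        rw [Matrix.transpose_mul (G y), h.source.transpose_eq hy]
      rw [e5, e4, e2]
      simp only [Matrix.transpose_mul, Matrix.transpose_add, Matrix.transpose_transpose,
        h.target.transpose_eq hy']
      noncomm_ring
  rw [key, ← mul_assoc, h.jac_mul_inv hy, one_mul]

/-- Curvature is gauge covariant: differentiating dA = AΓ - ωA and alternating yields A R = (dω +
ω∧ω)A. The curvature of the pulled back form ω is the pullback of the curvature of G'. The inverse
of A is kept out so that only products have to be differentiated. -/
lemma jac_mul_curv (h : IsPullback G G' φ U U') (hy : y ∈ U) (i j : Fin d) :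
    jac φ y * curv G i j y =
      (∑ a, ∑ b, (jac φ y a i * jac φ y b j) • curv G' a b (φ y)) * jac φ y := by
  have hU := h.source.isOpen
  have hy' := h.maps y hy
  have hg := h.source.gam_smooth
  have ho := h.pullGam_smooth
  have hj := h.jac_smooth
  have gd : ∀ i j, pdM i (jac φ) y * gam G j y + jac φ y * pdM i (gam G j) y =
      pdM i (pdM j (jac φ)) y +
        (pdM i (pullGam G' φ j) y * jac φ y + pullGam G' φ j y * pdM i (jac φ) y) := by
    intro i j
    rw [← pdM_mul hj (hg j) hU hy, pdM_congr hU (fun z hz => h.jac_mul_gam hz j) hy,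
      pdM_add (hj.pdM hU j) ((ho j).mul hj) hU hy, pdM_mul (ho j) hj hU hy]
  have e0 : ∀ i, pdM i (jac φ) y = jac φ y * gam G i y - pullGam G' φ i y * jac φ y := fun i => by
    rw [h.jac_mul_gam hy]; abel
  have dω : ∀ i j, pdM i (pullGam G' φ j) y = ∑ b, pdM i (jac φ) y b j • gam G' b (φ y) +
      ∑ a, ∑ b, (jac φ y a i * jac φ y b j) • pdM a (gam G' b) (φ y) := by
    intro i j
    ext k l
    have d1 : ∀ b, DifferentiableAt ℝ (fun z => jac φ z b j) y := fun b =>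
      differentiableAt_of_mem (hj b j) hU hy
    have d2 : ∀ b, DifferentiableAt ℝ (fun z => gam G' b (φ z) k l) y := fun b =>
      differentiableAt_of_mem (h.comp_smoothM (h.target.gam_smooth b) k l) hU hy
    simp only [pdM_apply, pullGam_apply]
    rw [pd_fun_sum fun b _ => (d1 b).fun_mul (d2 b), Finset.sum_comm]
    simp only [pd_fun_mul (d1 _) (d2 _), h.chain hy (h.target.gam_smooth _ k l), Matrix.add_apply,
      Matrix.sum_apply, Matrix.smul_apply, smul_eq_mul, pdM_apply, Finset.sum_add_distrib,
      Finset.mul_sum]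
    rw [add_comm]
    congr 1
    · exact Finset.sum_congr rfl fun _ _ => by ring
    · exact Finset.sum_congr rfl fun _ _ => Finset.sum_congr rfl fun _ _ => by ring
  have e1 : jac φ y * curv G i j y = (pdM i (pullGam G' φ j) y - pdM j (pullGam G' φ i) y +
      (pullGam G' φ i y * pullGam G' φ j y - pullGam G' φ j y * pullGam G' φ i y)) * jac φ y := by
    have g1 := gd i j
    have g2 := gd j i
    rw [pdM_comm hj hU hy i j] at g1
    rw [e0 i] at g1
    rw [e0 j] at g2
    have w : jac φ y * pdM i (gam G j) y - jac φ y * pdM j (gam G i) y =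
        (pdM i (pullGam G' φ j) y * jac φ y +
          pullGam G' φ j y * (jac φ y * gam G i y - pullGam G' φ i y * jac φ y)) -
        (jac φ y * gam G i y - pullGam G' φ i y * jac φ y) * gam G j y -
        ((pdM j (pullGam G' φ i) y * jac φ y +
          pullGam G' φ i y * (jac φ y * gam G j y - pullGam G' φ j y * jac φ y)) -
        (jac φ y * gam G j y - pullGam G' φ j y * jac φ y) * gam G i y) := by
      rw [eq_sub_of_add_eq' g1, eq_sub_of_add_eq' g2]
      abel
    rw [curv_eq, mul_add, mul_sub, w]
    noncomm_ring
  -- Second derivatives of φ enter dω only through this sum, which is symmetric in i and j and so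
  -- disappears on alternation.
  have e2 : ∑ b, pdM i (jac φ) y b j • gam G' b (φ y) =
      ∑ b, pdM j (jac φ) y b i • gam G' b (φ y) :=
    Finset.sum_congr rfl fun b _ => by rw [h.pd_jac_symm hy]
  have e3 : ∀ i j, pullGam G' φ i y * pullGam G' φ j y =
      ∑ a, ∑ b, (jac φ y a i * jac φ y b j) • (gam G' a (φ y) * gam G' b (φ y)) := by
    intro i j
    simp only [pullGam, Finset.sum_mul, Finset.mul_sum, Matrix.smul_mul, Matrix.mul_smul, smul_smul]
    rw [Finset.sum_comm]
    exact Finset.sum_congr rfl fun _ _ => Finset.sum_congr rfl fun _ _ => by rw [mul_comm]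
  have e4 : ∀ (F : Fin d → Fin d → Matrix (Fin d) (Fin d) ℝ),
      ∑ a, ∑ b, (jac φ y a j * jac φ y b i) • F a b =
      ∑ a, ∑ b, (jac φ y a i * jac φ y b j) • F b a := by
    intro F
    rw [Finset.sum_comm]
    exact Finset.sum_congr rfl fun _ _ => Finset.sum_congr rfl fun _ _ => by rw [mul_comm]
  rw [e1, dω, dω, e2, e3, e3, e4, e4]
  congr 1
  simp only [curv_eq, smul_add, smul_sub, Finset.sum_add_distrib, Finset.sum_sub_distrib]
  abel

/-- The Ricci tensor is natural. -/
lemma ricci_eq (h : IsPullback G G' φ U U') (hy : y ∈ U) :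
    coordRicci G y = (jac φ y).transpose * coordRicci G' (φ y) * jac φ y := by
  set A := jac φ y with hA
  have e : ∀ i j, curv G i j y =
      A⁻¹ * ((∑ a, ∑ b, (A a i * A b j) • curv G' a b (φ y)) * A) := by
    intro i j
    rw [← h.jac_mul_curv hy, ← mul_assoc, h.inv_mul_jac hy, one_mul]
  ext j l
  have e1 : ∀ a c, ∑ k, A a k * A⁻¹ k c = (1 : Matrix (Fin d) (Fin d) ℝ) a c := by
    intro a c
    rw [← Matrix.mul_apply, h.jac_mul_inv hy]
  have e2 : ∀ k, curv G k j y k l = ∑ a, ∑ b, ∑ c,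
      A b j * (A a k * A⁻¹ k c) * (curv G' a b (φ y) * A) c l := by
    intro k
    rw [e]
    simp only [Finset.sum_mul, Finset.mul_sum, Matrix.smul_mul, Matrix.mul_smul, Matrix.sum_apply,
      Matrix.smul_apply, smul_eq_mul]
    simp only [Matrix.mul_apply (M := A⁻¹), Finset.mul_sum]
    exact Finset.sum_congr rfl fun _ _ => Finset.sum_congr rfl fun _ _ =>
      Finset.sum_congr rfl fun _ _ => by ring
  rw [coordRicci_apply]
  simp only [e2]
  -- The contraction over k meets A A⁻¹ = 1, so the trace for G becomes the trace for G'.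
  have e3 : ∑ k, ∑ a, ∑ b, ∑ c, A b j * (A a k * A⁻¹ k c) * (curv G' a b (φ y) * A) c l =
      ∑ a, ∑ b, A b j * (curv G' a b (φ y) * A) a l := by
    rw [Finset.sum_comm]
    refine Finset.sum_congr rfl fun a _ => ?_
    rw [Finset.sum_comm]
    refine Finset.sum_congr rfl fun b _ => ?_
    rw [Finset.sum_comm]
    simp only [← Finset.sum_mul, ← Finset.mul_sum, e1]
    simp [Matrix.one_apply]
  rw [e3, mul_assoc, Matrix.mul_apply, Finset.sum_comm]
  simp only [Matrix.transpose_apply, Matrix.mul_apply, coordRicci_apply, Finset.mul_sum,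
    Finset.sum_mul]
  refine Finset.sum_congr rfl fun b _ => ?_
  rw [Finset.sum_comm]

/-- The Hessian is natural. -/
lemma hess_eq (h : IsPullback G G' φ U U') {u : Model d → ℝ} (hu : ContDiffOn ℝ ∞ u U')
    (hy : y ∈ U) : coordHess G (fun z => u (φ z)) y =
      (jac φ y).transpose * coordHess G' u (φ y) * jac φ y := by
  have hU := h.source.isOpen
  have hU' := h.target.isOpen
  set A := jac φ y with hA
  ext i j
  have d1 : ∀ a, DifferentiableAt ℝ (fun z => jac φ z a j) y := fun a =>
    differentiableAt_of_mem (h.jac_smooth a j) hU hy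
  have d2 : ∀ a, DifferentiableAt ℝ (fun z => pd a u (φ z)) y := fun a =>
    differentiableAt_of_mem (h.comp_smooth (contDiffOn_pd hu hU' a)) hU hy
  have e1 : pd i (pd j (fun z => u (φ z))) y = ∑ a, pdM i (jac φ) y a j * pd a u (φ y) +
      ∑ a, ∑ b, A a j * (A b i * pd b (pd a u) (φ y)) := by
    rw [pd_congr_on hU (fun z hz => h.chain hz hu j) hy,
      pd_fun_sum fun a _ => (d1 a).fun_mul (d2 a), ← Finset.sum_add_distrib]
    refine Finset.sum_congr rfl fun a _ => ?_
    rw [pd_fun_mul (d1 a) (d2 a), h.chain hy (contDiffOn_pd hu hU' a), Finset.mul_sum, pdM_apply]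
    ring
  have e2 : ∑ k, christoffel G k i j y * pd k (fun z => u (φ z)) y =
      ∑ a, (A * gam G i y) a j * pd a u (φ y) := by
    simp only [h.chain hy hu, Matrix.mul_apply, Finset.mul_sum, Finset.sum_mul, gam_apply]
    rw [Finset.sum_comm]
    exact Finset.sum_congr rfl fun _ _ => Finset.sum_congr rfl fun _ _ => by ring
  have e3 : ∑ a, (A * gam G i y) a j * pd a u (φ y) = ∑ a, pdM i (jac φ) y a j * pd a u (φ y) +
      ∑ c, ∑ b, A c j * (A b i * ∑ a, christoffel G' a b c (φ y) * pd a u (φ y)) := by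
    rw [h.jac_mul_gam hy]
    simp only [Matrix.add_apply, add_mul, Finset.sum_add_distrib, Matrix.mul_apply, pullGam_apply,
      Finset.sum_mul, Finset.mul_sum, gam_apply]
    congr 1
    rw [Finset.sum_comm]
    refine Finset.sum_congr rfl fun c _ => ?_
    rw [Finset.sum_comm]
    exact Finset.sum_congr rfl fun _ _ => Finset.sum_congr rfl fun _ _ => by ring
  have e4 : (A.transpose * coordHess G' u (φ y) * A) i j =
      ∑ c, ∑ b, A c j * (A b i * coordHess G' u (φ y) b c) := by
    simp only [Matrix.mul_apply, Matrix.transpose_apply, Finset.sum_mul]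
    exact Finset.sum_congr rfl fun _ _ => Finset.sum_congr rfl fun _ _ => by ring
  rw [e4]
  simp only [coordHess, Matrix.of_apply]
  rw [e1, e2, e3]
  simp only [mul_sub, Finset.sum_sub_distrib]
  ring

/-- Metric traces are natural. -/
lemma trace_eq (h : IsPullback G G' φ U U') (hy : y ∈ U) (T : Matrix (Fin d) (Fin d) ℝ) :
    ∑ i, ∑ j, (G y)⁻¹ i j * ((jac φ y).transpose * T * jac φ y) i j =
      ∑ i, ∑ j, (G' (φ y))⁻¹ i j * T i j := by
  rw [h.source.sum_inv_mul_eq_trace hy, h.target.sum_inv_mul_eq_trace (h.maps y hy), h.eq y hy,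
    Matrix.mul_inv_rev, Matrix.mul_inv_rev]
  have hT : ((jac φ y).transpose)⁻¹ * (jac φ y).transpose = 1 :=
    Matrix.nonsing_inv_mul _ (by rw [Matrix.det_transpose]; exact h.isUnit_jac hy)
  calc _ = ((jac φ y).transpose * (T * (jac φ y * (jac φ y)⁻¹) * (G' (φ y))⁻¹ *
        ((jac φ y).transpose)⁻¹)).trace := by simp only [mul_assoc]
    _ = _ := by
      rw [Matrix.trace_mul_comm, h.jac_mul_inv hy, mul_one, mul_assoc _ _ (jac φ y).transpose, hT,
        mul_one]

lemma eq_zero_of_pullback (h : IsPullback G G' φ U U') (hy : y ∈ U) {T : Matrix (Fin d) (Fin d) ℝ}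
    (hT : (jac φ y).transpose * T * jac φ y = 0) : T = 0 := by
  have h1 : ((jac φ y).transpose)⁻¹ * (jac φ y).transpose = 1 :=
    Matrix.nonsing_inv_mul _ (by rw [Matrix.det_transpose]; exact h.isUnit_jac hy)
  calc T = ((jac φ y).transpose)⁻¹ * (jac φ y).transpose * T * (jac φ y * (jac φ y)⁻¹) := by
        rw [h1, h.jac_mul_inv hy, one_mul, mul_one]
    _ = ((jac φ y).transpose)⁻¹ * ((jac φ y).transpose * T * jac φ y) * (jac φ y)⁻¹ := by
        simp only [mul_assoc]
    _ = 0 := by rw [hT, mul_zero, zero_mul]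

lemma coordJ_eq (h : IsPullback G G' φ U U') (hy : y ∈ U) : coordJ G y = coordJ G' (φ y) := by
  rw [coordJ, h.ricci_eq hy, h.trace_eq hy, coordJ]

lemma coordP_eq (h : IsPullback G G' φ U U') (hy : y ∈ U) :
    coordP G y = (jac φ y).transpose * coordP G' (φ y) * jac φ y := by
  rw [coordP, coordP, h.ricci_eq hy, h.coordJ_eq hy, h.eq y hy]
  simp only [Matrix.mul_smul, Matrix.smul_mul, mul_sub, sub_mul]

end IsPullback

end ChartChange

/-! ### Tensors in charts -/

section Charts

variable {d : ℕ} {M : Type*} [TopologicalSpace M] [ChartedSpace (Model d) M]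

lemma origin_mem (x : M) : origin d x ∈ (extChartAt (𝓡 d) x).target := mem_extChartAt_target x

lemma isOpen_target (x : M) : IsOpen (extChartAt (𝓡 d) x).target := isOpen_extChartAt_target x

/-- The derivative of the inverse of the chart at `x`, in the trivialisations of the tangent bundle
by the preferred charts. -/
noncomputable def symmDeriv (x : M) (y : Model d) : Model d →L[ℝ] Model d :=
  mfderiv 𝓘(ℝ, Model d) (𝓡 d) (extChartAt (𝓡 d) x).symm y

/-- A field of bilinear forms in the trivialisations of the tangent bundle by the preferred charts.
-/
def bilinAt (b : BilinField d M) (p : M) : Model d →L[ℝ] Model d →L[ℝ] ℝ := b p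

lemma chartMetric_eq (b : BilinField d M) (x : M) (y : Model d) (i j : Fin d) :
    chartMetric b x y i j = bilinAt b ((extChartAt (𝓡 d) x).symm y)
      (symmDeriv x y (stdVec i)) (symmDeriv x y (stdVec j)) := rfl

/-- The domain of the change from the chart at `x` to the chart at `x'`. -/
def overlap (x x' : M) : Set (Model d) := ((extChartAt (𝓡 d) x).symm ≫ extChartAt (𝓡 d) x').source

/-- The change from the chart at `x` to the chart at `x'`. -/
noncomputable def chartChange (x x' : M) (y : Model d) : Model d :=
  extChartAt (𝓡 d) x' ((extChartAt (𝓡 d) x).symm y)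

lemma mem_overlap {x x' : M} {y : Model d} : y ∈ overlap x x' ↔
    y ∈ (extChartAt (𝓡 d) x).target ∧
      (extChartAt (𝓡 d) x).symm y ∈ (extChartAt (𝓡 d) x').source := by
  simp [overlap, PartialEquiv.trans_source]

lemma isOpen_overlap (x x' : M) : IsOpen (overlap (d := d) x x') := by
  have : overlap (d := d) x x' = (extChartAt (𝓡 d) x).target ∩
      (extChartAt (𝓡 d) x).symm ⁻¹' (extChartAt (𝓡 d) x').source := by
    ext y
    exact mem_overlap
  rw [this]
  exact (continuousOn_extChartAt_symm x).isOpen_inter_preimage (isOpen_target x)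
    (isOpen_extChartAt_source x')

lemma symm_chartChange {x x' : M} {y : Model d} (hy : y ∈ overlap x x') :
    (extChartAt (𝓡 d) x').symm (chartChange x x' y) = (extChartAt (𝓡 d) x).symm y :=
  (extChartAt (𝓡 d) x').left_inv (mem_overlap.1 hy).2

lemma chartChange_mem {x x' : M} {y : Model d} (hy : y ∈ overlap x x') :
    chartChange x x' y ∈ (extChartAt (𝓡 d) x').target :=
  (extChartAt (𝓡 d) x').map_source (mem_overlap.1 hy).2

lemma chartFun_chartChange {x x' : M} (f : M → ℝ) {y : Model d} (hy : y ∈ overlap x x') :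
    chartFun x f y = chartFun x' f (chartChange x x' y) := by
  simp only [chartFun, Function.comp, symm_chartChange hy]

lemma origin_mem_overlap {x x' : M} (h : x ∈ (extChartAt (𝓡 d) x').source) :
    origin d x ∈ overlap x x' := by
  refine mem_overlap.2 ⟨origin_mem x, ?_⟩
  rwa [origin, extChartAt_to_inv x]

lemma chartChange_origin (x x' : M) :
    chartChange x x' (origin d x) = extChartAt (𝓡 d) x' x := by
  rw [chartChange, origin, extChartAt_to_inv x]

variable [IsManifold (𝓡 d) ∞ M]

lemma mdifferentiableAt_symm (x : M) {y : Model d} (hy : y ∈ (extChartAt (𝓡 d) x).target) :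
    MDifferentiableAt 𝓘(ℝ, Model d) (𝓡 d) (extChartAt (𝓡 d) x).symm y :=
  (((contMDiffOn_extChartAt_symm (n := ∞) x) y hy).contMDiffAt
    ((isOpen_target x).mem_nhds hy)).mdifferentiableAt (by simp)

/-- The derivative at its own centre of a chart is the identity. -/
lemma symmDeriv_origin (x : M) : symmDeriv x (origin d x) = ContinuousLinearMap.id ℝ (Model d) := by
  have e : (extChartAt (𝓡 d) x).symm (origin d x) = x := extChartAt_to_inv x
  have h0 : symmDeriv x (origin d x) = fderivWithin ℝ (writtenInExtChartAt 𝓘(ℝ, Model d) (𝓡 d)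
      (origin d x) (extChartAt (𝓡 d) x).symm) (Set.range 𝓘(ℝ, Model d))
      (extChartAt 𝓘(ℝ, Model d) (origin d x) (origin d x)) :=
    (mdifferentiableAt_symm x (origin_mem x)).mfderiv
  rw [h0]
  simp only [writtenInExtChartAt, e, extChartAt_model_space_eq_id, PartialEquiv.refl_symm,
    PartialEquiv.refl_coe, Function.comp_id, id_eq, modelWithCornersSelf_coe, Set.range_id,
    fderivWithin_univ]
  have h : (extChartAt (𝓡 d) x ∘ (extChartAt (𝓡 d) x).symm) =ᶠ[𝓝 (origin d x)] id := by
    filter_upwards [(isOpen_target x).mem_nhds (origin_mem x)] with z hz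
    exact (extChartAt (𝓡 d) x).right_inv hz
  exact h.fderiv_eq.trans fderiv_id

lemma metricAt_apply (b : BilinField d M) (x : M) (i j : Fin d) :
    metricAt b x i j = b x (frame x i) (frame x j) := by
  rw [metricAt, chartMetric_eq, symmDeriv_origin, origin, extChartAt_to_inv x]
  rfl

/-- The coordinate field is the image of a constant field under the tangent map of the inverse
chart, which is smooth on the open target. -/
lemma contMDiffAt_chartVec (x : M) (i : Fin d) {y : Model d}
    (hy : y ∈ (extChartAt (𝓡 d) x).target) :
    ContMDiffAt 𝓘(ℝ, Model d) (𝓡 d).tangent ∞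
      (fun z => (⟨(extChartAt (𝓡 d) x).symm z, chartVec x i z⟩ : TangentBundle (𝓡 d) M)) y := by
  have h1 := (contMDiffOn_extChartAt_symm (I := 𝓡 d) (n := ∞) x).contMDiffOn_tangentMapWithin
    (m := ∞) (by simp) (isOpen_target x).uniqueMDiffOn
  have h2 : ContMDiff 𝓘(ℝ, Model d) 𝓘(ℝ, Model d).tangent ∞
      (fun z => (⟨z, (stdVec i : Model d)⟩ : TangentBundle 𝓘(ℝ, Model d) (Model d))) :=
    contMDiff_vectorSpace_iff_contDiff.2 contDiff_const
  have h3 := h1.comp (h2.contMDiffOn (s := (extChartAt (𝓡 d) x).target)) (fun z hz => hz)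
  refine (h3.contMDiffAt ((isOpen_target x).mem_nhds hy)).congr_of_eventuallyEq ?_
  filter_upwards [(isOpen_target x).mem_nhds hy] with z hz
  simp only [Function.comp, tangentMapWithin, chartVec]
  rw [mfderivWithin_of_isOpen (isOpen_target x) hz]

/-- This makes the coordinate calculus available on the whole target of a chart. Smoothness is that
of the bundle metric evaluated on two smooth coordinate fields; nondegeneracy is positivity, as the
derivative of the inverse chart is injective. -/
lemma isMetricOn_chartMetric (g : Metric d M) (x : M) :
    IsMetricOn (chartMetric g.inner x) (extChartAt (𝓡 d) x).target where
  isOpen := isOpen_target x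
  symm y hy i j := g.symm _ _ _
  smooth i j y hy := by
    have hb : ContMDiffAt 𝓘(ℝ, Model d) (𝓡 d) ∞ (extChartAt (𝓡 d) x).symm y :=
      ((contMDiffOn_extChartAt_symm (n := ∞) x) y hy).contMDiffAt ((isOpen_target x).mem_nhds hy)
    have : ContMDiffAt 𝓘(ℝ, Model d) ((𝓡 d).prod 𝓘(ℝ)) ∞
        (fun z => TotalSpace.mk' ℝ (E := Bundle.Trivial M ℝ) ((extChartAt (𝓡 d) x).symm z)
          (g.inner _ (chartVec x i z) (chartVec x j z))) y := by
      apply ContMDiffAt.clm_bundle_apply₂ (F₁ := Model d) (F₂ := Model d)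
      · exact ContMDiffAt.comp y g.contMDiff.contMDiffAt hb
      · exact contMDiffAt_chartVec x i hy
      · exact contMDiffAt_chartVec x j hy
    simp only [contMDiffAt_totalSpace] at this
    exact (contMDiffAt_iff_contDiffAt.1 this.2).contDiffWithinAt
  det y hy := by
    rw [isUnit_iff_ne_zero]
    intro h0
    obtain ⟨v, hv, hM⟩ := Matrix.exists_mulVec_eq_zero_iff.2 h0
    set L : Model d →L[ℝ] TangentSpace (𝓡 d) ((extChartAt (𝓡 d) x).symm y) :=
      mfderiv 𝓘(ℝ, Model d) (𝓡 d) (extChartAt (𝓡 d) x).symm y with hL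
    have hinj : Function.Injective L := by
      have := isInvertible_mfderivWithin_extChartAt_symm (I := 𝓡 d) (x := x) hy
      rw [modelWithCornersSelf_coe, Set.range_id, mfderivWithin_univ] at this
      exact this.injective
    set V : Model d := ∑ i, v i • stdVec i with hV
    have hVi : ∀ i, V i = v i := by
      intro i
      simp [hV, stdVec, Pi.single_apply]
    have hV0 : V ≠ 0 := by
      intro hz
      apply hv
      ext i
      rw [← hVi i, hz]
      rfl
    have hpos := g.pos _ (L V) (fun hz => hV0 (hinj (by rw [hz, map_zero])))
    have : g.inner _ (L V) (L V) = v ⬝ᵥ (chartMetric g.inner x y).mulVec v := by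
      simp only [hV, map_sum, map_smul, dotProduct, Matrix.mulVec, Finset.mul_sum, sum_apply,
        smul_apply, smul_eq_mul]
      refine Finset.sum_comm.trans
        (Finset.sum_congr rfl fun i _ => Finset.sum_congr rfl fun j _ => ?_)
      exact (by intros; ring : ∀ a b c : ℝ, a * (b * c) = b * (c * a)) _ _ _
    rw [this, hM] at hpos
    simp at hpos

lemma contDiffOn_chartFun (x : M) {f : M → ℝ} (hf : ContMDiff (𝓡 d) 𝓘(ℝ, ℝ) ∞ f) :
    ContDiffOn ℝ ∞ (chartFun x f) (extChartAt (𝓡 d) x).target :=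
  contMDiffOn_iff_contDiffOn.1
    (hf.comp_contMDiffOn (contMDiffOn_extChartAt_symm (I := 𝓡 d) (n := ∞) x))

lemma chartForm_diff (x : M) {f : M → ℝ} (hf : ContMDiff (𝓡 d) 𝓘(ℝ, ℝ) ∞ f) (i : Fin d)
    {y : Model d} (hy : y ∈ (extChartAt (𝓡 d) x).target) :
    chartForm (diff d f) x i y = pd i (chartFun x f) y := by
  have h := mfderiv_comp y (hf.mdifferentiable (by simp) ((extChartAt (𝓡 d) x).symm y))
    (mdifferentiableAt_symm x hy)
  rw [pd, chartFun, ← mfderiv_eq_fderiv]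
  exact (congrArg (fun L : Model d →L[ℝ] ℝ => L (stdVec i)) h).symm

lemma contDiffOn_chartChange (x x' : M) :
    ContDiffOn ℝ ∞ (chartChange (d := d) x x') (overlap x x') :=
  contDiffOn_ext_coord_change (I := 𝓡 d) x' x

/-- The chain rule for the inverse chart at x, factored locally through the transition map. The
transformation law of the metric components follows from it. -/
lemma symmDeriv_chartChange {x x' : M} {y : Model d} (hy : y ∈ overlap x x') (i : Fin d) :
    symmDeriv x y (stdVec i) = ∑ a, jac (chartChange x x') y a i •
      symmDeriv x' (chartChange x x' y) (stdVec a) := by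
  have hφ : DifferentiableAt ℝ (chartChange (d := d) x x') y :=
    ((contDiffOn_chartChange x x').contDiffAt ((isOpen_overlap x x').mem_nhds hy)).differentiableAt
      (by simp)
  have h1 : (extChartAt (𝓡 d) x).symm =ᶠ[𝓝 y]
      (extChartAt (𝓡 d) x').symm ∘ chartChange x x' := by
    filter_upwards [(isOpen_overlap x x').mem_nhds hy] with z hz
    exact (symm_chartChange hz).symm
  have h2 := ((mdifferentiableAt_symm x' (chartChange_mem hy)).hasMFDerivAt.comp y
    hφ.hasFDerivAt.hasMFDerivAt).congr_of_eventuallyEq h1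
  have h3 : symmDeriv x y =
      (symmDeriv x' (chartChange x x' y)).comp (fderiv ℝ (chartChange x x') y) := h2.mfderiv
  have h4 : ∀ a, jac (chartChange x x') y a i = (fderiv ℝ (chartChange x x') y (stdVec i)) a := by
    intro a
    change fderiv ℝ ((EuclideanSpace.proj (𝕜 := ℝ) a : Model d →L[ℝ] ℝ) ∘ chartChange x x') y
      (stdVec i) = _
    rw [((EuclideanSpace.proj (𝕜 := ℝ) a : Model d →L[ℝ] ℝ).hasFDerivAt.comp y
      hφ.hasFDerivAt).fderiv]
    rfl
  rw [h3, ContinuousLinearMap.comp_apply]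
  conv_lhs => rw [← sum_smul_stdVec (fderiv ℝ (chartChange x x') y (stdVec i))]
  simp only [map_sum, map_smul, h4]

lemma chartMetric_chartChange (b : BilinField d M) {x x' : M} {y : Model d}
    (hy : y ∈ overlap x x') : chartMetric b x y =
      (jac (chartChange x x') y).transpose * chartMetric b x' (chartChange x x' y) *
        jac (chartChange x x') y := by
  ext i j
  simp only [Matrix.mul_apply, Matrix.transpose_apply, chartMetric_eq]
  rw [symm_chartChange hy, symmDeriv_chartChange hy i, symmDeriv_chartChange hy j]
  simp only [map_sum, map_smul, Finset.sum_mul, sum_apply, smul_apply, smul_eq_mul, Finset.mul_sum]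
  exact Finset.sum_congr rfl fun _ _ => Finset.sum_congr rfl fun _ _ => by ring

/-- Tensors at a point are defined in the chart preferred at that point, which varies with the
point. This is the bridge by which such pointwise quantities are expressed in one fixed chart and
can be differentiated there. -/
lemma isPullback_chartChange (g : Metric d M) (x x' : M) :
    IsPullback (chartMetric g.inner x) (chartMetric g.inner x') (chartChange x x')
      (overlap x x') (extChartAt (𝓡 d) x').target where
  source := (isMetricOn_chartMetric g x).mono (isOpen_overlap x x') fun _ hy => (mem_overlap.1 hy).1
  target := isMetricOn_chartMetric g x'
  smooth := contDiffOn_chartChange x x'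
  maps _ hz := chartChange_mem hz
  eq _ hz := chartMetric_chartChange g.inner hz

end Charts

/-! ### Consequences of the almost Einstein equation in coordinates -/

section AlmostEinstein

variable {d : ℕ} {U : Set (Model d)} {y : Model d} {G G' : Model d → Matrix (Fin d) (Fin d) ℝ}
  {u r : Model d → ℝ}

/-- If `∇∇u + uP + rg = 0` then `|du|² + 2 ur` is constant. -/
lemma IsMetricOn.pd_normSq (hG : IsMetricOn G U) (hd : 3 ≤ d) (hu : ContDiffOn ℝ ∞ u U)
    (hr : ContDiffOn ℝ ∞ r U)
    (h : ∀ z ∈ U, coordHess G u z + u z • coordP G z + r z • G z = 0) (hy : y ∈ U) (c : Fin d) :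
    pd c (fun z => ∑ i, ∑ j, (G z)⁻¹ i j * (pd i u z * pd j u z) + 2 * (u z * r z)) y = 0 := by
  have hU := hG.isOpen
  set V : Fin d → Model d → ℝ := fun a z => ∑ b, (G z)⁻¹ a b * pd b u z with hV
  have dV : ∀ a, DifferentiableAt ℝ (V a) y := fun a => differentiableAt_of_mem
    (ContDiffOn.sum fun b _ => (hG.inv_smooth a b).mul (contDiffOn_pd hu hU b)) hU hy
  have dp : ∀ a, DifferentiableAt ℝ (pd a u) y := fun a =>
    differentiableAt_of_mem (contDiffOn_pd hu hU a) hU hy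
  have du := differentiableAt_of_mem hu hU hy
  have dr := differentiableAt_of_mem hr hU hy
  have e0 : (fun z => ∑ i, ∑ j, (G z)⁻¹ i j * (pd i u z * pd j u z) + 2 * (u z * r z)) =
      fun z => ∑ i, V i z * pd i u z + 2 * (u z * r z) := by
    ext z
    congr 1
    simp only [hV, Finset.sum_mul]
    exact Finset.sum_congr rfl fun _ _ => Finset.sum_congr rfl fun _ _ => by ring
  have e1 : ∀ a, pd c (V a) y = (coordHess G u y * (G y)⁻¹) c a -
      ∑ p, christoffel G a c p y * V p y := fun a => by
    rw [hG.hess_mul_inv hu hy]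
    ring
  have e2 : ∀ a, pd c (pd a u) y = coordHess G u y c a + ∑ p, christoffel G p c a y * pd p u y := by
    intro a
    simp only [coordHess, Matrix.of_apply]
    ring
  have e3 : ∑ a, (coordHess G u y * (G y)⁻¹) c a * pd a u y = ∑ a, coordHess G u y c a * V a y := by
    simp only [hV, Matrix.mul_apply, Finset.sum_mul, Finset.mul_sum]
    rw [Finset.sum_comm]
    exact Finset.sum_congr rfl fun _ _ => Finset.sum_congr rfl fun _ _ => by ring
  have e4 : ∑ a, (∑ p, christoffel G a c p y * V p y) * pd a u y =
      ∑ a, V a y * ∑ p, christoffel G p c a y * pd p u y := by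
    simp only [Finset.sum_mul, Finset.mul_sum]
    rw [Finset.sum_comm]
    exact Finset.sum_congr rfl fun _ _ => Finset.sum_congr rfl fun _ _ => by ring
  -- The equation contracted with the gradient V of u.
  have e5 : ∑ a, coordHess G u y c a * V a y =
      - (u y * ∑ a, coordP G y c a * V a y) - r y * pd c u y := by
    have hg : ∑ a, G y c a * V a y = pd c u y := hG.sum_metric_grad hy (fun b => pd b u y) c
    rw [← hg, Finset.mul_sum, Finset.mul_sum, ← Finset.sum_neg_distrib, ← Finset.sum_sub_distrib]
    refine Finset.sum_congr rfl fun a _ => ?_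
    have := congrFun (congrFun (h y hy) c) a
    simp only [Matrix.add_apply, Matrix.smul_apply, smul_eq_mul, Matrix.zero_apply] at this
    linear_combination V a y * this
  have e6 : pd c r y = ∑ a, coordP G y c a * V a y := by
    rw [hG.pd_of_almostEinstein hd hu hr h hy]
    simp only [hV, Finset.mul_sum]
    exact Finset.sum_congr rfl fun _ _ => Finset.sum_congr rfl fun _ _ => by ring
  -- Compatibility with the metric: the Christoffel terms from du and from its gradient cancel, so
  -- d|du|² = 2∇∇u(∇u, ·).
  have e7 : ∑ a, (V a y * pd c (pd a u) y + pd a u y * pd c (V a) y) =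
      2 * ∑ a, coordHess G u y c a * V a y := by
    have : ∀ a, V a y * pd c (pd a u) y + pd a u y * pd c (V a) y =
        coordHess G u y c a * V a y + V a y * (∑ p, christoffel G p c a y * pd p u y) +
        (coordHess G u y * (G y)⁻¹) c a * pd a u y -
          (∑ p, christoffel G a c p y * V p y) * pd a u y := fun a => by
      rw [e1, e2]
      ring
    simp only [this, Finset.sum_add_distrib, Finset.sum_sub_distrib, e3, e4]
    ring
  rw [e0, pd_fun_add (DifferentiableAt.fun_sum fun a _ => (dV a).fun_mul (dp a))
    ((du.fun_mul dr).const_mul 2), pd_const_mul 2 (du.fun_mul dr), pd_fun_mul du dr,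
    pd_fun_sum fun a _ => (dV a).fun_mul (dp a)]
  simp only [pd_fun_mul (dV _) (dp _)]
  rw [e7, e5, e6]
  ring

/-- If `∇∇u + uP + rg = 0` then `u⁻² g` is Einstein. -/
lemma IsMetricOn.ricci_of_almostEinstein (hG : IsMetricOn G U) (hd : 3 ≤ d)
    (hu : ContDiffOn ℝ ∞ u U) (h0 : ∀ z ∈ U, u z ≠ 0) {ρ : ℝ} (hy : y ∈ U)
    (h : coordHess G u y + u y • coordP G y + ρ • G y = 0)
    (hG' : ∀ z ∈ U, G' z = (u z ^ 2)⁻¹ • G z) :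
    coordRicci G' y = (-((d : ℝ) - 1) *
      (∑ i, ∑ j, (G y)⁻¹ i j * (pd i u y * pd j u y) + 2 * (u y * ρ))) • G' y := by
  have hU := hG.isOpen
  have hd3 : (3 : ℝ) ≤ d := by exact_mod_cast hd
  have hd2 : (d : ℝ) - 2 ≠ 0 := by linarith
  -- `Real.log` is log|·|, so e^{2f} = u⁻² holds for either sign of u.
  set f : Model d → ℝ := fun z => - Real.log (u z) with hfdef
  have hf : ContDiffOn ℝ ∞ f U := (hu.log h0).neg
  have hc : ∀ z ∈ U, G' z = Real.exp (2 * f z) • G z := by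
    intro z hz
    have : Real.exp (2 * f z) = (u z ^ 2)⁻¹ := by
      have e : 2 * f z = -Real.log (u z ^ 2) := by
        rw [Real.log_pow]
        simp only [hfdef]
        push_cast
        ring
      rw [e, Real.exp_neg, Real.exp_log (by have := h0 z hz; positivity)]
    rw [hG' z hz, this]
  have du : ∀ z ∈ U, DifferentiableAt ℝ u z := fun z hz => differentiableAt_of_mem hu hU hz
  have dp : ∀ a, DifferentiableAt ℝ (pd a u) y := fun a =>
    differentiableAt_of_mem (contDiffOn_pd hu hU a) hU hy
  have f1 : ∀ i, ∀ z ∈ U, pd i f z = -(u z)⁻¹ * pd i u z := fun i z hz =>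
    pd_comp (h := fun t => - Real.log t) i (Real.hasDerivAt_log (h0 z hz)).neg (du z hz)
  have hu0 := h0 y hy
  have dinv : DifferentiableAt ℝ (fun z => -(u z)⁻¹) y := ((du y hy).inv hu0).neg
  have i1 : ∀ i, pd i (fun z => -(u z)⁻¹) y = (u y ^ 2)⁻¹ * pd i u y := fun i => by
    have := (hasDerivAt_inv hu0).neg
    rw [neg_neg] at this
    exact pd_comp (h := fun t => -t⁻¹) i this (du y hy)
  have f2 : ∀ i j, pd i (pd j f) y =
      -(u y)⁻¹ * pd i (pd j u) y + (u y ^ 2)⁻¹ * (pd i u y * pd j u y) := by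
    intro i j
    rw [pd_congr_on hU (f1 j) hy, pd_fun_mul dinv (dp j), i1]
    ring
  have f3 : ∀ i j, coordHess G f y i j =
      -(u y)⁻¹ * coordHess G u y i j + (u y ^ 2)⁻¹ * (pd i u y * pd j u y) := by
    intro i j
    simp only [coordHess, Matrix.of_apply, f2, f1 _ y hy, mul_sub, Finset.mul_sum,
      mul_left_comm (christoffel G _ i j y)]
    ring
  set N := ∑ i, ∑ j, (G y)⁻¹ i j * (pd i u y * pd j u y) with hN
  set L := ∑ i, ∑ j, (G y)⁻¹ i j * coordHess G u y i j with hL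
  have hH : ∀ i j, coordHess G u y i j = -(u y * coordP G y i j) - ρ * G y i j := by
    intro i j
    have := congrFun (congrFun h i) j
    simp only [Matrix.add_apply, Matrix.smul_apply, smul_eq_mul, Matrix.zero_apply] at this
    linarith
  have hLJ : L = -(u y * coordJ G y) - ρ * d := by
    rw [hL, ← hG.trace_coordP hd hy, ← hG.trace_self hy]
    simp only [hH, mul_sub, Finset.sum_sub_distrib, Finset.mul_sum, mul_neg,
      Finset.sum_neg_distrib, mul_left_comm ((G y)⁻¹ _ _)]
  have hRic : ∀ i j, coordRicci G y i j = ((d : ℝ) - 2) * coordP G y i j +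
      coordJ G y * G y i j := by
    intro i j
    simp only [coordP, Matrix.smul_apply, Matrix.sub_apply, smul_eq_mul]
    field_simp
    ring
  have s1 : ∑ i, ∑ k, (G y)⁻¹ i k * coordHess G f y i k = -(u y)⁻¹ * L + (u y ^ 2)⁻¹ * N := by
    simp only [f3, hL, hN, Finset.mul_sum, ← Finset.sum_add_distrib]
    exact Finset.sum_congr rfl fun _ _ => Finset.sum_congr rfl fun _ _ => by ring
  have s2 : ∑ i, ∑ k, (G y)⁻¹ i k * (pd i f y * pd k f y) = (u y ^ 2)⁻¹ * N := by
    simp only [f1 _ y hy, hN, Finset.mul_sum]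
    exact Finset.sum_congr rfl fun _ _ => Finset.sum_congr rfl fun _ _ => by field_simp
  ext j l
  -- The gradient terms cancel in ∇∇f - df ⊗ df = -u⁻¹∇∇u, which the equation turns into P + (ρ/u)g.
  -- Hence P drops out of the new Ricci tensor and only multiples of g are left.
  rw [hG.ricci_conformal hf hc hy, s1, s2, f3, f1 j y hy, f1 l y hy, hRic, hLJ, hH, hG' y hy]
  simp only [Matrix.smul_apply, smul_eq_mul]
  field_simp
  ring

/-- The function `(1/d)(Δu - Ju)` in coordinates. -/
noncomputable def coordRho (G : Model d → Matrix (Fin d) (Fin d) ℝ) (u : Model d → ℝ)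
    (y : Model d) : ℝ :=
  (d : ℝ)⁻¹ * (-(∑ i, ∑ j, (G y)⁻¹ i j * coordHess G u y i j) - coordJ G y * u y)

lemma IsMetricOn.coordRho_smooth (hG : IsMetricOn G U) (hu : ContDiffOn ℝ ∞ u U) :
    ContDiffOn ℝ ∞ (coordRho G u) U :=
  contDiffOn_const.mul ((ContDiffOn.sum fun i _ => ContDiffOn.sum fun j _ =>
    (hG.inv_smooth i j).mul (hG.coordHess_smooth hu i j)).neg.sub (hG.coordJ_smooth.mul hu))

/-- As tr P = J, the function ρ is chosen so that adding ρg removes the trace of ∇∇u + uP. The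
almost Einstein equation thus becomes ∇∇u + uP + ρg = 0. -/
lemma IsMetricOn.coordRho_eq (hG : IsMetricOn G U) (hd : 3 ≤ d) (hy : y ∈ U) :
    coordRho G u y =
      -((d : ℝ)⁻¹ * ∑ i, ∑ j, (G y)⁻¹ i j * (coordHess G u y + u y • coordP G y) i j) := by
  simp only [coordRho, ← hG.trace_coordP hd hy, Matrix.add_apply, Matrix.smul_apply, smul_eq_mul,
    mul_add, Finset.sum_add_distrib, mul_left_comm ((G y)⁻¹ _ _) (u y), ← Finset.mul_sum]
  ring

end AlmostEinstein

/-! ### The almost Einstein equation on a manifold -/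

section Global

variable {d : ℕ} {M : Type*} [TopologicalSpace M] [ChartedSpace (Model d) M]

lemma contract_apply (x : M) (T : Matrix (Fin d) (Fin d) ℝ) (v w : TangentSpace (𝓡 d) x) :
    contract x T v w = ∑ j, (∑ i, coords v i * T i j) * coords w j := by
  have h : ∀ (a : Fin d → ℝ) (w : Model d),
      (∑ j, a j • (EuclideanSpace.proj j : Model d →L[ℝ] ℝ)) w = ∑ j, a j * w j := fun a w => by
    simp
  exact h _ w

lemma coords_frame (x : M) (i j : Fin d) :
    coords (frame (d := d) x i) j = (1 : Matrix (Fin d) (Fin d) ℝ) i j := by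
  change (stdVec i : Model d) j = _
  simp [stdVec, Matrix.one_apply, eq_comm]

lemma contract_frame (x : M) (T : Matrix (Fin d) (Fin d) ℝ) (i j : Fin d) :
    contract x T (frame x i) (frame x j) = T i j := by
  simp [contract_apply, coords_frame, Matrix.one_apply]

lemma contract_add (x : M) (T S : Matrix (Fin d) (Fin d) ℝ) (v : TangentSpace (𝓡 d) x) :
    contract x (T + S) v = contract x T v + contract x S v := by
  ext w
  simp [contract_apply, mul_add, add_mul, Finset.sum_add_distrib]

lemma contract_smul (x : M) (r : ℝ) (T : Matrix (Fin d) (Fin d) ℝ) (v : TangentSpace (𝓡 d) x) :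
    contract x (r • T) v = r • contract x T v := by
  ext w
  simp [contract_apply, Finset.mul_sum, mul_left_comm, mul_assoc, Finset.sum_mul]

lemma contract_zero (x : M) (v : TangentSpace (𝓡 d) x) : contract x 0 v = 0 := by
  ext w
  simp [contract_apply]

lemma eq_zero_of_contract (x : M) {T : Matrix (Fin d) (Fin d) ℝ} (h : ∀ v, contract x T v = 0) :
    T = 0 := by
  ext i j
  rw [← contract_frame x T i j, h]
  rfl

lemma sum_coords_frame (x : M) (v : TangentSpace (𝓡 d) x) : ∑ i, coords v i • frame x i = v :=
  sum_smul_stdVec (v : Model d)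

lemma coInner_diff (b : BilinField d M) {x : M} {f : M → ℝ}
    (hf : ContMDiffAt (𝓡 d) 𝓘(ℝ, ℝ) ∞ f x) : coInner b x (diff d f x) (diff d f x) =
      ∑ i, ∑ j, (chartMetric b x (origin d x))⁻¹ i j *
        (pd i (chartFun x f) (origin d x) * pd j (chartFun x f) (origin d x)) := by
  simp only [coInner, diff_frame hf]
  rfl

/-- `(1/d)(Δf - Jf)`. -/
noncomputable def rhoFun (b : BilinField d M) (f : M → ℝ) (x : M) : ℝ :=
  (d : ℝ)⁻¹ * (laplacian b f x - schoutenTrace b x * f x)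

lemma rhoFun_eq (b : BilinField d M) (f : M → ℝ) (x : M) :
    rhoFun b f x = coordRho (chartMetric b x) (chartFun x f) (origin d x) := by
  rw [rhoFun, coordRho, chartFun_origin]
  rfl

lemma contMDiff_of_chartFun {f : M → ℝ}
    (h : ∀ x, ContDiffOn ℝ ∞ (chartFun x f) (extChartAt (𝓡 d) x).target) :
    ContMDiff (𝓡 d) 𝓘(ℝ, ℝ) ∞ f := by
  intro x
  have h1 : ContMDiffAt 𝓘(ℝ, Model d) 𝓘(ℝ, ℝ) ∞ (chartFun x f) (extChartAt (𝓡 d) x x) :=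
    ((h x).contDiffAt ((isOpen_target x).mem_nhds (origin_mem x))).contMDiffAt
  have h2 : ContMDiffAt (𝓡 d) 𝓘(ℝ, ℝ) ∞ (fun p => chartFun x f (extChartAt (𝓡 d) x p)) x :=
    h1.comp x contMDiffAt_extChartAt
  refine h2.congr_of_eventuallyEq ?_
  filter_upwards [extChartAt_source_mem_nhds (I := 𝓡 d) x] with z hz
  simp only [chartFun, Function.comp, (extChartAt (𝓡 d) x).left_inv hz]

variable [IsManifold (𝓡 d) ∞ M]

lemma inner_eq_contract (g : Metric d M) (x : M) (v : TangentSpace (𝓡 d) x) :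
    g.inner x v = contract x (metricAt g.inner x) v := by
  ext w
  rw [contract_apply]
  conv_lhs => rw [← sum_coords_frame x v, ← sum_coords_frame x w]
  simp only [map_sum, map_smul, sum_apply, smul_apply, smul_eq_mul, metricAt_apply, Finset.mul_sum,
    Finset.sum_mul]
  exact Finset.sum_congr rfl fun _ _ => Finset.sum_congr rfl fun _ _ => by ring

lemma covForm_diff (b : BilinField d M) {f : M → ℝ} (hf : ContMDiff (𝓡 d) 𝓘(ℝ, ℝ) ∞ f) (x : M) :
    covForm b (diff d f) x = hess b f x := by
  ext i j
  simp only [covForm, coordCov, hess, coordHess, Matrix.of_apply]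
  rw [pd_congr_on (isOpen_target x) (fun z hz => chartForm_diff x hf j hz) (origin_mem x)]
  simp only [chartForm_diff x hf _ (origin_mem x)]

/-- The almost Einstein equation `∇∇f + fP + ρg = 0` with `ρ = (1/d)(Δf - Jf)`. -/
lemma obstructionA_eq (hd : 3 ≤ d) (g : Metric d M) (f : M → ℝ) (x : M) :
    obstructionA g.inner f x =
      hess g.inner f x + f x • schouten g.inner x + rhoFun g.inner f x • metricAt g.inner x := by
  have h := (isMetricOn_chartMetric g x).coordRho_eq (u := chartFun x f) hd (origin_mem x)
  rw [chartFun_origin] at h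
  rw [obstructionA, rhoFun_eq, h, neg_smul, sub_eq_add_neg]
  rfl

/-- Naturality of the Hessian, of J and of traces, applied to the transition from the chart
preferred at x to a fixed chart around x. -/
lemma rhoFun_chart (g : Metric d M) {f : M → ℝ} (hf : ContMDiff (𝓡 d) 𝓘(ℝ, ℝ) ∞ f) {x x' : M}
    (hx : x ∈ (extChartAt (𝓡 d) x').source) : rhoFun g.inner f x =
      coordRho (chartMetric g.inner x') (chartFun x' f) (extChartAt (𝓡 d) x' x) := by
  have h := isPullback_chartChange g x x'
  have ho := origin_mem_overlap hx
  have e : coordHess (chartMetric g.inner x) (chartFun x f) (origin d x) =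
      coordHess (chartMetric g.inner x) (fun z => chartFun x' f (chartChange x x' z))
        (origin d x) :=
    coordHess_congr (isOpen_overlap (d := d) x x') (fun w hw => chartFun_chartChange f hw) ho
  rw [rhoFun_eq, coordRho, coordRho, e, h.hess_eq (contDiffOn_chartFun x' hf) ho, h.trace_eq ho,
    h.coordJ_eq ho, chartFun_chartChange f ho, chartChange_origin]

/-- In any chart, `ρ` is given by the coordinate expression. -/
lemma chartFun_rhoFun (g : Metric d M) {f : M → ℝ} (hf : ContMDiff (𝓡 d) 𝓘(ℝ, ℝ) ∞ f) (x : M)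
    {y : Model d} (hy : y ∈ (extChartAt (𝓡 d) x).target) :
    chartFun x (rhoFun g.inner f) y = coordRho (chartMetric g.inner x) (chartFun x f) y := by
  rw [chartFun, Function.comp, rhoFun_chart g hf ((extChartAt (𝓡 d) x).map_target hy),
    (extChartAt (𝓡 d) x).right_inv hy]

lemma contMDiff_rhoFun (g : Metric d M) {f : M → ℝ} (hf : ContMDiff (𝓡 d) 𝓘(ℝ, ℝ) ∞ f) :
    ContMDiff (𝓡 d) 𝓘(ℝ, ℝ) ∞ (rhoFun g.inner f) :=
  contMDiff_of_chartFun fun x => ContDiffOn.congr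
    ((isMetricOn_chartMetric g x).coordRho_smooth (contDiffOn_chartFun x hf))
    fun _ hy => chartFun_rhoFun g hf x hy

/-- The almost Einstein equation in an arbitrary chart. -/
lemma almostEinstein_chart (hd : 3 ≤ d) (g : Metric d M) {f : M → ℝ}
    (hf : ContMDiff (𝓡 d) 𝓘(ℝ, ℝ) ∞ f) (h : ∀ x, obstructionA g.inner f x = 0) (x' : M)
    {y : Model d} (hy : y ∈ (extChartAt (𝓡 d) x').target) :
    coordHess (chartMetric g.inner x') (chartFun x' f) y +
      chartFun x' f y • coordP (chartMetric g.inner x') y +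
      coordRho (chartMetric g.inner x') (chartFun x' f) y • chartMetric g.inner x' y = 0 := by
  set x := (extChartAt (𝓡 d) x').symm y with hx
  have hs : x ∈ (extChartAt (𝓡 d) x').source := (extChartAt (𝓡 d) x').map_target hy
  have p := isPullback_chartChange g x x'
  have ho := origin_mem_overlap hs
  have e : chartChange x x' (origin d x) = y := by
    rw [chartChange_origin, hx, (extChartAt (𝓡 d) x').right_inv hy]
  have h0 := h x
  rw [obstructionA_eq hd, rhoFun_chart g hf hs, hess,
    coordHess_congr (isOpen_overlap (d := d) x x') (fun w hw => chartFun_chartChange f hw) ho,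
    p.hess_eq (contDiffOn_chartFun x' hf) ho, show schouten g.inner x = coordP _ _ from rfl,
    p.coordP_eq ho, metricAt, p.eq _ ho, ← chartChange_origin, e] at h0
  apply p.eq_zero_of_pullback ho
  rw [← h0]
  simp only [mul_add, add_mul, Matrix.mul_smul, Matrix.smul_mul]
  rfl

end Global

/-! ### Smoothness of the differential as a section of the cotangent bundle -/

section Global

variable {d : ℕ} {M : Type*} [TopologicalSpace M] [ChartedSpace (Model d) M] [IsManifold (𝓡 d) ∞ M]

lemma contMDiff_diff {f : M → ℝ} (hf : ContMDiff (𝓡 d) 𝓘(ℝ, ℝ) ∞ f) :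
    ContMDiff (𝓡 d) ((𝓡 d).prod 𝓘(ℝ, Model d →L[ℝ] ℝ)) ∞
      (fun x => TotalSpace.mk' (Model d →L[ℝ] ℝ) (E := fun x : M => Cotangent d x) x
        (diff d f x)) := by
  intro x
  rw [contMDiffAt_hom_bundle]
  refine ⟨contMDiffAt_id, ?_⟩
  have := (hf x).mfderiv_const (m := ∞) (by simp)
  refine this.congr_of_eventuallyEq (Filter.Eventually.of_forall fun z => ?_)
  -- The target is the trivial line bundle on the one side and the tangent bundle of ℝ on the other.
  -- Both trivialisations are the identity, so the two coordinate expressions of df agree.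
  have h : (trivializationAt ℝ (fun _ : M => ℝ) x).continuousLinearMapAt ℝ z =
      ContinuousLinearMap.id ℝ ℝ := Bundle.Trivial.continuousLinearMapAt_trivialization ..
  simp only [inTangentCoordinates, ContinuousLinearMap.inCoordinates, id]
  rw [TangentBundle.continuousLinearMapAt_model_space]
  ext v
  exact DFunLike.congr_fun h _

end Global

/-! ### Conformal invariance -/

section ConformalInvariance

variable {d : ℕ} {U : Set (Model d)} {y : Model d} {G G' : Model d → Matrix (Fin d) (Fin d) ℝ}
  {f s s' : Model d → ℝ}

/-- The function `|du|² + 2 uρ` with `ρ = (1/d)(Δu - Ju)`, in coordinates. -/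
noncomputable def coordNormSq (G : Model d → Matrix (Fin d) (Fin d) ℝ) (u : Model d → ℝ)
    (y : Model d) : ℝ :=
  ∑ i, ∑ j, (G y)⁻¹ i j * (pd i u y * pd j u y) + 2 * (u y * coordRho G u y)

/-- The conformal change of `ρ`. -/
lemma IsMetricOn.coordRho_conformal (hG : IsMetricOn G U) (hd : 3 ≤ d)
    (hf : ContDiffOn ℝ ∞ f U) (h : ∀ z ∈ U, G' z = Real.exp (2 * f z) • G z)
    (hs : ContDiffOn ℝ ∞ s U) (hs' : ∀ z ∈ U, s' z = Real.exp (f z) * s z) (hy : y ∈ U) :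
    coordRho G' s' y = (Real.exp (f y))⁻¹ * (coordRho G s y -
      (∑ i, ∑ k, (G y)⁻¹ i k * (pd i f y * pd k s y) +
        s y / 2 * ∑ i, ∑ k, (G y)⁻¹ i k * (pd i f y * pd k f y))) := by
  have hd0 : (d : ℝ) ≠ 0 := by
    have : (3 : ℝ) ≤ d := by exact_mod_cast hd
    linarith
  set c := ∑ i, ∑ k, (G y)⁻¹ i k * (pd i f y * pd k s y) +
    s y / 2 * ∑ i, ∑ k, (G y)⁻¹ i k * (pd i f y * pd k f y) with hc
  rw [(hG.conformal hf h).coordRho_eq hd hy, hG.trace_conformal hy (h y hy),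
    hG.hess_add_schouten_conformal hd hf h hs hs' hy, ← hc, hG.coordRho_eq hd hy]
  have e : ∑ i, ∑ k, (G y)⁻¹ i k *
      (Real.exp (f y) • (coordHess G s y + s y • coordP G y + c • G y)) i k =
      Real.exp (f y) * (∑ i, ∑ k, (G y)⁻¹ i k * (coordHess G s y + s y • coordP G y) i k +
        c * d) := by
    rw [← hG.trace_self hy]
    simp only [Matrix.smul_apply, Matrix.add_apply, smul_eq_mul, Finset.mul_sum, mul_add,
      Finset.sum_add_distrib]
    simp only [mul_left_comm ((G y)⁻¹ _ _)]
  have e2 : Real.exp (2 * f y) = Real.exp (f y) * Real.exp (f y) := by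
    rw [← Real.exp_add]
    ring_nf
  rw [e, e2]
  have := Real.exp_ne_zero (f y)
  field_simp
  ring

/-- Conformal covariance of `∇∇s + sP + ρg`. -/
lemma IsMetricOn.almostEinstein_conformal (hG : IsMetricOn G U) (hd : 3 ≤ d)
    (hf : ContDiffOn ℝ ∞ f U) (h : ∀ z ∈ U, G' z = Real.exp (2 * f z) • G z)
    (hs : ContDiffOn ℝ ∞ s U) (hs' : ∀ z ∈ U, s' z = Real.exp (f z) * s z) (hy : y ∈ U) :
    coordHess G' s' y + s' y • coordP G' y + coordRho G' s' y • G' y =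
      Real.exp (f y) • (coordHess G s y + s y • coordP G y + coordRho G s y • G y) := by
  have e2 : Real.exp (2 * f y) = Real.exp (f y) * Real.exp (f y) := by
    rw [← Real.exp_add]
    ring_nf
  have := Real.exp_ne_zero (f y)
  rw [hG.hess_add_schouten_conformal hd hf h hs hs' hy, hG.coordRho_conformal hd hf h hs hs' hy,
    h y hy, e2]
  ext i j
  simp only [Matrix.smul_apply, Matrix.add_apply, smul_eq_mul]
  field_simp
  ring

/-- Conformal invariance of `|ds|² + 2 sρ`. -/
lemma IsMetricOn.coordNormSq_conformal (hG : IsMetricOn G U) (hd : 3 ≤ d)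
    (hf : ContDiffOn ℝ ∞ f U) (h : ∀ z ∈ U, G' z = Real.exp (2 * f z) • G z)
    (hs : ContDiffOn ℝ ∞ s U) (hs' : ∀ z ∈ U, s' z = Real.exp (f z) * s z) (hy : y ∈ U) :
    coordNormSq G' s' y = coordNormSq G s y := by
  have hU := hG.isOpen
  have df := differentiableAt_of_mem hf hU hy
  have ds := differentiableAt_of_mem hs hU hy
  have e1 : ∀ i, pd i s' y = Real.exp (f y) * (pd i s y + s y * pd i f y) := fun i => by
    rw [pd_congr_on hU hs' hy, pd_fun_mul df.exp ds, pd_exp i df]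
    ring
  have e2 : Real.exp (2 * f y) = Real.exp (f y) * Real.exp (f y) := by
    rw [← Real.exp_add]
    ring_nf
  have e3 : ∑ i, ∑ k, (G y)⁻¹ i k * (pd i s y * pd k f y) =
      ∑ i, ∑ k, (G y)⁻¹ i k * (pd i f y * pd k s y) := by
    rw [Finset.sum_comm]
    exact Finset.sum_congr rfl fun i _ => Finset.sum_congr rfl fun k _ => by
      rw [hG.inv_symm hy, mul_comm (pd _ s y)]
  have e4 : ∑ i, ∑ j, (G' y)⁻¹ i j * (pd i s' y * pd j s' y) =
      ∑ i, ∑ j, (G y)⁻¹ i j * (pd i s y * pd j s y) +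
        2 * s y * ∑ i, ∑ k, (G y)⁻¹ i k * (pd i f y * pd k s y) +
        s y ^ 2 * ∑ i, ∑ k, (G y)⁻¹ i k * (pd i f y * pd k f y) := by
    have := hG.trace_conformal hy (h y hy) (Matrix.of fun i j => pd i s' y * pd j s' y)
    simp only [Matrix.of_apply] at this
    rw [this, e2, two_mul, add_mul (s y) (s y)]
    -- Of the two equal cross terms one is transposed, so that the identity can be checked entry by
    -- entry.
    nth_rewrite 1 [← e3]
    have := Real.exp_ne_zero (f y)
    simp only [e1, Finset.mul_sum, ← Finset.sum_add_distrib]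
    exact Finset.sum_congr rfl fun _ _ => Finset.sum_congr rfl fun _ _ => by
      field_simp
      ring
  rw [coordNormSq, coordNormSq, e4, hG.coordRho_conformal hd hf h hs hs' hy, hs' y hy]
  have := Real.exp_ne_zero (f y)
  field_simp
  ring

end ConformalInvariance

/-! ### Independence of the scale on the manifold -/

section Global

variable {d : ℕ} {M : Type*} [TopologicalSpace M] [ChartedSpace (Model d) M]

/-- `|df|² + 2 fρ` with `ρ = (1/d)(Δf - Jf)`. -/
noncomputable def normSq (b : BilinField d M) (f : M → ℝ) (x : M) : ℝ :=
  coInner b x (diff d f x) (diff d f x) + 2 * (f x * rhoFun b f x)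

/-- The factor 2/d in S is absorbed by ρ, so this is an algebraic identity that needs no equation
for f. -/
lemma scalarS_eq (b : BilinField d M) (f : M → ℝ) (x : M) : scalarS b f x = -normSq b f x := by
  rw [scalarS, normSq, rhoFun]
  ring

lemma normSq_eq (b : BilinField d M) {f : M → ℝ} {x : M}
    (hf : ContMDiffAt (𝓡 d) 𝓘(ℝ, ℝ) ∞ f x) :
    normSq b f x = coordNormSq (chartMetric b x) (chartFun x f) (origin d x) := by
  rw [normSq, coordNormSq, coInner_diff b hf, rhoFun_eq, chartFun_origin]

variable [IsManifold (𝓡 d) ∞ M] {c : ConformalStructure d M}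

lemma chartMetric_logFactor (g g' : c.metrics) (x : M) (y : Model d) :
    chartMetric g'.1.inner x y =
      Real.exp (2 * chartFun x (logFactor g g') y) • chartMetric g.1.inner x y := by
  ext i j
  simp only [chartMetric, Matrix.of_apply, inner_logFactor g g', Matrix.smul_apply, smul_eq_mul]
  rfl

lemma chartFun_inScale (g g' : c.metrics) (σ : SmoothDensity c 1) (x : M) (y : Model d) :
    chartFun x (inScale g' σ.1) y =
      Real.exp (chartFun x (logFactor g g') y) * chartFun x (inScale g σ.1) y := by
  simp only [chartFun, Function.comp, inScale_eq (inner_logFactor g g') σ.2.1, one_mul]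

/-- Both scales are compared in the chart at x, where the coordinate covariance of ∇∇s + sP + ρg
applies. -/
lemma obstructionA_conformal (hd : 3 ≤ d) (g g' : c.metrics) (σ : SmoothDensity c 1) (x : M) :
    obstructionA g'.1.inner (inScale g' σ.1) x =
      Real.exp (logFactor g g' x) • obstructionA g.1.inner (inScale g σ.1) x := by
  have h := (isMetricOn_chartMetric g.1 x).almostEinstein_conformal hd
    (contDiffOn_chartFun x (contMDiff_logFactor g g')) (fun z _ => chartMetric_logFactor g g' x z)
    (contDiffOn_chartFun x (σ.2.2 g)) (fun z _ => chartFun_inScale g g' σ x z) (origin_mem x)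
  simp only [chartFun_origin] at h
  rw [obstructionA_eq hd, obstructionA_eq hd, rhoFun_eq, rhoFun_eq]
  exact h

lemma IsAlmostEinstein.congr (hd : 3 ≤ d) {g : c.metrics} (g' : c.metrics)
    {σ : SmoothDensity c 1} (h : IsAlmostEinstein c g σ.1) : IsAlmostEinstein c g' σ.1 := by
  intro x
  rw [obstructionA_conformal hd g g', h x, smul_zero]

lemma normSq_conformal (hd : 3 ≤ d) (g g' : c.metrics) (σ : SmoothDensity c 1) (x : M) :
    normSq g'.1.inner (inScale g' σ.1) x = normSq g.1.inner (inScale g σ.1) x := by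
  rw [normSq_eq _ (σ.2.2 g' x), normSq_eq _ (σ.2.2 g x)]
  exact (isMetricOn_chartMetric g.1 x).coordNormSq_conformal hd
    (contDiffOn_chartFun x (contMDiff_logFactor g g')) (fun z _ => chartMetric_logFactor g g' x z)
    (contDiffOn_chartFun x (σ.2.2 g)) (fun z _ => chartFun_inScale g g' σ x z) (origin_mem x)

end Global

/-! ### Coordinate preliminaries for the constancy of |df|² + 2fρ -/

section CoordNormSq

variable {d : ℕ} {U : Set (Model d)} {y : Model d} {G : Model d → Matrix (Fin d) (Fin d) ℝ}
  {u : Model d → ℝ}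

lemma fderiv_eq_zero_of_pd (h : ∀ i, pd i u y = 0) : fderiv ℝ u y = 0 := by
  ext v
  rw [← sum_smul_stdVec v, map_sum]
  exact Finset.sum_eq_zero fun i _ => by
    rw [map_smul, show fderiv ℝ u y (stdVec i) = 0 from h i, smul_zero]

lemma IsMetricOn.coordNormSq_smooth (hG : IsMetricOn G U) (hu : ContDiffOn ℝ ∞ u U) :
    ContDiffOn ℝ ∞ (coordNormSq G u) U :=
  (ContDiffOn.sum fun i _ => ContDiffOn.sum fun j _ => (hG.inv_smooth i j).mul
    ((contDiffOn_pd hu hG.isOpen i).mul (contDiffOn_pd hu hG.isOpen j))).add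
    (contDiffOn_const.mul (hu.mul (hG.coordRho_smooth hu)))

end CoordNormSq

/-! ### The prolonged equation on the manifold -/

section Global

variable {d : ℕ} {M : Type*} [TopologicalSpace M] [ChartedSpace (Model d) M] [IsManifold (𝓡 d) ∞ M]

/-- In any chart, `|df|² + 2 fρ` is given by the coordinate expression. -/
lemma chartFun_normSq (g : Metric d M) {f : M → ℝ} (hf : ContMDiff (𝓡 d) 𝓘(ℝ, ℝ) ∞ f) (x' : M)
    {y : Model d} (hy : y ∈ (extChartAt (𝓡 d) x').target) :
    chartFun x' (normSq g.inner f) y = coordNormSq (chartMetric g.inner x') (chartFun x' f) y := by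
  rw [coordNormSq, ← chartFun_rhoFun g hf x' hy]
  change normSq g.inner f ((extChartAt (𝓡 d) x').symm y) = _
  set x := (extChartAt (𝓡 d) x').symm y with hx
  have p := isPullback_chartChange g x x'
  have ho := origin_mem_overlap ((extChartAt (𝓡 d) x').map_target hy)
  rw [← hx] at ho
  have e : chartChange x x' (origin d x) = y := by
    rw [chartChange_origin, hx, (extChartAt (𝓡 d) x').right_inv hy]
  have hp : ∀ i, pd i (chartFun x f) (origin d x) =
      ∑ a, jac (chartChange x x') (origin d x) a i * pd a (chartFun x' f) y := fun i => by
    rw [pd_congr_on (isOpen_overlap (d := d) x x') (fun w hw => chartFun_chartChange f hw) ho,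
      p.chain ho (contDiffOn_chartFun x' hf), e]
  have ht := p.trace_eq ho
    (Matrix.of fun a b => pd a (chartFun x' f) y * pd b (chartFun x' f) y)
  rw [e] at ht
  simp only [Matrix.of_apply] at ht
  rw [normSq, coInner_diff _ (hf x), ← ht]
  congr 1
  refine Finset.sum_congr rfl fun i _ => Finset.sum_congr rfl fun j _ => ?_
  rw [hp, hp]
  simp only [Matrix.mul_apply, Matrix.transpose_apply, Matrix.of_apply, Finset.sum_mul,
    Finset.mul_sum]
  exact Finset.sum_congr rfl fun _ _ => Finset.sum_congr rfl fun _ _ => by ring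

/-- For a solution of the almost Einstein equation, `|df|² + 2 fρ` is locally constant. -/
lemma isLocallyConstant_normSq (hd : 3 ≤ d) (g : Metric d M) {f : M → ℝ}
    (hf : ContMDiff (𝓡 d) 𝓘(ℝ, ℝ) ∞ f) (h : ∀ x, obstructionA g.inner f x = 0) :
    IsLocallyConstant (normSq g.inner f) := by
  rw [IsLocallyConstant.iff_eventually_eq]
  intro x
  have hG := isMetricOn_chartMetric g x
  have hu := contDiffOn_chartFun x hf
  -- A vanishing derivative gives constancy only on a connected set, so the chart is shrunk to a
  -- ball.
  obtain ⟨ε, hε, hb⟩ := Metric.isOpen_iff.1 (isOpen_target (d := d) x) _ (origin_mem x)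
  have hc : ∀ z ∈ Metric.ball (origin d x) ε,
      coordNormSq (chartMetric g.inner x) (chartFun x f) z =
        coordNormSq (chartMetric g.inner x) (chartFun x f) (origin d x) := fun z hz =>
    Metric.isOpen_ball.is_const_of_fderiv_eq_zero (convex_ball _ _).isPreconnected
      (((hG.coordNormSq_smooth hu).differentiableOn (by simp)).mono hb)
      (fun w hw => fderiv_eq_zero_of_pd fun i => hG.pd_normSq hd hu (hG.coordRho_smooth hu)
        (fun v hv => almostEinstein_chart hd g hf h x hv) (hb hw) i) hz (Metric.mem_ball_self hε)
  have hn : (extChartAt (𝓡 d) x) ⁻¹' Metric.ball (origin d x) ε ∈ 𝓝 x :=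
    (continuousAt_extChartAt x).preimage_mem_nhds (Metric.ball_mem_nhds _ hε)
  filter_upwards [hn, extChartAt_source_mem_nhds (I := 𝓡 d) x] with z hz hzs
  rw [normSq_eq _ (hf x), ← hc _ hz, ← chartFun_normSq g hf x (hb hz)]
  simp only [chartFun, Function.comp, (extChartAt (𝓡 d) x).left_inv hzs]

/-- For a solution of the almost Einstein equation, `∇ᵥρ = P(v, ∇f)`. -/
lemma diff_rhoFun (hd : 3 ≤ d) (g : Metric d M) {f : M → ℝ}
    (hf : ContMDiff (𝓡 d) 𝓘(ℝ, ℝ) ∞ f) (h : ∀ x, obstructionA g.inner f x = 0) (x : M)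
    (v : TangentSpace (𝓡 d) x) : diff d (rhoFun g.inner f) x v =
      coInner g.inner x (contract x (schouten g.inner x) v) (diff d f x) := by
  have hG := isMetricOn_chartMetric g x
  have hu := contDiffOn_chartFun x hf
  have key : ∀ k, diff d (rhoFun g.inner f) x (frame x k) =
      ∑ i, ∑ j, (metricAt g.inner x)⁻¹ i j *
        (schouten g.inner x k i * diff d f x (frame x j)) := fun k => by
    rw [diff_frame (contMDiff_rhoFun g hf x),
      pd_congr_on (isOpen_target x) (fun z hz => chartFun_rhoFun g hf x hz) (origin_mem x),
      hG.pd_of_almostEinstein hd hu (hG.coordRho_smooth hu)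
        (fun z hz => almostEinstein_chart hd g hf h x hz) (origin_mem x)]
    simp only [diff_frame (hf x)]
    rfl
  have hc : ∀ i, contract x (schouten g.inner x) v (frame x i) =
      ∑ k, coords v k * schouten g.inner x k i := fun i => by
    simp [contract_apply, coords_frame, Matrix.one_apply]
  conv_lhs => rw [← sum_coords_frame x v]
  simp only [map_sum, map_smul, smul_eq_mul, key, coInner, hc, Finset.sum_mul, Finset.mul_sum]
  rw [Finset.sum_comm]
  refine Finset.sum_congr rfl fun i _ => ?_
  rw [Finset.sum_comm]
  exact Finset.sum_congr rfl fun _ _ => Finset.sum_congr rfl fun _ _ => by ring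

lemma trace_schouten (hd : 3 ≤ d) (g : Metric d M) (x : M) :
    trace g.inner x (schouten g.inner x) = schoutenTrace g.inner x :=
  (isMetricOn_chartMetric g x).trace_coordP hd (origin_mem x)

/-- The trace of the equation is -Δf + dr + fJ = 0. This identifies the bottom slot of a parallel
tractor. -/
lemma eq_rhoFun (hd : 3 ≤ d) (g : Metric d M) (f : M → ℝ) (x : M) {r : ℝ}
    (h : hess g.inner f x + r • metricAt g.inner x + f x • schouten g.inner x = 0) :
    r = rhoFun g.inner f x := by
  have hd0 : (d : ℝ) ≠ 0 := by
    have : (3 : ℝ) ≤ d := by exact_mod_cast hd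
    linarith
  have ht := congrArg (trace g.inner x) h
  rw [trace_add, trace_add, trace_smul, trace_smul, trace_metricAt, trace_schouten hd,
    show trace g.inner x 0 = 0 by simp [trace]] at ht
  rw [rhoFun, laplacian]
  field_simp
  linarith

end Global

/-! ### Parallel tractors -/

section ParallelTractors

variable {d : ℕ} {M : Type*} [TopologicalSpace M] [ChartedSpace (Model d) M] [IsManifold (𝓡 d) ∞ M]
  {c : ConformalStructure d M}

lemma tractorD_zero (x : M) : tractorD c (0 : SmoothDensity c 1) x = 0 :=
  map_zero (toTractor c x)

/-- Where `σ ≠ 0`, the metric `σ⁻² 𝐠` of a solution `σ` of the almost Einstein equation is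
Einstein. -/
lemma ricciAt_scaleMetric (hd : 3 ≤ d) {g : c.metrics} {σ : SmoothDensity c 1}
    (h : IsAlmostEinstein c g σ.1) {x : M} (hx : σ.1 x g ≠ 0) (v w : TangentSpace (𝓡 d) x) :
    contract x (ricciAt (scaleMetric c g σ.1) x) v w =
      -((d : ℝ) - 1) * normSq g.1.inner (inScale g σ.1) x * scaleMetric c g σ.1 x v w := by
  have hf := σ.2.2 g
  set f := inScale g σ.1 with hfdef
  have hu := contDiffOn_chartFun (d := d) x hf
  -- The part of the chart where f does not vanish. It is open by continuity, and there σ⁻²g is a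
  -- metric conformal to g.
  set U := (extChartAt (𝓡 d) x).target ∩ chartFun x f ⁻¹' {0}ᶜ with hU
  have hUo : IsOpen U :=
    hu.continuousOn.isOpen_inter_preimage (isOpen_target x) isOpen_compl_singleton
  have hG := (isMetricOn_chartMetric g.1 x).mono hUo Set.inter_subset_left
  have hy : origin d x ∈ U := ⟨origin_mem x, fun h0 => hx ((chartFun_origin x f).symm.trans h0)⟩
  have hG' : ∀ z, chartMetric (scaleMetric c g σ.1) x z =
      (chartFun x f z ^ 2)⁻¹ • chartMetric g.1.inner x z := fun z => rfl
  have hr := hG.ricci_of_almostEinstein hd (hu.mono Set.inter_subset_left) (fun z hz => hz.2) hy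
    (almostEinstein_chart hd g.1 hf h x hy.1) (fun z _ => hG' z)
  rw [ricciAt, hr, hG', ← coordNormSq, ← normSq_eq _ (hf x), chartFun_origin, contract_smul,
    contract_smul, ← metricAt, ← inner_eq_contract]
  rfl

variable [NeZero d]

lemma splitting_tractorD (g : c.metrics) (σ : SmoothDensity c 1) (x : M) :
    splitting c g x (tractorD c σ x) = (inScale g σ.1 x, diff d (inScale g σ.1) x,
      rhoFun g.1.inner (inScale g σ.1) x) := rfl

/-- Since X = (0, 0, 1) has only a bottom slot, the tractor metric pairs it with the top slot of I
alone. The density represented by 1 in the scale g has value 1 at g, because the logarithmic factor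
from g to itself is zero. -/
lemma pairX_apply (I : ∀ x, TractorFibre c x) (x : M) (g : c.metrics) :
    pairX c I x g = compσ c g I x := by
  have e : ofScale c (-1) g (fun _ => 1) x g = 1 :=
    congrFun (inScale_ofScale (-1) g fun _ : M => (1 : ℝ)) x
  simp [pairX, tractorMetric, canonicalX, coInner, compσ, e]

lemma tractorMetric_tractorD (g : c.metrics) (σ : SmoothDensity c 1) (x : M) :
    tractorMetric c g x (tractorD c σ x) (tractorD c σ x) = normSq g.1.inner (inScale g σ.1) x := by
  rw [tractorMetric, splitting_tractorD, normSq]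
  ring

lemma isSmoothTractor_tractorD (σ : SmoothDensity c 1) : IsSmoothTractor c (tractorD c σ) :=
  fun g => by
    have h1 : compσ c g (tractorD c σ) = inScale g σ.1 := rfl
    have h2 : compμ c g (tractorD c σ) = diff d (inScale g σ.1) := rfl
    have h3 : compρ c g (tractorD c σ) = rhoFun g.1.inner (inScale g σ.1) := rfl
    rw [h1, h2, h3]
    exact ⟨σ.2.2 g, contMDiff_diff (σ.2.2 g), contMDiff_rhoFun g.1 (σ.2.2 g)⟩

lemma pairX_tractorD (σ : SmoothDensity c 1) : pairX c (tractorD c σ) = σ.1 := by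
  ext x g
  rw [pairX_apply]
  rfl

/-- Slot by slot: the first is dσ - dσ, the second is the almost Einstein equation with its trace
restored, and the third is the prolonged equation dρ = P(∇σ). -/
lemma isParallel_tractorD (hd : 3 ≤ d) {g : c.metrics} {σ : SmoothDensity c 1}
    (h : IsAlmostEinstein c g σ.1) : IsParallel c g (tractorD c σ) := by
  intro x v
  refine (LinearEquiv.map_eq_zero_iff _).2 (Prod.ext (sub_self _) (Prod.ext ?_ ?_))
  · change contract x (covForm g.1.inner (diff d (inScale g σ.1)) x) v +
      rhoFun g.1.inner (inScale g σ.1) x • g.1.inner x v +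
        inScale g σ.1 x • contract x (schouten g.1.inner x) v = 0
    have h0 := h x
    rw [obstructionA_eq hd] at h0
    rw [covForm_diff _ (σ.2.2 g), inner_eq_contract, ← contract_smul, ← contract_smul,
      ← contract_add, ← contract_add, add_right_comm, h0, contract_zero]
  · exact sub_eq_zero.2 (diff_rhoFun hd g.1 (σ.2.2 g) h x v)

/-- A parallel tractor comes from a solution of the almost Einstein equation. -/
lemma exists_of_isParallel (hd : 3 ≤ d) {g : c.metrics} {I : ∀ x, TractorFibre c x}
    (hI : IsSmoothTractor c I) (hp : IsParallel c g I) :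
    ∃ σ : SmoothDensity c 1, σ.1 = pairX c I ∧ IsAlmostEinstein c g σ.1 ∧ tractorD c σ = I := by
  have h0 := fun x v => (LinearEquiv.map_eq_zero_iff _).1 (hp x v)
  have hμ : compμ c g I = diff d (compσ c g I) := by
    funext x
    ext v
    exact (sub_eq_zero.1 (congrArg Prod.fst (h0 x v))).symm
  -- The second slot of ∇I = 0, after the first slot has turned ∇μ into a Hessian.
  have hE : ∀ x, hess g.1.inner (compσ c g I) x + compρ c g I x • metricAt g.1.inner x +
      compσ c g I x • schouten g.1.inner x = 0 := by
    intro x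
    refine eq_zero_of_contract x fun v => ?_
    have h1 : contract x (covForm g.1.inner (compμ c g I) x) v + compρ c g I x • g.1.inner x v +
        compσ c g I x • contract x (schouten g.1.inner x) v = 0 :=
      congrArg (fun p => p.2.1) (h0 x v)
    rwa [hμ, covForm_diff _ (hI g).1, inner_eq_contract, ← contract_smul, ← contract_smul,
      ← contract_add, ← contract_add] at h1
  have hρ : ∀ x, compρ c g I x = rhoFun g.1.inner (compσ c g I) x := fun x =>
    eq_rhoFun hd g.1 _ x (hE x)
  have hs : ∀ g' : c.metrics, inScale g' (pairX c I) = compσ c g' I := fun g' =>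
    funext fun x => pairX_apply I x g'
  let σ : SmoothDensity c 1 := ⟨pairX c I, fun x => by
    -- Homogeneity of h(I, X) comes from the jet description: I(x) is the class of a local density
    -- τ, whose value at x is the top slot of I(x) in every scale.
    obtain ⟨τ, hτ⟩ := toTractor_surjective x (I x)
    have : pairX c I x = τ.1 x := by
      ext g'
      rw [pairX_apply, compσ, ← hτ]
      rfl
    rw [this]
    exact τ.2.1 x, fun g' => by rw [hs]; exact (hI g').1⟩
  refine ⟨σ, rfl, fun x => ?_, ?_⟩
  · rw [obstructionA_eq hd, hs, ← hρ, add_right_comm, hE]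
  · funext x
    apply (splitting c g x).injective
    rw [splitting_tractorD, show inScale g σ.1 = compσ c g I from hs g, ← hρ, ← hμ]
    rfl

end ParallelTractors

end Tractor

/-! ### The main theorem -/

open Tractor
theorem mainTheorem3 {n : ℕ} (hn : 2 ≤ n) {M : Type*} [TopologicalSpace M] [T2Space M]
    [SecondCountableTopology M] [ChartedSpace (Model (n + 1)) M] [IsManifold (𝓡 (n + 1)) ∞ M]
    (c : ConformalStructure (n + 1) M) :
    (∀ (g g' : c.metrics) (σ : SmoothDensity c 1), σ ≠ 0 → IsAlmostEinstein c g σ.1 →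
      IsSmoothTractor c (tractorD c σ) ∧ (∃ x, tractorD c σ x ≠ 0) ∧
        IsParallel c g' (tractorD c σ) ∧ pairX c (tractorD c σ) = σ.1) ∧
    (∀ (g g' : c.metrics) (I : ∀ x, TractorFibre c x),
      IsSmoothTractor c I → (∃ x, I x ≠ 0) → IsParallel c g' I →
        ∃ σ : SmoothDensity c 1, σ.1 = pairX c I ∧ σ ≠ 0 ∧ IsAlmostEinstein c g σ.1 ∧
          tractorD c σ = I) ∧
    (∀ (g : c.metrics) (I : ∀ x, TractorFibre c x),
      IsSmoothTractor c I → (∃ x, I x ≠ 0) → IsParallel c g I →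
        (∀ (g₁ g₂ : c.metrics) (x : M), scalarS g₁.1.inner (inScale g₁ (pairX c I)) x =
          -tractorMetric c g₂ x (I x) (I x)) ∧
        (PreconnectedSpace M → ∃ k : ℝ, IsAlmostScalarConstant c (pairX c I) k ∧
          ∀ (g₂ : c.metrics) (x : M), k = -tractorMetric c g₂ x (I x) (I x)) ∧
        (∀ (g₁ g₂ : c.metrics) (x : M), pairX c I x g₁ ≠ 0 → ∀ v w : TangentSpace (𝓡 (n + 1)) x,
          contract x (ricciAt (scaleMetric c g₁ (pairX c I)) x) v w =
            -(n : ℝ) * tractorMetric c g₂ x (I x) (I x) *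
              scaleMetric c g₁ (pairX c I) x v w)) := by
  have hd : 3 ≤ n + 1 := by omega
  have exists_density : ∀ (g g' : c.metrics) (I : ∀ x, TractorFibre c x),
      IsSmoothTractor c I → (∃ x, I x ≠ 0) → IsParallel c g' I →
        ∃ σ : SmoothDensity c 1, σ.1 = pairX c I ∧ σ ≠ 0 ∧ IsAlmostEinstein c g σ.1 ∧
          tractorD c σ = I := by
    rintro g g' I hI ⟨x, hx⟩ hp
    obtain ⟨σ, h1, h2, h3⟩ := exists_of_isParallel hd hI hp
    -- The scale g' in which I is parallel may differ from g. The equation is obtained for g' and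
    -- carried to g by conformal covariance.
    refine ⟨σ, h1, fun h0 => hx ?_, h2.congr hd g, h3⟩
    rw [← h3, h0, tractorD_zero]
  refine ⟨fun g g' σ h0 h => ⟨isSmoothTractor_tractorD σ, ?_,
    isParallel_tractorD hd (h.congr hd g'), pairX_tractorD σ⟩, exists_density, ?_⟩
  -- D is injective: if Dσ vanishes everywhere, then so does σ = h(Dσ, X).
  · by_contra! hz
    apply h0
    ext x g₁
    rw [← pairX_tractorD σ, pairX_apply, compσ, hz x, map_zero]
    rfl
  · intro g I hI hI0 hp
    obtain ⟨σ, h1, h2, h3, rfl⟩ := exists_density g g I hI hI0 hp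
    rw [← h1]
    have hS : ∀ (g₁ g₂ : c.metrics) (x : M), scalarS g₁.1.inner (inScale g₁ σ.1) x =
        -tractorMetric c g₂ x (tractorD c σ x) (tractorD c σ x) := fun g₁ g₂ x => by
      rw [scalarS_eq, tractorMetric_tractorD, normSq_conformal hd g₁ g₂]
    refine ⟨hS, fun _ => ?_, fun g₁ g₂ x hx v w => ?_⟩
    -- `PreconnectedSpace` allows the empty space; the point where I ≠ 0 supplies a base point, and
    -- k is the value of S there.
    · obtain ⟨x₀, -⟩ := hI0
      have hc : ∀ (g₁ : c.metrics) (x : M), scalarS g₁.1.inner (inScale g₁ σ.1) x =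
          -normSq g.1.inner (inScale g σ.1) x₀ := fun g₁ x => by
        rw [scalarS_eq, normSq_conformal hd g g₁,
          (isLocallyConstant_normSq hd g.1 (σ.2.2 g) h3).apply_eq_of_preconnectedSpace x x₀]
      refine ⟨_, ⟨σ.2, fun h => h2 (Subtype.ext h), hc⟩, fun g₂ x => ?_⟩
      rw [← hS g g₂, hc]
    · rw [ricciAt_scaleMetric hd (h3.congr hd g₁) hx, tractorMetric_tractorD,
        normSq_conformal hd g₁ g₂]
      -- The dimension is d = n + 1, so the factor -(d - 1) becomes -n.
      push_cast
      ring
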